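/- Let $k$ be an algebraically closed field of characteristic zero, and let $n\ge 2$, $d\ge 2$. Let $k[x_1,\dots,x_n]$ act on $k[y_1,\dots,y_n]$ by differentiation, $h\circ F:=h(\partial/\partial y_1,\dots,\partial/\partial y_n)F$, and for $F\in k[y_1,\dots,y_n]$ put $F^{\perp}:=\{h\in k[x_1,\dots,x_n] : h\circ F=0\}$. Let $\mathrm{Res}$ be the resultant of $n$ forms of degree $d$ in $n$ variables. Put $K:=\dim_k k[x_1,\dots,x_n]_d=\binom{d+n-1}{n-1}$. For a form $F\in k[y_1,\dots,y_n]_{n(d-1)}$ let $D(F)$ be the catalecticant matrix, whose column indexed by a monomial $m$ of degree $d$ consists of the coefficients of $m\circ F$ with respect to the monomials of degree $n(d-1)-d$. In the affine space $k[y_1,\dots,y_n]_{n(d-1)}$ with the Zariski topology define $$U:=\{F : \operatorname{rank} D(F)=K-n\},\qquad V:=\{F : \operatorname{rank} D(F)\le K-n\},$$ $$\mathrm{Gor}(T):=\{F : k[x_1,\dots,x_n]/F^{\perp}\ \text{has Hilbert function}\ T\},$$ where $T=(t_0,t_1,\dots)$ is given by $\sum_i t_iu^i=(1+u+\dots+u^{d-1})^n$,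 and let $U_{\mathrm{Res}}$ be the set of forms $F$ such that $F^{\perp}\cap k[x_1,\dots,x_n]_d$ is $n$-dimensional and has a basis with nonvanishing resultant. For each choice $\alpha$ of a $(K-n)$-minor of $D(F)$ let $U_\alpha\subset U$ be the open subset where this minor does not vanish. For $F\in U_\alpha$ number the columns of $D(F)$ so that those of the minor come first, let $A(F)$ be the square submatrix of the minor and $B(F)$ the submatrix formed by the same rows and the remaining $n$ columns, and let $r_{j,\alpha}(F)\in k[x_1,\dots,x_n]_d$ be the form with coefficient vector $\gamma_j(F)=(-A(F)^{-1}B(F)e_j,\ e_j)$, $j=1,\dots,n$; these forms are the canonical basis of $F^{\perp}\cap k[x_1,\dots,x_n]_d$. Let $$Z:=\bigcup_\alpha\{F\in U_\alpha : \mathrm{Res}(r_{1,\alpha}(F),\dots,r_{n,\alpha}(F))=0\}\subset U,$$ and let $\overline{Z}$ be its closure. Then $Z$ is closed in $U$, and there exist irreducible components $\mathrm{Gor}(T)^{\circ}$, $U^{\circ}$, $V^{\circ}$ of $\mathrm{Gor}(T)$, $U$, $V$, respectively, such that $$U_{\mathrm{Res}}=\mathrm{Gor}(T)^{\circ}\setminus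 Z=U^{\circ}\setminus Z=V^{\circ}\setminus\overline{Z},$$ and $$\dim\mathrm{Gor}(T)^{\circ}=\dim U^{\circ}=\dim V^{\circ}=Kn-n^2+1.$$ -/

import Mathlib

open MvPolynomial Topology

namespace Catalecticant

/-! ### Forms, their coefficients, and the Zariski topology -/

/-- Exponent vectors of the monomials of degree `j` in `n` variables. -/
abbrev Monom (n j : ℕ) : Type := {m : Fin n →₀ ℕ // m.degree = j}

noncomputable instance instFintypeMonom (n j : ℕ) : Fintype (Monom n j) :=
  (Finsupp.finite_of_degree_eq (σ := Fin n) j).fintype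

/-- The vector space `k[y₁, …, yₙ]_j` of forms of degree `j`. -/
abbrev Form (k : Type*) [Field k] (n j : ℕ) : Type _ :=
  ↥(homogeneousSubmodule (Fin n) k j)

/-- The vector of coefficients of a polynomial at the monomials of degree `j`. -/
def coeffVec {k : Type*} [Field k] {n : ℕ} (j : ℕ) (F : MvPolynomial (Fin n) k) :
    Monom n j → k :=
  fun m => coeff m.1 F

/-- The common zeros, in the affine space of forms of degree `j`, of a set of polynomials in the
coefficients of a form. -/
def formZeros {k : Type*} [Field k] {n j : ℕ} (S : Set (MvPolynomial (Monom n j) k)) :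
    Set (Form k n j) :=
  {F | ∀ p ∈ S, eval (coeffVec j F.1) p = 0}

/-- The Zariski topology on the affine space of forms of degree `j`: the closed sets are the
common zero sets of polynomials in the coefficients. -/
instance instZariski {k : Type*} [Field k] {n j : ℕ} : TopologicalSpace (Form k n j) :=
  TopologicalSpace.ofClosed {C | ∃ S : Set (MvPolynomial (Monom n j) k), C = formZeros S}
    ⟨{1}, by ext F; simp [formZeros]⟩
    (by
      intro A hA
      refine ⟨{p | ∃ S : Set (MvPolynomial (Monom n j) k), formZeros S ∈ A ∧ p ∈ S}, ?_⟩
      ext F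
      constructor
      · rintro hF p ⟨S, hS, hp⟩
        exact hF _ hS p hp
      · intro hF C hC
        obtain ⟨S, rfl⟩ := hA hC
        exact fun p hp => hF p ⟨S, hC, hp⟩)
    (by
      rintro _ ⟨S, rfl⟩ _ ⟨S', rfl⟩
      refine ⟨{p | ∃ q ∈ S, ∃ q' ∈ S', p = q * q'}, ?_⟩
      ext F
      constructor
      · rintro (h | h) _ ⟨q, hq, q', hq', rfl⟩
        · simp [h q hq]
        · simp [h q' hq']
      · intro h
        by_contra hcon
        simp only [Set.mem_union, formZeros, Set.mem_ofPred_eq, not_or, not_forall] at hcon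
        obtain ⟨⟨q, hq, hq0⟩, q', hq', hq0'⟩ := hcon
        have := h _ ⟨q, hq, q', hq', rfl⟩
        rw [map_mul] at this
        exact (mul_ne_zero hq0 hq0') this)

/-- `C` is an irreducible component of the subset `X` of a topological space. -/
def IsIrredComponentOf {α : Type*} [TopologicalSpace α] (C X : Set α) : Prop :=
  ∃ C' ∈ irreducibleComponents ↥X, C = Subtype.val '' C'

/-! ### Polynomials acting by differentiation, annihilators, Hilbert functions -/

/-- The partial derivative `∂/∂yᵢ` as a `k`-linear endomorphism of `k[y₁, …, yₙ]`. -/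
noncomputable def partialEnd (k : Type*) [Field k] {n : ℕ} (i : Fin n) :
    Module.End k (MvPolynomial (Fin n) k) :=
  (pderiv i : Derivation k (MvPolynomial (Fin n) k) (MvPolynomial (Fin n) k)).toLinearMap

theorem partialEnd_comm (k : Type*) [Field k] {n : ℕ} (i j : Fin n) :
    Commute (partialEnd k i) (partialEnd k j) := by
  have h : ⁅(pderiv i : Derivation k (MvPolynomial (Fin n) k) (MvPolynomial (Fin n) k)),
      (pderiv j : Derivation k (MvPolynomial (Fin n) k) (MvPolynomial (Fin n) k))⁆ = 0 := by
    apply MvPolynomial.derivation_ext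
    intro l
    simp [Derivation.commutator_apply, pderiv_X, Pi.single_apply, apply_ite]
  refine LinearMap.ext fun F => ?_
  have := congrArg (fun D => D F) h
  simpa [Derivation.commutator_apply, partialEnd, sub_eq_zero] using this

theorem partialEnd_pow_pairwise (k : Type*) [Field k] {n : ℕ} (m m' : Fin n →₀ ℕ)
    (s : Set (Fin n)) :
    s.Pairwise fun i j => Commute (partialEnd k i ^ m i) (partialEnd k j ^ m' j) :=
  fun i _ j _ _ => (partialEnd_comm k i j).pow_pow _ _

/-- The differential operator `∂₁^{m₁} ⋯ ∂ₙ^{mₙ}` of an exponent vector `m`. -/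
noncomputable def partialPow (k : Type*) [Field k] {n : ℕ} (m : Fin n →₀ ℕ) :
    Module.End k (MvPolynomial (Fin n) k) :=
  Finset.univ.noncommProd (fun i => partialEnd k i ^ m i) (partialEnd_pow_pairwise k m m _)

theorem partialPow_single (k : Type*) [Field k] {n : ℕ} (i : Fin n) :
    partialPow k (Finsupp.single i 1) = partialEnd k i := by
  classical
  unfold partialPow
  rw [← Finset.mul_noncommProd_erase Finset.univ (Finset.mem_univ i) _ _
    (partialEnd_pow_pairwise k _ _ _), Finset.noncommProd_eq_pow_card _ _ _ 1]
  · simp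
  · intro j hj
    simp [Finset.ne_of_mem_erase hj |>.symm]

/-- The map `m ↦ ∂₁^{m₁} ⋯ ∂ₙ^{mₙ}` as a monoid homomorphism. -/
noncomputable def partialMonomial (k : Type*) [Field k] (n : ℕ) :
    Multiplicative (Fin n →₀ ℕ) →* Module.End k (MvPolynomial (Fin n) k) where
  toFun m := partialPow k m.toAdd
  map_one' := by
    refine (Finset.noncommProd_eq_pow_card _ _ _ 1 ?_).trans (one_pow _)
    intro i _
    exact pow_zero _
  map_mul' m m' := by
    refine Eq.trans ?_ (Finset.noncommProd_mul_distrib (s := Finset.univ)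
      (fun i => partialEnd k i ^ (m.toAdd i)) (fun i => partialEnd k i ^ (m'.toAdd i))
      (partialEnd_pow_pairwise k _ _ _) (partialEnd_pow_pairwise k _ _ _)
      (partialEnd_pow_pairwise k _ _ _))
    refine Finset.noncommProd_congr rfl ?_ _
    intro i _
    exact pow_add _ _ _

/-- The action of `k[x₁, …, xₙ]` on `k[y₁, …, yₙ]` by differentiation:
`diffOp h F = h(∂/∂y₁, …, ∂/∂yₙ) F`. -/
noncomputable def diffOp (k : Type*) [Field k] (n : ℕ) :
    MvPolynomial (Fin n) k →ₐ[k] Module.End k (MvPolynomial (Fin n) k) :=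
  AddMonoidAlgebra.lift k (Module.End k (MvPolynomial (Fin n) k)) (Fin n →₀ ℕ)
    (partialMonomial k n)

theorem diffOp_monomial (k : Type*) [Field k] {n : ℕ} (m : Fin n →₀ ℕ) (c : k) :
    diffOp k n (monomial m c) = c • partialPow k m :=
  AddMonoidAlgebra.lift_single _ _ _

theorem diffOp_X (k : Type*) [Field k] {n : ℕ} (i : Fin n) (F : MvPolynomial (Fin n) k) :
    diffOp k n (X i) F = pderiv i F := by
  rw [X, diffOp_monomial, one_smul, partialPow_single]
  rfl

/-- The annihilator `F^⊥ = {h | h(∂/∂y) F = 0}`, an ideal of `k[x₁, …, xₙ]`. -/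
noncomputable def annihilator {k : Type*} [Field k] {n : ℕ} (F : MvPolynomial (Fin n) k) :
    Ideal (MvPolynomial (Fin n) k) where
  carrier := {h | diffOp k n h F = 0}
  add_mem' {a b} ha hb := by
    have ha' : diffOp k n a F = 0 := ha
    have hb' : diffOp k n b F = 0 := hb
    simp [ha', hb']
  zero_mem' := by simp
  smul_mem' c h hh := by
    have hh' : diffOp k n h F = 0 := hh
    simp [hh']

/-- `F^⊥ ∩ k[x₁, …, xₙ]_j`. -/
noncomputable def annihilatorDeg {k : Type*} [Field k] {n : ℕ} (F : MvPolynomial (Fin n) k)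
    (j : ℕ) : Submodule k (MvPolynomial (Fin n) k) :=
  (annihilator F).restrictScalars k ⊓ homogeneousSubmodule (Fin n) k j

/-- The Hilbert function of `k[x₁, …, xₙ] / I`: the dimension of its degree `i` component. -/
noncomputable def hilbertFunction {k : Type*} [Field k] {n : ℕ}
    (I : Ideal (MvPolynomial (Fin n) k)) (i : ℕ) : ℕ :=
  Module.finrank k
    ((homogeneousSubmodule (Fin n) k i).map (Ideal.Quotient.mkₐ k I).toLinearMap)

/-- The sequence `T = (t₀, t₁, …)` of coefficients of `(u^{d-1} + ⋯ + u + 1)^n`. -/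
noncomputable def seqT (n d i : ℕ) : ℕ :=
  ((∑ a ∈ Finset.range d, (Polynomial.X : Polynomial ℕ) ^ a) ^ n).coeff i

/-! ### The resultant of `n` forms of degree `d` in `n` variables -/

/-- The coefficient vectors of the `n`-tuples of forms of degree `d` in `n` variables that have a
common zero away from the origin. -/
def commonZeroLocus (k : Type*) [Field k] (n d : ℕ) : Set (Fin n × Monom n d → k) :=
  {a | ∃ x : Fin n → k, x ≠ 0 ∧ ∀ i, eval x (∑ m : Monom n d, monomial m.1 (a (i, m))) = 0}

/-- `R` is the resultant, as a polynomial in the coefficients of `n` forms of degree `d` in `n`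
variables: it generates the ideal of all polynomials vanishing on the tuples with a common zero
away from the origin, and it is normalized to be `1` at `(x₁^d, …, xₙ^d)`. These two conditions
determine `R`. -/
def IsResultant (k : Type*) [Field k] (n d : ℕ) (R : MvPolynomial (Fin n × Monom n d) k) : Prop :=
  vanishingIdeal k (commonZeroLocus k n d) = Ideal.span {R} ∧
    eval (fun p => coeff p.2.1 ((X p.1 : MvPolynomial (Fin n) k) ^ d)) R = 1

open Classical in
/-- The resultant polynomial. -/
noncomputable def resultantPoly (k : Type*) [Field k] (n d : ℕ) :
    MvPolynomial (Fin n × Monom n d) k :=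
  if h : ∃ R, IsResultant k n d R then h.choose else 0

/-- The resultant `Res(f₁, …, fₙ)` of `n` forms of degree `d` in `n` variables. -/
noncomputable def resultant {k : Type*} [Field k] {n : ℕ} (d : ℕ)
    (f : Fin n → MvPolynomial (Fin n) k) : k :=
  eval (fun p => coeff p.2.1 (f p.1)) (resultantPoly k n d)

/-! ### The catalecticant varieties -/

/-- `K = dim k[x₁, …, xₙ]_d`. -/
def dimK (n d : ℕ) : ℕ := (d + n - 1).choose (n - 1)

/-- The catalecticant matrix `D(F)`: its column at a monomial `m` of degree `d` consists of the
coefficients of `m(∂/∂y) F` at the monomials of degree `n(d-1)-d`. -/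
noncomputable def catMatrix {k : Type*} [Field k] {n : ℕ} (d : ℕ) (F : MvPolynomial (Fin n) k) :
    Matrix (Monom n (n * (d - 1) - d)) (Monom n d) k :=
  Matrix.of fun l m => coeff l.1 (diffOp k n (monomial m.1 1) F)

/-- The variety `U` of forms `F` with `rank D(F) = K - n`. -/
def varU (k : Type*) [Field k] (n d : ℕ) : Set (Form k n (n * (d - 1))) :=
  {F | (catMatrix d F.1).rank = dimK n d - n}

/-- The variety `V` of forms `F` with `rank D(F) ≤ K - n`. -/
def varV (k : Type*) [Field k] (n d : ℕ) : Set (Form k n (n * (d - 1))) :=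
  {F | (catMatrix d F.1).rank ≤ dimK n d - n}

/-- The variety `Gor(T)` of forms `F` such that `k[x₁, …, xₙ]/F^⊥` has Hilbert function `T`. -/
def varGor (k : Type*) [Field k] (n d : ℕ) : Set (Form k n (n * (d - 1))) :=
  {F | ∀ i, hilbertFunction (annihilator F.1) i = seqT n d i}

/-- The locus `U_Res` of forms `F` such that `F^⊥ ∩ k[x₁, …, xₙ]_d` is `n`-dimensional and has a
basis with nonvanishing resultant. -/
def locusURes (k : Type*) [Field k] (n d : ℕ) : Set (Form k n (n * (d - 1))) :=
  {F | Module.finrank k (annihilatorDeg F.1 d) = n ∧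
    ∃ b : Module.Basis (Fin n) k (annihilatorDeg F.1 d),
      resultant d (fun i => (b i : MvPolynomial (Fin n) k)) ≠ 0}

/-! ### The locus `Z` -/

/-- A choice `α` of a `(K-n)`-minor of the catalecticant matrix: its rows, and a numbering of all
columns in which the `K-n` columns of the minor come first, followed by the `n` others. -/
structure MinorChoice (n d : ℕ) where
  rows : Fin (dimK n d - n) ↪ Monom n (n * (d - 1) - d)
  cols : Fin (dimK n d - n) ⊕ Fin n ≃ Monom n d

variable {k : Type*} [Field k] {n d : ℕ}

/-- The block `A(F)`, whose determinant is the chosen minor. -/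
noncomputable def MinorChoice.blockA (α : MinorChoice n d) (F : MvPolynomial (Fin n) k) :
    Matrix (Fin (dimK n d - n)) (Fin (dimK n d - n)) k :=
  (catMatrix d F).submatrix α.rows (fun i => α.cols (Sum.inl i))

/-- The block `B(F)`: the rows of the chosen minor and the remaining `n` columns. -/
noncomputable def MinorChoice.blockB (α : MinorChoice n d) (F : MvPolynomial (Fin n) k) :
    Matrix (Fin (dimK n d - n)) (Fin n) k :=
  (catMatrix d F).submatrix α.rows (fun j => α.cols (Sum.inr j))

/-- The open subset `U_α` of `U` where the chosen minor does not vanish. -/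
def MinorChoice.chart (k : Type*) [Field k] {n d : ℕ} (α : MinorChoice n d) :
    Set (Form k n (n * (d - 1))) :=
  {F | F ∈ varU k n d ∧ (α.blockA F.1).det ≠ 0}

/-- The vector `γ_j(F) = (-A(F)⁻¹ B(F) e_j, e_j)`; for `F ∈ U_α` these vectors form the canonical
basis of the solution space of `D(F) γ = 0`. -/
noncomputable def MinorChoice.kernelVec (α : MinorChoice n d) (F : MvPolynomial (Fin n) k)
    (j : Fin n) : Monom n d → k :=
  fun m => Sum.elim (-((α.blockA F)⁻¹.mulVec ((α.blockB F).mulVec (Pi.single j 1))))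
    (Pi.single j 1) (α.cols.symm m)

/-- The `d`-form `r_{j,α}(F)` with coefficient vector `γ_j(F)`; for `F ∈ U_α` these forms are the
canonical basis of `F^⊥ ∩ k[x₁, …, xₙ]_d`. -/
noncomputable def MinorChoice.canonicalForm (α : MinorChoice n d) (F : MvPolynomial (Fin n) k)
    (j : Fin n) : MvPolynomial (Fin n) k :=
  ∑ m : Monom n d, monomial m.1 (α.kernelVec F j m)

/-- The zero locus `Z_α` in `U_α` of the function `R_α = Res(r_{1,α}, …, r_{n,α})`. -/
def MinorChoice.zeroLocus (k : Type*) [Field k] {n d : ℕ} (α : MinorChoice n d) :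
    Set (Form k n (n * (d - 1))) :=
  {F | F ∈ α.chart k ∧ resultant d (α.canonicalForm F.1) = 0}

/-- The subset `Z` of `U` glued from the loci `Z_α`. -/
def locusZ (k : Type*) [Field k] (n d : ℕ) : Set (Form k n (n * (d - 1))) :=
  ⋃ α : MinorChoice n d, α.zeroLocus k

end Catalecticant

/-! The locus U_Res consists of the Macaulay duals of complete intersections. If n forms f of degree
d in n variables have no common zero, then k[x]/(f) has Hilbert function T, and its socle is
one-dimensional, in degree n(d-1). Hence, up to a scalar, exactly one nonzero form F of that degree
is killed by f, and F^⊥ agrees with (f) in every degree (`socle_degree`,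
`NoCommonZero.hilbertFunction_eq`, `NoCommonZero.idealDeg_annihilator`, `NoCommonZero.form_unique`).

The resultant is defined as a normalized generator of a vanishing ideal, so its existence is part of
the proof. That ideal is the kernel of a parametrization of the incidence variety, hence prime. A
Jacobian computation and a count of transcendence degrees then make it principal
(`exists_isResultant`). It follows that the resultant vanishes exactly when there is a common zero,
a condition on the span of the forms alone. This gives U_Res ⊆ Gor(T) ⊆ U ⊆ V and U_Res = U \ Z.
Clearing denominators in the canonical basis shows that U_Res is the trace on V of an open set
(`exists_isOpen_locusURes`).

U_Res is irreducible, because the tuples without common zero form an open subset of an affine space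
over which the line of dual forms has local polynomial generators (`exists_local_section`,
`isIrreducible_locusURes`). An irreducible relatively open subset has an irreducible component as
its relative closure, so one argument yields all three components. For V one also needs V \ U inside
the closure of Z: adding powers of linear forms raises a deficient rank to K - n and produces a
common zero in the annihilator (`exists_rank_add_smul`).

For the dimension, tuples are normalized at the pure powers x_i^d. The n(K - n) remaining
coefficients and one scalar parametrize a dense part of U_Res, and they are rational functions of F
(`exists_chart_family`). This bounds chains of irreducible closed sets from both sides. -/

namespace Catalecticant

/-! ### Regular elements modulo an ideal, and prime avoidance. -/

section RegMod
variable {R : Type*} [CommRing R]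

/-- `a` is a nonzerodivisor modulo the ideal `I`. -/
def RegMod (I : Ideal R) (a : R) : Prop := ∀ h, a * h ∈ I → h ∈ I

/-- The ideal generated by the first `j` terms of a sequence. -/
def initIdeal (w : ℕ → R) (j : ℕ) : Ideal R := Ideal.span (w '' Set.Iio j)

/-- The first `j` terms of `w` form a (weakly) regular sequence. -/
def RegSeq (w : ℕ → R) (j : ℕ) : Prop := ∀ i < j, RegMod (initIdeal w i) (w i)

theorem initIdeal_zero (w : ℕ → R) : initIdeal w 0 = ⊥ := by simp [initIdeal]

theorem initIdeal_succ (w : ℕ → R) (j : ℕ) :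
    initIdeal w (j + 1) = initIdeal w j ⊔ Ideal.span {w j} := by
  rw [initIdeal, initIdeal, ← Ideal.span_union]
  congr 1
  ext x
  simp only [Set.mem_image, Set.mem_Iio, Set.mem_union, Set.mem_singleton_iff]
  constructor
  · rintro ⟨i, hi, rfl⟩
    rcases Nat.lt_succ_iff_lt_or_eq.1 hi with h | rfl
    · exact Or.inl ⟨i, h, rfl⟩
    · exact Or.inr rfl
  · rintro (⟨i, hi, rfl⟩ | rfl)
    · exact ⟨i, by omega, rfl⟩
    · exact ⟨j, by omega, rfl⟩

theorem mem_sup_span_singleton {I : Ideal R} {a h : R} :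
    h ∈ I ⊔ Ideal.span {a} ↔ ∃ u, h - a * u ∈ I := by
  rw [Submodule.mem_sup]
  constructor
  · rintro ⟨y, hy, z, hz, rfl⟩
    obtain ⟨u, rfl⟩ := Ideal.mem_span_singleton'.1 hz
    exact ⟨u, by convert hy using 1; ring⟩
  · rintro ⟨u, hu⟩
    exact ⟨_, hu, a * u, Ideal.mem_span_singleton.2 ⟨u, rfl⟩, by ring⟩

/-- Exchange: if `a` and `b` are regular modulo `I`, the elements killed by an ideal `m ∋ b` modulo
`I + (a)` correspond to those killed by `m` modulo `I + (b)`. -/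
theorem RegMod.exchange {I : Ideal R} {a b : R} (ha : RegMod I a) (hb : RegMod I b) {m : Ideal R}
    {h h' : R} (hh : ∀ x ∈ m, x * h ∈ I ⊔ Ideal.span {a})
    (hh' : b * h - a * h' ∈ I) :
    (∀ x ∈ m, x * h' ∈ I ⊔ Ideal.span {b}) ∧
      (h' ∈ I ⊔ Ideal.span {b} → h ∈ I ⊔ Ideal.span {a}) := by
  constructor
  · intro x hx
    obtain ⟨u, hu⟩ := mem_sup_span_singleton.1 (hh x hx)
    refine mem_sup_span_singleton.2 ⟨u, ha _ ?_⟩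
    have : a * (x * h' - b * u) = b * (x * h - a * u) - x * (b * h - a * h') := by ring
    rw [this]
    exact I.sub_mem (I.mul_mem_left _ hu) (I.mul_mem_left _ hh')
  · intro h1
    obtain ⟨v, hv⟩ := mem_sup_span_singleton.1 h1
    refine mem_sup_span_singleton.2 ⟨v, hb _ ?_⟩
    have : b * (h - a * v) = (b * h - a * h') + a * (h' - b * v) := by ring
    rw [this]
    exact I.add_mem hh' (I.mul_mem_left _ hv)

/-- From a h ≡ b u modulo I, regularity of b modulo I + (a) gives u ≡ a v, and then a cancels in a
(h - b v). -/
theorem RegMod.swap {I : Ideal R} {a b : R} (ha : RegMod I a)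
    (hb : RegMod (I ⊔ Ideal.span {a}) b) : RegMod (I ⊔ Ideal.span {b}) a := by
  intro h hh
  obtain ⟨u, hu⟩ := mem_sup_span_singleton.1 hh
  have h1 : b * u ∈ I ⊔ Ideal.span {a} :=
    mem_sup_span_singleton.2 ⟨h, by rw [← neg_sub]; exact I.neg_mem hu⟩
  obtain ⟨v, hv⟩ := mem_sup_span_singleton.1 (hb _ h1)
  refine mem_sup_span_singleton.2 ⟨v, ha _ ?_⟩
  have : a * (h - b * v) = (a * h - b * u) + b * (u - a * v) := by ring
  rw [this]
  exact I.add_mem hu (I.mul_mem_left _ hv)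

/-- If `b` is regular modulo all initial ideals of a regular sequence, then the sequence is regular
modulo `b`; this is phrased through a surjection with kernel `(b)`. -/
theorem RegSeq.map {S : Type*} [CommRing S] (π : R →+* S) (hπ : Function.Surjective π) {b : R}
    (hker : RingHom.ker π = Ideal.span {b}) {w : ℕ → R} {j : ℕ} (hw : RegSeq w j)
    (hb : ∀ i ≤ j, RegMod (initIdeal w i) b) : RegSeq (fun i => π (w i)) j := by
  intro i hi h hh
  obtain ⟨h, rfl⟩ := hπ h
  have hmap : initIdeal (fun i => π (w i)) i = (initIdeal w i).map π := by
    rw [initIdeal, initIdeal, Ideal.map_span, ← Set.image_comp]; rfl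
  have key : ∀ y, π y ∈ (initIdeal w i).map π ↔ y ∈ initIdeal w i ⊔ Ideal.span {b} := by
    intro y
    rw [← Ideal.mem_comap, Ideal.comap_map_of_surjective π hπ, ← hker]
    rfl
  rw [hmap, ← map_mul, key] at hh
  rw [hmap, key]
  refine RegMod.swap (hw i hi) ?_ _ hh
  rw [← initIdeal_succ]
  exact hb _ hi

theorem map_mem_initIdeal {S : Type*} [CommRing S] (π : R →+* S) (hπ : Function.Surjective π) {b : R}
    (hker : RingHom.ker π = Ideal.span {b}) (w : ℕ → R) (j : ℕ) (y : R) :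
    π y ∈ initIdeal (fun i => π (w i)) j ↔ y ∈ initIdeal w j ⊔ Ideal.span {b} := by
  have hmap : initIdeal (fun i => π (w i)) j = (initIdeal w j).map π := by
    rw [initIdeal, initIdeal, Ideal.map_span, ← Set.image_comp]; rfl
  rw [hmap, ← Ideal.mem_comap, Ideal.comap_map_of_surjective π hπ, ← hker]
  rfl

/-- Prime avoidance by vector subspaces: if no proper ideal among finitely many annihilators
contains the space `W`, some element of `W` is regular modulo `I`. -/
theorem exists_regMod {k : Type*} [Field k] [Infinite k] [Algebra k R] [IsNoetherianRing R]
    {ι : Type*} [Finite ι] (I : ι → Ideal R) (W : Submodule k R) (W' : Submodule k W) (hW' : W' ≠ ⊤)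
    (h : ∀ i, ∀ P : Ideal R, P.IsPrime → (∃ y, y ∉ I i ∧ ∀ x, x ∈ P ↔ x * y ∈ I i) →
      ∃ x ∈ W, x ∉ P) :
    ∃ a : W, a ∉ W' ∧ ∀ i, RegMod (I i) a := by
  classical
  let T : Set (Ideal R) := ⋃ i, associatedPrimes R (R ⧸ I i)
  have hT : T.Finite := Set.finite_iUnion fun i => associatedPrimes.finite R (R ⧸ I i)
  have hass : ∀ i, ∀ P ∈ associatedPrimes R (R ⧸ I i),
      P.IsPrime ∧ ∃ y, y ∉ I i ∧ ∀ x, x ∈ P ↔ x * y ∈ I i := by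
    intro i P hP
    rw [AssociatedPrimes.mem_iff, isAssociatedPrime_iff] at hP
    obtain ⟨hp, y, hy⟩ := hP
    obtain ⟨y, rfl⟩ := Ideal.Quotient.mk_surjective y
    have hx : ∀ x, x ∈ P ↔ x * y ∈ I i := by
      intro x
      rw [hy, Submodule.mem_colon_singleton, Submodule.mem_bot, ← Ideal.Quotient.eq_zero_iff_mem]
      rfl
    exact ⟨hp, y, fun hyI => hp.ne_top ((Ideal.eq_top_iff_one _).2 ((hx 1).2 (by simpa))), hx⟩
  -- The traces on W of the associated primes, together with W', are finitely many proper subspaces;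
  -- over an infinite field they cannot cover W.
  let S : Set (Submodule k W) := insert W' ((fun P : Ideal R =>
    (P.restrictScalars k).comap W.subtype) '' T)
  have hS : S.Finite := (hT.image _).insert _
  have htop : (⊤ : Submodule k W) ∉ hS.toFinset := by
    rw [Set.Finite.mem_toFinset]
    rintro (h1 | ⟨P, hP, hPtop⟩)
    · exact hW' h1.symm
    · obtain ⟨i, hP⟩ := Set.mem_iUnion.1 hP
      obtain ⟨hp, hy⟩ := hass i P hP
      obtain ⟨x, hxW, hxP⟩ := h i P hp hy
      have : (⟨x, hxW⟩ : W) ∈ (P.restrictScalars k).comap W.subtype := by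
        simp only at hPtop; rw [hPtop]; trivial
      exact hxP this
  have hne := Subspace.biUnion_ne_univ_of_top_notMem htop
  obtain ⟨a, ha⟩ := (Set.ne_univ_iff_exists_notMem _).1 hne
  simp only [Set.Finite.mem_toFinset, Set.mem_iUnion, not_exists] at ha
  refine ⟨a, fun h1 => ha W' (Set.mem_insert _ _) h1, fun i y hy => ?_⟩
  by_contra hyI
  have h1 : (a : R) ∈ ⋃ p ∈ associatedPrimes R (R ⧸ I i), (p : Set R) := by
    rw [biUnion_associatedPrimes_eq_compl_regular]
    intro hreg
    have h2 : (a : R) • (Ideal.Quotient.mk (I i) y) = 0 := by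
      rw [← Ideal.Quotient.eq_zero_iff_mem] at hy
      exact hy
    have h3 : Ideal.Quotient.mk (I i) y = 0 := hreg (by simpa using h2)
    exact hyI (Ideal.Quotient.eq_zero_iff_mem.1 h3)
  simp only [Set.mem_iUnion] at h1
  obtain ⟨P, hP, haP⟩ := h1
  exact ha ((P.restrictScalars k).comap W.subtype)
    (Set.mem_insert_of_mem _ ⟨P, Set.mem_iUnion.2 ⟨i, hP⟩, rfl⟩) haP

end RegMod
end Catalecticant

namespace Catalecticant

/-! ### Cutting by a linear form, and the depth of the polynomial ring. -/

section Elimination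
variable {k : Type*} [Field k] {n : ℕ}

/-- The linear form `x_n - ∑ c_i x_i` in `n + 1` variables. -/
noncomputable def linForm (c : Fin n → k) : MvPolynomial (Fin (n + 1)) k :=
  X (Fin.last n) - ∑ i, C (c i) * X i.castSucc

/-- Elimination of the last variable by means of `linForm c`. -/
noncomputable def elimLast (c : Fin n → k) :
    MvPolynomial (Fin (n + 1)) k →ₐ[k] MvPolynomial (Fin n) k :=
  aeval (Fin.lastCases (∑ i, C (c i) * X i) X)

@[simp] theorem elimLast_castSucc (c : Fin n → k) (i : Fin n) :
    elimLast c (X i.castSucc) = X i := by simp [elimLast]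

@[simp] theorem elimLast_last (c : Fin n → k) :
    elimLast c (X (Fin.last n)) = ∑ i, C (c i) * X i := by simp [elimLast]

theorem elimLast_rename (c : Fin n → k) (p : MvPolynomial (Fin n) k) :
    elimLast c (rename Fin.castSucc p) = p := by
  have : (elimLast c).comp (rename Fin.castSucc) = AlgHom.id k _ := by
    ext i; simp
  exact DFunLike.congr_fun this p

theorem elimLast_surjective (c : Fin n → k) : Function.Surjective (elimLast c) :=
  fun p => ⟨_, elimLast_rename c p⟩

theorem elimLast_linForm (c : Fin n → k) : elimLast c (linForm c) = 0 := by
  simp [linForm, MvPolynomial.algHom_C]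

/-- Eliminating the last variable and including the remaining ones back is the identity modulo
`linForm c`, as one checks on generators. -/
theorem ker_elimLast (c : Fin n → k) :
    RingHom.ker (elimLast c : MvPolynomial (Fin (n + 1)) k →+* MvPolynomial (Fin n) k) =
      Ideal.span {linForm c} := by
  apply le_antisymm
  · have key : ∀ p, p - rename Fin.castSucc (elimLast c p) ∈ Ideal.span {linForm c} := by
      intro p
      induction p using MvPolynomial.induction_on with
      | C a => simp [MvPolynomial.algHom_C]
      | add p q hp hq =>
        rw [map_add, map_add, add_sub_add_comm]; exact Ideal.add_mem _ hp hq
      | mul_X p i hp =>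
        rw [map_mul, map_mul]
        have hi : X i - rename Fin.castSucc (elimLast c (X i)) ∈ Ideal.span {linForm c} := by
          refine Fin.lastCases ?_ (fun i => ?_) i
          · simp only [elimLast_last, map_sum, map_mul, rename_C, rename_X]
            exact Ideal.mem_span_singleton_self _
          · simp
        have : p * X i - rename Fin.castSucc (elimLast c p) * rename Fin.castSucc (elimLast c (X i))
            = X i * (p - rename Fin.castSucc (elimLast c p)) +
              rename Fin.castSucc (elimLast c p) *
                (X i - rename Fin.castSucc (elimLast c (X i))) := by ring
        rw [this]
        exact Ideal.add_mem _ (Ideal.mul_mem_left _ _ hp) (Ideal.mul_mem_left _ _ hi)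
    intro p hp
    have h0 : elimLast c p = 0 := hp
    simpa [h0] using key p
  · rw [Ideal.span_singleton_le_iff_mem]
    exact elimLast_linForm c

theorem linForm_isHomogeneous (c : Fin n → k) : (linForm c).IsHomogeneous 1 := by
  refine (isHomogeneous_X _ _).sub (IsHomogeneous.sum _ _ _ fun i _ => ?_)
  exact (isHomogeneous_X _ _).C_mul _

theorem elimLast_isHomogeneous (c : Fin n → k) {p : MvPolynomial (Fin (n + 1)) k} {d : ℕ}
    (hp : p.IsHomogeneous d) : (elimLast c p).IsHomogeneous d := by
  have := hp.aeval (S := k) (Fin.lastCases (∑ i, C (c i) * X i) X : Fin (n + 1) → MvPolynomial (Fin n) k)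
    (n := 1) (fun i => by
      refine Fin.lastCases ?_ (fun i => ?_) i
      · simp only [Fin.lastCases_last]
        exact IsHomogeneous.sum _ _ _ fun i _ => (isHomogeneous_X _ _).C_mul _
      · simpa using isHomogeneous_X k i)
  rwa [one_mul] at this

/-- The ideal generated by the variables. -/
noncomputable def irrelevant (k : Type*) [Field k] (n : ℕ) : Ideal (MvPolynomial (Fin n) k) :=
  Ideal.span (Set.range X)

theorem X_mem_irrelevant (i : Fin n) : (X i : MvPolynomial (Fin n) k) ∈ irrelevant k n :=
  Ideal.subset_span ⟨i, rfl⟩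

theorem irrelevant_mul_mem {I : Ideal (MvPolynomial (Fin n) k)} {h : MvPolynomial (Fin n) k}
    (H : ∀ i, X i * h ∈ I) : ∀ x ∈ irrelevant k n, x * h ∈ I := by
  intro x hx
  have : irrelevant k n ≤ I.colon {h} := by
    refine Ideal.span_le.2 ?_
    rintro _ ⟨i, rfl⟩
    exact Submodule.mem_colon_singleton.2 (by simpa using H i)
  simpa using Submodule.mem_colon_singleton.1 (this hx)

theorem linForm_mem_irrelevant (c : Fin n → k) : linForm c ∈ irrelevant k (n + 1) :=
  Ideal.sub_mem _ (X_mem_irrelevant _)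
    (Ideal.sum_mem _ fun _ _ => Ideal.mul_mem_left _ _ (X_mem_irrelevant _))

theorem elimLast_mem_irrelevant (c : Fin n → k) {p : MvPolynomial (Fin (n + 1)) k}
    (hp : p ∈ irrelevant k (n + 1)) : elimLast c p ∈ irrelevant k n := by
  have : irrelevant k (n + 1) ≤ (irrelevant k n).comap (elimLast c) := by
    refine Ideal.span_le.2 ?_
    rintro _ ⟨i, rfl⟩
    change elimLast c (X i) ∈ irrelevant k n
    refine Fin.lastCases ?_ (fun i => ?_) i
    · rw [elimLast_last]
      exact Ideal.sum_mem _ fun _ _ => Ideal.mul_mem_left _ _ (X_mem_irrelevant _)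
    · rw [elimLast_castSucc]; exact X_mem_irrelevant _
  exact this hp

variable [Infinite k]

/-- A linear form regular modulo finitely many ideals none of which has the irrelevant ideal as an
associated prime. -/
theorem exists_linForm_regMod {ι : Type*} [Finite ι] (I : ι → Ideal (MvPolynomial (Fin (n + 1)) k))
    (hI : ∀ i, ∀ h, (∀ j, X j * h ∈ I i) → h ∈ I i) :
    ∃ c : Fin n → k, ∀ i, RegMod (I i) (linForm c) := by
  classical
  let W : Submodule k (MvPolynomial (Fin (n + 1)) k) := Submodule.span k (Set.range X)
  -- Linear forms without the last variable; an element outside this subspace can be rescaled to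
  -- some `linForm c`.
  let W' : Submodule k W :=
    (LinearMap.ker (lcoeff k (Finsupp.single (Fin.last n) 1))).comap W.subtype
  have hW' : W' ≠ ⊤ := by
    intro h
    have h1 : (⟨X (Fin.last n), Submodule.subset_span ⟨_, rfl⟩⟩ : W) ∈ W' := by rw [h]; trivial
    have h2 : coeff (Finsupp.single (Fin.last n) 1) (X (Fin.last n) : MvPolynomial _ k) = 0 := h1
    simp at h2
  obtain ⟨a, ha', ha⟩ := exists_regMod I W W' hW' (by
    rintro i P - ⟨y, hy, hP⟩
    by_contra! hcon
    exact hy (hI i y fun j => (hP _).1 (hcon _ (Submodule.subset_span ⟨j, rfl⟩))))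
  obtain ⟨e, he⟩ := (Submodule.mem_span_range_iff_exists_fun k).1 a.2
  have hlast : e (Fin.last n) ≠ 0 := by
    intro h0
    apply ha'
    change coeff (Finsupp.single (Fin.last n) 1) (a : MvPolynomial _ k) = 0
    rw [← he, coeff_sum]
    refine Finset.sum_eq_zero fun i _ => ?_
    rw [coeff_smul, coeff_X, smul_eq_mul]
    split_ifs with h
    · rw [Finsupp.single_left_injective one_ne_zero h, h0, zero_mul]
    · simp
  refine ⟨fun i => -(e (Fin.last n))⁻¹ * e i.castSucc, fun i h hh => ha i h ?_⟩
  have : (a : MvPolynomial (Fin (n + 1)) k) = C (e (Fin.last n)) *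
      linForm (fun i : Fin n => -(e (Fin.last n))⁻¹ * e i.castSucc) := by
    rw [← he, Fin.sum_univ_castSucc, linForm, mul_sub, Finset.mul_sum, add_comm (∑ i : Fin n, _), sub_eq_add_neg,
      ← Finset.sum_neg_distrib, smul_eq_C_mul]
    congr 1
    refine Finset.sum_congr rfl fun i _ => ?_
    rw [smul_eq_C_mul, ← mul_assoc, ← C_mul, ← neg_mul, ← C_neg]
    congr 2
    field_simp
  rw [this, mul_assoc]
  exact Ideal.mul_mem_left _ _ hh

/-- A regular sequence of fewer than `n` elements in the irrelevant ideal of a polynomial ring in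
`n` variables does not have the irrelevant ideal as an associated prime. -/
theorem depth_pos : ∀ (n j : ℕ), j < n → ∀ (w : ℕ → MvPolynomial (Fin n) k), RegSeq w j →
    (∀ i < j, w i ∈ irrelevant k n) → ∀ h, (∀ i, X i * h ∈ initIdeal w j) → h ∈ initIdeal w j := by
  intro n
  induction n with
  | zero => intro j hj; omega
  | succ n ihn =>
    intro j
    induction j using Nat.strong_induction_on with
    | _ j ihj =>
    intro hj w hw hm h hh
    rcases j with _ | j
    · have := hh 0
      rw [initIdeal_zero, Ideal.mem_bot] at this ⊢
      exact (mul_eq_zero.1 this).resolve_left (X_ne_zero _)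
    -- These initial ideals have at most j generators while the sequence has j + 1, so the inner
    -- induction applies and one linear form is regular modulo all of them.
    · obtain ⟨c, hc⟩ := exists_linForm_regMod (fun i : Fin (j + 1) => initIdeal w i)
        (fun i h hh => ihj i i.2 (by omega) w (fun l hl => hw l (by omega))
          (fun l hl => hm l (by omega)) h hh)
      have hc' : ∀ i ≤ j, RegMod (initIdeal w i) (linForm c) := fun i hi => hc ⟨i, by omega⟩
      have hh1 := irrelevant_mul_mem hh
      rw [initIdeal_succ] at hh1 ⊢
      obtain ⟨h', hh'⟩ := mem_sup_span_singleton.1 (hh1 _ (linForm_mem_irrelevant c))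
      -- Trading the last term for the linear form moves the question to the quotient by that form:
      -- a polynomial ring with one variable less and a regular sequence with one term less.
      obtain ⟨hx1, hx2⟩ := (hw j (by omega)).exchange (hc' j le_rfl) hh1 hh'
      apply hx2
      have hsur : Function.Surjective
          (elimLast c : MvPolynomial (Fin (n + 1)) k →+* MvPolynomial (Fin n) k) :=
        elimLast_surjective c
      rw [← map_mem_initIdeal _ hsur (ker_elimLast c)]
      refine ihn j (by omega) _ (RegSeq.map _ hsur (ker_elimLast c)
        (fun i hi => hw i (by omega)) hc') (fun i hi => elimLast_mem_irrelevant c (hm i (by omega)))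
        _ fun i => ?_
      have := (map_mem_initIdeal _ hsur (ker_elimLast c) w j _).2
        (hx1 _ (X_mem_irrelevant i.castSucc))
      simpa using this

end Elimination

/-! ### Homogeneous ideals and the degree of the socle. -/

section Graded
variable {k : Type*} [Field k] {n : ℕ}

/-- The homogeneous components of elements of the ideal lie in the ideal. -/
def HomogIdeal (I : Ideal (MvPolynomial (Fin n) k)) : Prop :=
  ∀ p ∈ I, ∀ i, homogeneousComponent i p ∈ I

theorem homogeneousComponent_mul_eq_sum {a : MvPolynomial (Fin n) k} {d : ℕ}
    (ha : a.IsHomogeneous d) (p : MvPolynomial (Fin n) k) (i : ℕ) :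
    homogeneousComponent i (a * p) = ∑ j ∈ Finset.range (p.totalDegree + 1),
      if d + j = i then a * homogeneousComponent j p else 0 := by
  conv_lhs => rw [← sum_homogeneousComponent p, Finset.mul_sum, map_sum]
  refine Finset.sum_congr rfl fun j _ => ?_
  rw [homogeneousComponent_of_mem ((mem_homogeneousSubmodule _ _).2
    (ha.mul (homogeneousComponent_isHomogeneous j p)))]
  simp only [eq_comm]

theorem homogeneousComponent_mul {a : MvPolynomial (Fin n) k} {d : ℕ} (ha : a.IsHomogeneous d)
    (p : MvPolynomial (Fin n) k) (i : ℕ) :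
    homogeneousComponent (i + d) (a * p) = a * homogeneousComponent i p := by
  rw [homogeneousComponent_mul_eq_sum ha]
  have : ∀ j, (d + j = i + d) ↔ j = i := fun j => by omega
  simp only [this, Finset.sum_ite_eq', Finset.mem_range]
  split_ifs with h
  · rfl
  · rw [homogeneousComponent_eq_zero _ _ (by omega), mul_zero]

theorem homogeneousComponent_mul_of_lt {a : MvPolynomial (Fin n) k} {d : ℕ} (ha : a.IsHomogeneous d)
    (p : MvPolynomial (Fin n) k) {i : ℕ} (hi : i < d) :
    homogeneousComponent i (a * p) = 0 := by
  rw [homogeneousComponent_mul_eq_sum ha]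
  exact Finset.sum_eq_zero fun j _ => if_neg (by omega)

theorem homogIdeal_span {s : Set (MvPolynomial (Fin n) k)}
    (hs : ∀ a ∈ s, ∃ d, a.IsHomogeneous d) : HomogIdeal (Ideal.span s) := by
  intro p hp
  induction hp using Submodule.span_induction with
  | mem a ha =>
    obtain ⟨d, hd⟩ := hs a ha
    intro i
    rw [homogeneousComponent_of_mem ((mem_homogeneousSubmodule _ _).2 hd)]
    split_ifs
    · exact Ideal.subset_span ha
    · exact zero_mem _
  | zero => simp
  | add x y _ _ hx hy => intro i; rw [map_add]; exact add_mem (hx i) (hy i)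
  | smul a x hx ih =>
    intro i
    rw [smul_eq_mul]
    have hx' : x = ∑ j ∈ Finset.range (x.totalDegree + 1), homogeneousComponent j x :=
      (sum_homogeneousComponent x).symm
    rw [hx', Finset.mul_sum, map_sum]
    refine Ideal.sum_mem _ fun j _ => ?_
    rw [mul_comm]
    by_cases hij : i < j
    · rw [homogeneousComponent_mul_of_lt (homogeneousComponent_isHomogeneous j x) _ hij]
      exact zero_mem _
    · obtain ⟨l, rfl⟩ := Nat.exists_eq_add_of_le (not_lt.1 hij)
      rw [add_comm j, homogeneousComponent_mul (homogeneousComponent_isHomogeneous j x)]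
      exact Ideal.mul_mem_right _ _ (ih j)

theorem homogIdeal_initIdeal {w : ℕ → MvPolynomial (Fin n) k} {j : ℕ}
    (hw : ∀ i < j, ∃ d, (w i).IsHomogeneous d) : HomogIdeal (initIdeal w j) := by
  refine homogIdeal_span ?_
  rintro _ ⟨i, hi, rfl⟩
  exact hw i hi

theorem mem_irrelevant_of_isHomogeneous {p : MvPolynomial (Fin n) k} {d : ℕ}
    (hp : p.IsHomogeneous d) (hd : d ≠ 0) : p ∈ irrelevant k n := by
  rw [irrelevant, ← Set.image_univ, mem_ideal_span_X_image]
  intro m hm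
  by_contra! hcon
  have : m = 0 := Finsupp.ext fun i => hcon i (Set.mem_univ i)
  subst this
  exact hd ((hp (mem_support_iff.1 hm)).symm.trans (by simp))

/-- Homogeneous elements of the ideal generated by `I` and a homogeneous `a`. -/
theorem mem_sup_span_of_isHomogeneous {I : Ideal (MvPolynomial (Fin n) k)} (hI : HomogIdeal I)
    {a : MvPolynomial (Fin n) k} {d : ℕ} (ha : a.IsHomogeneous d) {p : MvPolynomial (Fin n) k}
    {e : ℕ} (hp : p.IsHomogeneous e) {u : MvPolynomial (Fin n) k} (h : p - a * u ∈ I) :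
    (e < d → p ∈ I) ∧ (d ≤ e → p - a * homogeneousComponent (e - d) u ∈ I) := by
  have h1 := hI _ h e
  rw [map_sub, homogeneousComponent_of_mem ((mem_homogeneousSubmodule _ _).2 hp), if_pos rfl] at h1
  constructor
  · intro hed
    rwa [homogeneousComponent_mul_of_lt ha _ hed, sub_zero] at h1
  · intro hed
    obtain ⟨i, rfl⟩ := Nat.exists_eq_add_of_le' hed
    rwa [homogeneousComponent_mul ha, ← Nat.add_sub_cancel (n := i) (m := d)] at h1

variable [Infinite k]

/-- The socle of the quotient by a regular sequence of `n` forms of degrees `d_0, …, d_{n-1}` in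
`n` variables is concentrated in degree `∑ (d_i - 1)`. -/
theorem socle_degree : ∀ (n : ℕ) (w : ℕ → MvPolynomial (Fin n) k) (d : ℕ → ℕ), RegSeq w n →
    (∀ i < n, (w i).IsHomogeneous (d i)) → (∀ i < n, d i ≠ 0) →
    ∀ (h : MvPolynomial (Fin n) k) (e : ℕ), h.IsHomogeneous e → (∀ i, X i * h ∈ initIdeal w n) →
      e + n ≠ ∑ i ∈ Finset.range n, d i → h ∈ initIdeal w n := by
  intro n
  induction n with
  | zero =>
    intro w d _ _ _ h e he _ hne
    by_cases h0 : h = 0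
    · rw [h0]; exact zero_mem _
    · exact absurd (he.inj_right (isHomogeneous_of_isEmpty _ _ h) h0) (by simpa using hne)
  | succ n ih =>
    intro w d hw hwd hd h e he hh hne
    have hm : ∀ i < n + 1, w i ∈ irrelevant k (n + 1) := fun i hi =>
      mem_irrelevant_of_isHomogeneous (hwd i hi) (hd i hi)
    obtain ⟨c, hc⟩ := exists_linForm_regMod (fun i : Fin (n + 1) => initIdeal w i)
      (fun i h hh => depth_pos _ i i.2 w (fun l hl => hw l (by omega))
        (fun l hl => hm l (by omega)) h hh)
    have hc' : ∀ i ≤ n, RegMod (initIdeal w i) (linForm c) := fun i hi => hc ⟨i, by omega⟩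
    have hh1 := irrelevant_mul_mem hh
    rw [initIdeal_succ] at hh1 ⊢
    obtain ⟨u, hu⟩ := mem_sup_span_singleton.1 (hh1 _ (linForm_mem_irrelevant c))
    have hI : HomogIdeal (initIdeal w n) :=
      homogIdeal_initIdeal fun i hi => ⟨d i, hwd i (by omega)⟩
    obtain ⟨hlt, hge⟩ := mem_sup_span_of_isHomogeneous hI (hwd n (by omega))
      ((linForm_isHomogeneous c).mul he) hu
    -- Below degree d n no multiple of w n occurs, and h already lies in the previous ideal.
    -- Otherwise the traded element has degree 1 + e - d n in one variable less, so the difference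
    -- between degree plus number of variables and the sum of the d i is unchanged.
    by_cases hed : 1 + e < d n
    · exact Ideal.mem_sup_left (hc' n le_rfl _ (hlt hed))
    · push Not at hed
      obtain ⟨hx1, hx2⟩ := (hw n (by omega)).exchange (hc' n le_rfl) hh1 (hge hed)
      apply hx2
      have hsur : Function.Surjective
          (elimLast c : MvPolynomial (Fin (n + 1)) k →+* MvPolynomial (Fin n) k) :=
        elimLast_surjective c
      rw [← map_mem_initIdeal _ hsur (ker_elimLast c)]
      refine ih _ d (RegSeq.map _ hsur (ker_elimLast c)
        (fun i hi => hw i (by omega)) hc')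
        (fun i hi => elimLast_isHomogeneous c (hwd i (by omega))) (fun i hi => hd i (by omega))
        _ (1 + e - d n) (elimLast_isHomogeneous c (homogeneousComponent_isHomogeneous _ _))
        (fun i => ?_) ?_
      · have := (map_mem_initIdeal _ hsur (ker_elimLast c) w n _).2
          (hx1 _ (X_mem_irrelevant i.castSucc))
        simpa using this
      · rw [Finset.sum_range_succ] at hne
        omega

end Graded
end Catalecticant

namespace Catalecticant

/-! ### Hilbert functions of quotients by regular sequences. -/

section Hilbert
variable {k : Type*} [Field k] {n : ℕ}

instance finite_homogeneousSubmodule (j : ℕ) :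
    Module.Finite k (homogeneousSubmodule (Fin n) k j) :=
  Module.Finite.iff_fg.2 (homogeneousSubmodule_fg _ _ j)

/-- The homogeneous part of degree `i` of an ideal. -/
noncomputable def idealDeg (I : Ideal (MvPolynomial (Fin n) k)) (i : ℕ) :
    Submodule k (MvPolynomial (Fin n) k) :=
  I.restrictScalars k ⊓ homogeneousSubmodule (Fin n) k i

theorem mem_idealDeg {I : Ideal (MvPolynomial (Fin n) k)} {i : ℕ} {p : MvPolynomial (Fin n) k} :
    p ∈ idealDeg I i ↔ p ∈ I ∧ p.IsHomogeneous i := Iff.rfl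

instance finite_idealDeg (I : Ideal (MvPolynomial (Fin n) k)) (j : ℕ) :
    Module.Finite k (idealDeg I j) :=
  Submodule.finiteDimensional_of_le (inf_le_right : idealDeg I j ≤ homogeneousSubmodule _ _ _)

theorem hilbertFunction_add (I : Ideal (MvPolynomial (Fin n) k)) (i : ℕ) :
    hilbertFunction I i + Module.finrank k (idealDeg I i) =
      Module.finrank k (homogeneousSubmodule (Fin n) k i) := by
  let φ := (Ideal.Quotient.mkₐ k I).toLinearMap.domRestrict (homogeneousSubmodule (Fin n) k i)
  have h1 := φ.finrank_range_add_finrank_ker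
  have h2 : LinearMap.range φ =
      (homogeneousSubmodule (Fin n) k i).map (Ideal.Quotient.mkₐ k I).toLinearMap := by
    rw [LinearMap.range_domRestrict]
  have h3 : (LinearMap.ker φ).map (homogeneousSubmodule (Fin n) k i).subtype = idealDeg I i := by
    ext p
    simp only [Submodule.mem_map, LinearMap.mem_ker, mem_idealDeg]
    constructor
    · rintro ⟨q, hq, rfl⟩
      exact ⟨Ideal.Quotient.eq_zero_iff_mem.1 hq, q.2⟩
    · rintro ⟨hp, hi⟩
      exact ⟨⟨p, hi⟩, Ideal.Quotient.eq_zero_iff_mem.2 hp, rfl⟩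
  rw [h2] at h1
  rw [← h3, LinearEquiv.finrank_eq (Submodule.equivMapOfInjective _
    (Submodule.injective_subtype _) _).symm]
  exact h1

theorem hilbertFunction_congr {I J : Ideal (MvPolynomial (Fin n) k)} {i : ℕ}
    (h : idealDeg I i = idealDeg J i) : hilbertFunction I i = hilbertFunction J i := by
  have h1 := hilbertFunction_add I i
  have h2 := hilbertFunction_add J i
  rw [h] at h1
  omega

theorem hilbertFunction_sup_of_lt {I : Ideal (MvPolynomial (Fin n) k)} (hI : HomogIdeal I)
    {a : MvPolynomial (Fin n) k} {d : ℕ} (ha : a.IsHomogeneous d) {i : ℕ} (hi : i < d) :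
    hilbertFunction (I ⊔ Ideal.span {a}) i = hilbertFunction I i := by
  apply hilbertFunction_congr
  ext p
  simp only [mem_idealDeg]
  constructor
  · rintro ⟨hp, hpi⟩
    obtain ⟨u, hu⟩ := mem_sup_span_singleton.1 hp
    exact ⟨(mem_sup_span_of_isHomogeneous hI ha hpi hu).1 hi, hpi⟩
  · rintro ⟨hp, hpi⟩
    exact ⟨Ideal.mem_sup_left hp, hpi⟩

/-- In degree i + d the new ideal is the sum of I and the a-multiples of forms of degree i. By
regularity these meet exactly in a times the degree i part of I, and the dimension formula for a sum
concludes. -/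
theorem hilbertFunction_sup {I : Ideal (MvPolynomial (Fin n) k)} (hI : HomogIdeal I)
    {a : MvPolynomial (Fin n) k} {d : ℕ} (ha : a.IsHomogeneous d) (ha0 : a ≠ 0)
    (hreg : RegMod I a) (i : ℕ) :
    hilbertFunction (I ⊔ Ideal.span {a}) (i + d) + hilbertFunction I i =
      hilbertFunction I (i + d) := by
  let μ := LinearMap.mulLeft k a
  have hμ : Function.Injective μ := fun x y h => mul_left_cancel₀ ha0 h
  have e1 : idealDeg (I ⊔ Ideal.span {a}) (i + d) =
      idealDeg I (i + d) ⊔ (homogeneousSubmodule (Fin n) k i).map μ := by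
    ext p
    refine Iff.trans ?_ Submodule.mem_sup.symm
    rw [mem_idealDeg]
    constructor
    · rintro ⟨hp, hpi⟩
      obtain ⟨u, hu⟩ := mem_sup_span_singleton.1 hp
      have := (mem_sup_span_of_isHomogeneous hI ha hpi hu).2 (by omega)
      have hd : (a * homogeneousComponent (i + d - d) u).IsHomogeneous (i + d) := by
        rw [add_comm i d]
        exact ha.mul (by simpa using homogeneousComponent_isHomogeneous i u)
      refine ⟨_, ⟨this, hpi.sub hd⟩, a * homogeneousComponent (i + d - d) u,
        ⟨_, ?_, rfl⟩, by ring⟩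
      simpa using homogeneousComponent_isHomogeneous i u
    · rintro ⟨y, ⟨hy, hyi⟩, _, ⟨u, hu, rfl⟩, rfl⟩
      refine ⟨Ideal.add_mem _ (Ideal.mem_sup_left hy) (Ideal.mem_sup_right
        (Ideal.mem_span_singleton.2 ⟨u, rfl⟩)), hyi.add ?_⟩
      rw [add_comm i d]
      exact ha.mul hu
  have e2 : idealDeg I (i + d) ⊓ (homogeneousSubmodule (Fin n) k i).map μ =
      (idealDeg I i).map μ := by
    ext p
    rw [Submodule.mem_inf]
    constructor
    · rintro ⟨⟨hp, -⟩, u, hu, rfl⟩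
      exact ⟨u, ⟨hreg u hp, hu⟩, rfl⟩
    · rintro ⟨u, ⟨hu, hui⟩, rfl⟩
      refine ⟨⟨Ideal.mul_mem_left _ _ hu, ?_⟩, u, hui, rfl⟩
      rw [add_comm i d]
      exact ha.mul hui
  have h1 := Submodule.finrank_sup_add_finrank_inf_eq (idealDeg I (i + d))
    ((homogeneousSubmodule (Fin n) k i).map μ)
  rw [← e1, e2, (Submodule.equivMapOfInjective μ hμ _).symm.finrank_eq,
    (Submodule.equivMapOfInjective μ hμ _).symm.finrank_eq] at h1
  have h2 := hilbertFunction_add (I ⊔ Ideal.span {a}) (i + d)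
  have h3 := hilbertFunction_add I i
  have h4 := hilbertFunction_add I (i + d)
  omega

/-- The Hilbert series. -/
noncomputable def hilbertSeries (I : Ideal (MvPolynomial (Fin n) k)) : PowerSeries ℤ :=
  PowerSeries.mk fun i => (hilbertFunction I i : ℤ)

theorem hilbertSeries_sup {I : Ideal (MvPolynomial (Fin n) k)} (hI : HomogIdeal I)
    {a : MvPolynomial (Fin n) k} {d : ℕ} (ha : a.IsHomogeneous d) (ha0 : a ≠ 0)
    (hreg : RegMod I a) :
    hilbertSeries (I ⊔ Ideal.span {a}) = (1 - PowerSeries.X ^ d) * hilbertSeries I := by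
  ext i
  rw [sub_mul, one_mul, map_sub, PowerSeries.coeff_X_pow_mul']
  simp only [hilbertSeries, PowerSeries.coeff_mk]
  split_ifs with h
  · obtain ⟨i, rfl⟩ := Nat.exists_eq_add_of_le' h
    have := hilbertFunction_sup hI ha ha0 hreg i
    rw [Nat.add_sub_cancel]
    omega
  · rw [hilbertFunction_sup_of_lt hI ha (by omega), sub_zero]

/-- The assumption `hproper` serves to make each term nonzero, so that multiplication by it is
injective. -/
theorem hilbertSeries_initIdeal {w : ℕ → MvPolynomial (Fin n) k} {d j : ℕ} (hw : RegSeq w j)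
    (hwd : ∀ i < j, (w i).IsHomogeneous d) (hproper : ∀ i < j, w i ∉ initIdeal w i) :
    hilbertSeries (initIdeal w j) = (1 - PowerSeries.X ^ d) ^ j *
      hilbertSeries (⊥ : Ideal (MvPolynomial (Fin n) k)) := by
  induction j with
  | zero => simp [initIdeal_zero]
  | succ j ih =>
    rw [initIdeal_succ, hilbertSeries_sup (homogIdeal_initIdeal fun i hi => ⟨d, hwd i (by omega)⟩)
      (hwd j (by omega)) (fun h0 => hproper j (by omega) (by rw [h0]; exact zero_mem _))
      (hw j (by omega)),
      ih (fun i hi => hw i (by omega)) (fun i hi => hwd i (by omega))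
        (fun i hi => hproper i (by omega)), ← mul_assoc, pow_succ, mul_comm ((1 - _) ^ j)]

end Hilbert

/-! ### Coefficient vectors of forms, and the Hilbert function T. -/

section Coordinates
variable {k : Type*} [Field k] {n j : ℕ}

/-- The form with a given vector of coefficients. -/
noncomputable def formOf (v : Monom n j → k) : MvPolynomial (Fin n) k :=
  ∑ m : Monom n j, monomial m.1 (v m)

theorem formOf_isHomogeneous (v : Monom n j → k) : (formOf v).IsHomogeneous j :=
  IsHomogeneous.sum _ _ _ fun m _ => isHomogeneous_monomial _ m.2

theorem coeff_formOf (v : Monom n j → k) (m : Monom n j) : coeff m.1 (formOf v) = v m := by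
  classical
  rw [formOf, coeff_sum, Finset.sum_eq_single m]
  · simp
  · intro b _ hb
    rw [coeff_monomial, if_neg fun h => hb (Subtype.ext h)]
  · simp

theorem coeffVec_formOf (v : Monom n j → k) : coeffVec j (formOf v) = v :=
  funext fun m => coeff_formOf v m

theorem ext_of_isHomogeneous {p q : MvPolynomial (Fin n) k} (hp : p.IsHomogeneous j)
    (hq : q.IsHomogeneous j) (h : ∀ m : Monom n j, coeff m.1 p = coeff m.1 q) : p = q := by
  ext m
  by_cases hm : m.degree = j
  · exact h ⟨m, hm⟩
  · rw [hp.coeff_eq_zero hm, hq.coeff_eq_zero hm]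

theorem formOf_coeffVec {p : MvPolynomial (Fin n) k} (hp : p.IsHomogeneous j) :
    formOf (coeffVec j p) = p :=
  ext_of_isHomogeneous (formOf_isHomogeneous _) hp fun m => coeff_formOf _ m

/-- Forms of degree `j` are the same as vectors of coefficients. -/
noncomputable def coeffEquiv (k : Type*) [Field k] (n j : ℕ) : Form k n j ≃ₗ[k] (Monom n j → k) where
  toFun F := coeffVec j F.1
  map_add' F G := by ext m; simp [coeffVec]
  map_smul' c F := by ext m; simp [coeffVec]
  invFun v := ⟨formOf v, formOf_isHomogeneous v⟩
  left_inv F := Subtype.ext (formOf_coeffVec F.2)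
  right_inv v := coeffVec_formOf v

theorem card_monom (hn : 0 < n) : Fintype.card (Monom n j) = (j + n - 1).choose (n - 1) := by
  classical
  have h : Fintype.card (Monom n j) = (Finset.finsuppAntidiag (Finset.univ : Finset (Fin n)) j).card := by
    rw [← Fintype.card_coe]
    refine Fintype.card_congr (Equiv.subtypeEquivRight fun m => ?_)
    simp [Finset.mem_finsuppAntidiag, Finsupp.degree_eq_sum]
  rw [h, Finset.card_finsuppAntidiag_nat_eq_choose, Finset.card_univ, Fintype.card_fin]
  rw [add_comm n j, ← Nat.choose_symm (by omega)]
  congr 1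
  omega

theorem finrank_homogeneousSubmodule :
    Module.finrank k (homogeneousSubmodule (Fin n) k j) = Fintype.card (Monom n j) := by
  rw [(coeffEquiv k n j).finrank_eq, Module.finrank_fintype_fun_eq_card]

theorem card_monom_dimK {d : ℕ} (hn : 0 < n) : Fintype.card (Monom n d) = dimK n d := card_monom hn

theorem hilbertSeries_bot (hn : 0 < n) :
    hilbertSeries (⊥ : Ideal (MvPolynomial (Fin n) k)) = (PowerSeries.invOneSubPow ℤ n).val := by
  ext i
  rw [PowerSeries.invOneSubPow_val_eq_mk_sub_one_add_choose_of_pos _ _ hn, hilbertSeries,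
    PowerSeries.coeff_mk, PowerSeries.coeff_mk]
  have h := hilbertFunction_add (⊥ : Ideal (MvPolynomial (Fin n) k)) i
  have h0 : idealDeg (⊥ : Ideal (MvPolynomial (Fin n) k)) i = ⊥ := by
    rw [eq_bot_iff]
    intro p hp
    exact (mem_idealDeg.1 hp).1
  rw [h0, finrank_bot, add_zero, finrank_homogeneousSubmodule, card_monom hn] at h
  rw [h]
  congr 2
  omega

/-- The Hilbert function of a complete intersection of `n` forms of degree `d`. -/
theorem hilbertFunction_initIdeal {d : ℕ} (hn : 0 < n) {w : ℕ → MvPolynomial (Fin n) k}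
    (hw : RegSeq w n) (hwd : ∀ i < n, (w i).IsHomogeneous d)
    (hproper : ∀ i < n, w i ∉ initIdeal w i) (i : ℕ) :
    hilbertFunction (initIdeal w n) i = seqT n d i := by
  have h := hilbertSeries_initIdeal hw hwd hproper
  rw [hilbertSeries_bot hn] at h
  -- The polynomial ring contributes 1/(1 - X)^n, which cancels the factor (1 - X)^n of (1 - X^d)^n.
  have h1 : (1 - PowerSeries.X ^ d : PowerSeries ℤ) =
      (∑ a ∈ Finset.range d, (PowerSeries.X : PowerSeries ℤ) ^ a) * (1 - PowerSeries.X) :=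
    (geom_sum_mul_neg _ _).symm
  have h2 : (1 - PowerSeries.X : PowerSeries ℤ) ^ n * (PowerSeries.invOneSubPow ℤ n).val = 1 := by
    rw [← PowerSeries.invOneSubPow_inv_eq_one_sub_pow]
    exact (PowerSeries.invOneSubPow ℤ n).inv_val
  rw [h1, mul_pow, mul_assoc, h2, mul_one] at h
  have h3 := congrArg (PowerSeries.coeff i) h
  rw [hilbertSeries, PowerSeries.coeff_mk] at h3
  have h4 : (∑ a ∈ Finset.range d, (PowerSeries.X : PowerSeries ℤ) ^ a) ^ n =
      ((((∑ a ∈ Finset.range d, (Polynomial.X : Polynomial ℕ) ^ a) ^ n).map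
        (Nat.castRingHom ℤ) : Polynomial ℤ) : PowerSeries ℤ) := by
    rw [← Polynomial.coeToPowerSeries.ringHom_apply, Polynomial.map_pow, map_pow,
      Polynomial.map_sum, map_sum]
    simp
  rw [h4, Polynomial.coeff_coe, Polynomial.coeff_map] at h3
  exact Nat.cast_injective h3

theorem natDegree_geomSum_le (d : ℕ) :
    (∑ a ∈ Finset.range d, (Polynomial.X : Polynomial ℕ) ^ a).natDegree ≤ d - 1 := by
  refine Polynomial.natDegree_sum_le_of_forall_le _ _ fun a ha => ?_
  rw [Polynomial.natDegree_X_pow]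
  have := Finset.mem_range.1 ha
  omega

/-- The value 1 in the top degree is what makes the dual form unique up to a scalar. -/
theorem seqT_top {d : ℕ} (hd : 0 < d) : seqT n d (n * (d - 1)) = 1 := by
  rw [seqT, Polynomial.coeff_pow_of_natDegree_le (natDegree_geomSum_le d), Polynomial.finsetSum_coeff]
  simp only [Polynomial.coeff_X_pow]
  rw [Finset.sum_ite_eq, if_pos (Finset.mem_range.2 (by omega)), one_pow]

theorem seqT_eq_zero {d i : ℕ} (hi : n * (d - 1) < i) : seqT n d i = 0 := by
  refine Polynomial.coeff_eq_zero_of_natDegree_lt ?_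
  exact lt_of_le_of_lt (Polynomial.natDegree_pow_le_of_le n (natDegree_geomSum_le d)) hi

end Coordinates
end Catalecticant

namespace Catalecticant

/-! ### Complete intersections of n forms in n variables. -/

section CompleteIntersection
variable {k : Type*} [Field k] {n d : ℕ}

/-- The polynomials `f` have no common zero away from the origin. -/
def NoCommonZero (f : Fin n → MvPolynomial (Fin n) k) : Prop :=
  ∀ x : Fin n → k, x ≠ 0 → ∃ i, eval x (f i) ≠ 0

theorem initIdeal_congr {R : Type*} [CommRing R] {w w' : ℕ → R} {j : ℕ} (h : ∀ i < j, w i = w' i) :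
    initIdeal w j = initIdeal w' j := by
  rw [initIdeal, initIdeal, Set.image_congr (s := Set.Iio j) fun i hi => h i hi]

theorem initIdeal_le_irrelevant {w : ℕ → MvPolynomial (Fin n) k} {j : ℕ}
    (hw : ∀ i < j, w i ∈ irrelevant k n) : initIdeal w j ≤ irrelevant k n := by
  refine Ideal.span_le.2 ?_
  rintro _ ⟨i, hi, rfl⟩
  exact hw i hi

theorem one_notMem_irrelevant : (1 : MvPolynomial (Fin n) k) ∉ irrelevant k n := by
  rw [irrelevant, ← Set.image_univ, mem_ideal_span_X_image]
  intro h
  obtain ⟨i, -, hi⟩ := h 0 (by simp)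
  exact hi rfl

theorem RegSeq.notMem_initIdeal {w : ℕ → MvPolynomial (Fin n) k} {j : ℕ} (hw : RegSeq w j)
    (hm : ∀ i < j, w i ∈ irrelevant k n) {i : ℕ} (hi : i < j) : w i ∉ initIdeal w i := by
  intro h
  exact one_notMem_irrelevant (initIdeal_le_irrelevant (fun l hl => hm l (by omega))
    (hw i hi 1 (by rwa [mul_one])))

theorem isHomogeneous_of_mem_span {s : Set (MvPolynomial (Fin n) k)}
    (hs : ∀ a ∈ s, a.IsHomogeneous d) {a : MvPolynomial (Fin n) k}
    (ha : a ∈ Submodule.span k s) : a.IsHomogeneous d := by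
  have : Submodule.span k s ≤ homogeneousSubmodule (Fin n) k d := Submodule.span_le.2 hs
  exact this ha

theorem RegSeq.linearIndependent {w : ℕ → MvPolynomial (Fin n) k} {j : ℕ} (hw : RegSeq w j)
    (hm : ∀ i < j, w i ∈ irrelevant k n) : LinearIndependent k (fun i : Fin j => w i) := by
  induction j with
  | zero => exact linearIndependent_empty_type
  | succ j ih =>
    have h1 := ih (fun i hi => hw i (by omega)) (fun i hi => hm i (by omega))
    have h2 : w j ∉ Submodule.span k (Set.range fun i : Fin j => w i) := by
      intro h
      refine hw.notMem_initIdeal hm (Nat.lt_succ_self j) ?_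
      have : Submodule.span k (Set.range fun i : Fin j => w i) ≤
          (initIdeal w j).restrictScalars k := by
        refine Submodule.span_le.2 ?_
        rintro _ ⟨i, rfl⟩
        exact Ideal.subset_span ⟨i, i.2, rfl⟩
      exact this h
    rw [linearIndependent_finSucc']
    exact ⟨h1, h2⟩

theorem span_restrict_le (s : Set (MvPolynomial (Fin n) k)) :
    Submodule.span k s ≤ (Ideal.span s).restrictScalars k :=
  Submodule.span_le.2 Ideal.subset_span

theorem idealDeg_span_self {ι : Type*} [Finite ι] {f : ι → MvPolynomial (Fin n) k}
    (hfd : ∀ i, (f i).IsHomogeneous d) :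
    idealDeg (Ideal.span (Set.range f)) d = Submodule.span k (Set.range f) := by
  classical
  have := Fintype.ofFinite ι
  apply le_antisymm
  · rintro p ⟨hp, hpd⟩
    obtain ⟨c, rfl⟩ := (Submodule.mem_span_range_iff_exists_fun _).1 hp
    have h1 := homogeneousComponent_of_mem (m := d) (n := d) hpd
    rw [if_pos rfl, map_sum] at h1
    rw [← h1]
    refine Submodule.sum_mem _ fun i _ => ?_
    rw [smul_eq_mul, mul_comm]
    have h2 := homogeneousComponent_mul (hfd i) (c i) 0
    rw [zero_add] at h2
    rw [h2, homogeneousComponent_zero, mul_comm, ← smul_eq_C_mul]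
    exact Submodule.smul_mem _ _ (Submodule.subset_span ⟨i, rfl⟩)
  · refine Submodule.span_le.2 ?_
    rintro _ ⟨i, rfl⟩
    exact ⟨Ideal.subset_span ⟨i, rfl⟩, hfd i⟩

variable [IsAlgClosed k]

/-- Nullstellensatz: f has no zero other than possibly the origin, where the variables vanish. -/
theorem NoCommonZero.X_mem_radical {f : Fin n → MvPolynomial (Fin n) k} (hf : NoCommonZero f)
    (i : Fin n) : X i ∈ (Ideal.span (Set.range f)).radical := by
  rw [← vanishingIdeal_zeroLocus_eq_radical (K := k), mem_vanishingIdeal_iff]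
  intro x hx
  by_cases h0 : x = 0
  · simp [h0]
  · obtain ⟨j, hj⟩ := hf x h0
    exact absurd (hx _ (Ideal.subset_span ⟨j, rfl⟩)) hj

/-- The terms are chosen one by one in the span of f. An associated prime of an initial ideal with
fewer than n terms that contained f would contain all variables, which `depth_pos` forbids, so prime
avoidance applies. -/
theorem NoCommonZero.exists_regSeq (hn : 0 < n) {f : Fin n → MvPolynomial (Fin n) k}
    (hf : NoCommonZero f) (hfd : ∀ i, (f i).IsHomogeneous d) (hd : d ≠ 0) :
    ∃ w : ℕ → MvPolynomial (Fin n) k, RegSeq w n ∧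
      (∀ i, w i ∈ Submodule.span k (Set.range f)) := by
  have hinf : Infinite k := IsAlgClosed.instInfinite
  have hW : ∀ a ∈ Submodule.span k (Set.range f), a ∈ irrelevant k n := fun a ha =>
    mem_irrelevant_of_isHomogeneous (isHomogeneous_of_mem_span
      (by rintro _ ⟨i, rfl⟩; exact hfd i) ha) hd
  have : ∀ j ≤ n, ∃ w : ℕ → MvPolynomial (Fin n) k, RegSeq w j ∧
      (∀ i, w i ∈ Submodule.span k (Set.range f)) := by
    intro j
    induction j with
    | zero => exact fun _ => ⟨0, fun i hi => by omega, fun _ => zero_mem _⟩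
    | succ j ih =>
      intro hj
      obtain ⟨w, hw, hwW⟩ := ih (by omega)
      have hne : (⊥ : Submodule k (Submodule.span k (Set.range f))) ≠ ⊤ := by
        intro hbot
        obtain ⟨i, hi⟩ := hf (fun _ => 1) (fun h => one_ne_zero (congrFun h ⟨0, hn⟩))
        have h1 : (⟨f i, Submodule.subset_span ⟨i, rfl⟩⟩ : Submodule.span k (Set.range f)) ∈
            (⊥ : Submodule k (Submodule.span k (Set.range f))) := by rw [hbot]; trivial
        have h2 : f i = 0 := congrArg Subtype.val ((Submodule.mem_bot k).1 h1)
        rw [h2] at hi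
        simp at hi
      obtain ⟨a, -, ha⟩ := exists_regMod (fun _ : Unit => initIdeal w j)
        (Submodule.span k (Set.range f)) ⊥ hne (by
          rintro - P hP ⟨y, hy, hyP⟩
          by_contra! hcon
          refine hy (depth_pos n j (by omega) w hw (fun i _ => hW _ (hwW i)) y fun i => ?_)
          rw [← hyP]
          have hle : Ideal.span (Set.range f) ≤ P := by
            refine Ideal.span_le.2 ?_
            rintro _ ⟨i, rfl⟩
            exact hcon _ (Submodule.subset_span ⟨i, rfl⟩)
          exact (hP.radical_le_iff.2 hle) (hf.X_mem_radical i))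
      refine ⟨Function.update w j a, fun i hi => ?_, fun i => ?_⟩
      · have hI : initIdeal (Function.update w j a) i = initIdeal w i :=
          initIdeal_congr fun l hl => Function.update_of_ne (by omega) _ _
        rw [hI]
        by_cases hij : i = j
        · subst hij
          rw [Function.update_self]
          exact ha ()
        · rw [Function.update_of_ne hij]
          exact hw i (by omega)
      · by_cases hij : i = j
        · subst hij
          rw [Function.update_self]
          exact a.2
        · rw [Function.update_of_ne hij]
          exact hwW i
  exact this n le_rfl

/-- `n` forms of degree `d` in `n` variables without common zeros are linearly independent, and the
ideal they generate is generated by a regular sequence of forms of degree `d`. -/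
theorem NoCommonZero.exists_regSeq_eq (hn : 0 < n) {f : Fin n → MvPolynomial (Fin n) k}
    (hf : NoCommonZero f) (hfd : ∀ i, (f i).IsHomogeneous d) (hd : d ≠ 0) :
    LinearIndependent k f ∧ ∃ w : ℕ → MvPolynomial (Fin n) k, RegSeq w n ∧
      (∀ i, (w i).IsHomogeneous d) ∧ Ideal.span (Set.range f) = initIdeal w n := by
  obtain ⟨w, hw, hwW⟩ := hf.exists_regSeq hn hfd hd
  have hwd : ∀ i, (w i).IsHomogeneous d := fun i =>
    isHomogeneous_of_mem_span (by rintro _ ⟨i, rfl⟩; exact hfd i) (hwW i)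
  have hli := hw.linearIndependent fun i _ => mem_irrelevant_of_isHomogeneous (hwd i) hd
  have hle : Submodule.span k (Set.range fun i : Fin n => w i) ≤ Submodule.span k (Set.range f) := by
    refine Submodule.span_le.2 ?_
    rintro _ ⟨i, rfl⟩
    exact hwW i
  have hfin : Module.finrank k (Submodule.span k (Set.range fun i : Fin n => w i)) = n := by
    rw [finrank_span_eq_card hli, Fintype.card_fin]
  have hfd' : Module.Finite k (Submodule.span k (Set.range f)) :=
    Module.Finite.span_of_finite k (Set.finite_range f)
  have hle2 : Module.finrank k (Submodule.span k (Set.range f)) ≤ n := by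
    have := finrank_range_le_card (R := k) f
    rwa [Fintype.card_fin] at this
  -- The w i are n independent elements of a space spanned by n vectors, so the two spans agree;
  -- this also makes f independent.
  have heq := Submodule.eq_of_le_of_finrank_le hle (by rw [hfin]; exact hle2)
  refine ⟨?_, w, hw, hwd, ?_⟩
  · rw [linearIndependent_iff_card_eq_finrank_span, Fintype.card_fin, Set.finrank, ← heq, hfin]
  · have hr : Set.range (fun i : Fin n => w i) = w '' Set.Iio n := by
      ext y
      simp only [Set.mem_range, Set.mem_image, Set.mem_Iio]
      exact ⟨fun ⟨i, hi⟩ => ⟨i, i.2, hi⟩, fun ⟨i, hi, h⟩ => ⟨⟨i, hi⟩, h⟩⟩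
    rw [hr] at heq
    apply le_antisymm
    · refine Ideal.span_le.2 ?_
      rintro _ ⟨i, rfl⟩
      have : f i ∈ Submodule.span k (w '' Set.Iio n) := by
        rw [heq]; exact Submodule.subset_span ⟨i, rfl⟩
      exact span_restrict_le _ this
    · refine Ideal.span_le.2 ?_
      rintro _ ⟨i, hi, rfl⟩
      exact span_restrict_le _ (hwW i)

theorem NoCommonZero.hilbertFunction_eq (hn : 0 < n) {f : Fin n → MvPolynomial (Fin n) k}
    (hf : NoCommonZero f) (hfd : ∀ i, (f i).IsHomogeneous d) (hd : d ≠ 0) (i : ℕ) :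
    hilbertFunction (Ideal.span (Set.range f)) i = seqT n d i := by
  obtain ⟨-, w, hw, hwd, heq⟩ := hf.exists_regSeq_eq hn hfd hd
  rw [heq]
  exact hilbertFunction_initIdeal hn hw (fun i _ => hwd i)
    (fun i hi => hw.notMem_initIdeal (fun l _ => mem_irrelevant_of_isHomogeneous (hwd l) hd) hi) i

/-- Forms of degree exceeding the socle degree lie in the ideal. -/
theorem NoCommonZero.mem_of_lt (hn : 0 < n) {f : Fin n → MvPolynomial (Fin n) k}
    (hf : NoCommonZero f) (hfd : ∀ i, (f i).IsHomogeneous d) (hd : d ≠ 0) {e : ℕ}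
    (hle : n * (d - 1) < e) {h : MvPolynomial (Fin n) k} (he : h.IsHomogeneous e) :
    h ∈ Ideal.span (Set.range f) := by
  have h0 := hf.hilbertFunction_eq hn hfd hd e
  rw [seqT_eq_zero hle] at h0
  have h1 := hilbertFunction_add (Ideal.span (Set.range f)) e
  rw [h0, zero_add] at h1
  have h2 : idealDeg (Ideal.span (Set.range f)) e = homogeneousSubmodule (Fin n) k e :=
    Submodule.eq_of_le_of_finrank_eq inf_le_right h1
  have h3 : h ∈ idealDeg (Ideal.span (Set.range f)) e := by rw [h2]; exact he
  exact h3.1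

/-- Gorenstein duality: a form outside the ideal has a multiple of the socle degree outside the
ideal. -/
theorem NoCommonZero.exists_mul_notMem (hn : 0 < n) {f : Fin n → MvPolynomial (Fin n) k}
    (hf : NoCommonZero f) (hfd : ∀ i, (f i).IsHomogeneous d) (hd : d ≠ 0) :
    ∀ (r e : ℕ) (h : MvPolynomial (Fin n) k), n * (d - 1) + 1 ≤ e + r → h.IsHomogeneous e →
      h ∉ Ideal.span (Set.range f) → ∃ g : MvPolynomial (Fin n) k,
        (g * h).IsHomogeneous (n * (d - 1)) ∧ g * h ∉ Ideal.span (Set.range f) := by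
  have hinf : Infinite k := IsAlgClosed.instInfinite
  intro r
  induction r with
  | zero =>
    intro e h her he hh
    exact absurd (hf.mem_of_lt hn hfd hd (by omega) he) hh
  | succ r ih =>
    intro e h her he hh
    by_cases heN : e = n * (d - 1)
    · exact ⟨1, by rwa [one_mul, ← heN], by rwa [one_mul]⟩
    · obtain ⟨-, w, hw, hwd, heq⟩ := hf.exists_regSeq_eq hn hfd hd
      -- There is no socle outside degree n(d-1), so some multiple X i * h stays outside the ideal;
      -- its degree is one higher.
      have : ¬ ∀ i, X i * h ∈ Ideal.span (Set.range f) := by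
        intro hall
        rw [heq] at hall hh
        refine hh (socle_degree n w (fun _ => d) hw (fun i _ => hwd i) (fun _ _ => hd) h e he hall ?_)
        rw [Finset.sum_const, Finset.card_range, smul_eq_mul]
        intro h1
        apply heN
        rw [Nat.mul_sub, mul_one]
        omega
      push Not at this
      obtain ⟨i, hi⟩ := this
      obtain ⟨g, hg1, hg2⟩ := ih (1 + e) (X i * h) (by omega) ((isHomogeneous_X _ i).mul he) hi
      exact ⟨g * X i, by rwa [mul_assoc], by rwa [mul_assoc]⟩

end CompleteIntersection
end Catalecticant

namespace Catalecticant

/-! ### Algebraic independence along chains of primes. -/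

section TranscendenceDegree
variable {k : Type*} [Field k]

/-- The elements `x i` are algebraically independent modulo `Q`. -/
def IndepMod {R : Type*} [CommRing R] [Algebra k R] (Q : Ideal R) {ι : Type*} (x : ι → R) : Prop :=
  ∀ p : MvPolynomial ι k, aeval x p ∈ Q → p = 0

theorem indepMod_iff {R : Type*} [CommRing R] [Algebra k R] (Q : Ideal R) {ι : Type*} (x : ι → R) :
    IndepMod (k := k) Q x ↔ AlgebraicIndependent k (fun i => Ideal.Quotient.mkₐ k Q (x i)) := by
  rw [algebraicIndependent_iff]
  refine forall_congr' fun p => ?_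
  have : aeval (fun i => Ideal.Quotient.mkₐ k Q (x i)) p = Ideal.Quotient.mkₐ k Q (aeval x p) := by
    rw [comp_aeval_apply]
  rw [this, Ideal.Quotient.mkₐ_eq_mk, Ideal.Quotient.eq_zero_iff_mem]

/-- Passing to a strictly smaller prime ideal increases the transcendence degree of the quotient. -/
theorem IndepMod.of_lt {R : Type*} [CommRing R] [Algebra k R] {Q Q' : Ideal R} [Q.IsPrime]
    (hlt : Q < Q') {r : ℕ} {x : Fin r → R} (hx : IndepMod (k := k) Q' x) :
    ∃ y : Fin (r + 1) → R, IndepMod (k := k) Q y := by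
  obtain ⟨a, haQ', haQ⟩ := Set.exists_of_ssubset hlt
  have hxQ : IndepMod (k := k) Q x := fun p hp => hx p (hlt.le hp)
  have hy := (indepMod_iff Q x).1 hxQ
  -- If a were algebraic, some nonzero polynomial in x would be a multiple of a modulo Q, hence
  -- would lie in Q', modulo which x is independent.
  have htr : Transcendental (Algebra.adjoin k (Set.range fun i => Ideal.Quotient.mkₐ k Q (x i)))
      (Ideal.Quotient.mkₐ k Q a) := by
    intro halg
    have ha0 : Ideal.Quotient.mkₐ k Q a ≠ 0 := fun h => haQ (Ideal.Quotient.eq_zero_iff_mem.1 h)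
    obtain ⟨⟨s, hs⟩, hs0, u, hu⟩ := halg.exists_nonzero_dvd (mem_nonZeroDivisors_of_ne_zero ha0)
    rw [Algebra.adjoin_range_eq_range_aeval] at hs
    obtain ⟨p, rfl⟩ := hs
    obtain ⟨u, rfl⟩ := Ideal.Quotient.mkₐ_surjective k Q u
    have hp : aeval (fun i => Ideal.Quotient.mkₐ k Q (x i)) p =
        Ideal.Quotient.mkₐ k Q (aeval x p) := by
      rw [comp_aeval_apply]
    have h1 : aeval x p - a * u ∈ Q := by
      rw [← Ideal.Quotient.eq_zero_iff_mem, ← Ideal.Quotient.mkₐ_eq_mk k, map_sub, map_mul, ← hp,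
        sub_eq_zero]
      exact hu
    have h2 : aeval x p ∈ Q' := by
      have := Q'.add_mem (hlt.le h1) (Q'.mul_mem_right u haQ')
      simpa using this
    apply hs0
    ext
    simp [hx p h2]
  have h3 := (hy.option_iff_transcendental _).2 htr
  let e : Fin (r + 1) ≃ Option (Fin r) := finSuccEquiv r
  refine ⟨fun i => (e i).elim a x, (indepMod_iff _ _).2 ?_⟩
  have h4 := h3.comp e e.injective
  convert h4 using 2 with i
  simp only [Function.comp]
  cases e i <;> rfl

theorem IndepMod.le_card {σ : Type*} [Fintype σ] {Q : Ideal (MvPolynomial σ k)} {r : ℕ}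
    {x : Fin r → MvPolynomial σ k} (hx : IndepMod (k := k) Q x) : r ≤ Fintype.card σ := by
  have h1 : IndepMod (k := k) (⊥ : Ideal (MvPolynomial σ k)) x := fun p hp =>
    hx p (by rw [Ideal.mem_bot.1 hp]; exact zero_mem _)
  have h2 : AlgebraicIndependent k x := algebraicIndependent_iff.2 h1
  have h3 := h2.lift_cardinalMk_le_trdeg
  rw [MvPolynomial.trdeg_of_isDomain] at h3
  simpa using h3

end TranscendenceDegree

/-! ### A Jacobian criterion in characteristic zero. -/

section Jacobian
variable {k : Type*} [Field k] {σ τ : Type*}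

theorem pderiv_aeval [Fintype σ] (g : σ → MvPolynomial τ k) (t : τ) (p : MvPolynomial σ k) :
    pderiv t (aeval g p) = ∑ s, aeval g (pderiv s p) * pderiv t (g s) := by
  classical
  induction p using MvPolynomial.induction_on with
  | C a => simp [algHom_C]
  | add p q hp hq => simp only [map_add, hp, hq, add_mul, Finset.sum_add_distrib]
  | mul_X p i hp =>
    simp only [map_mul, Derivation.leibniz, aeval_X, smul_eq_mul, map_add, add_mul,
      Finset.sum_add_distrib, hp, pderiv_X, Finset.mul_sum]
    congr 1
    · rw [Finset.sum_eq_single i]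
      · simp
      · intro b _ hb
        simp [hb.symm]
      · simp
    · refine Finset.sum_congr rfl fun s _ => ?_
      ring

theorem totalDegree_pderiv_le {p : MvPolynomial σ k} {N : ℕ} (hp : p.totalDegree ≤ N + 1) (s : σ) :
    (pderiv s p).totalDegree ≤ N := by
  refine Finset.sup_le fun m hm => ?_
  have h1 : coeff (m + Finsupp.single s 1) p ≠ 0 := by
    intro h0
    rw [mem_support_iff, coeff_pderiv, h0, zero_mul] at hm
    exact hm rfl
  have h2 := le_totalDegree (mem_support_iff.2 h1)
  rw [Finsupp.sum_add_index' (by simp) (by simp)] at h2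
  simp at h2
  omega

theorem eq_C_of_pderiv_eq_zero [CharZero k] {p : MvPolynomial σ k} (hp : ∀ s, pderiv s p = 0) :
    p = C (coeff 0 p) := by
  classical
  ext m
  rw [coeff_C]
  split_ifs with h
  · rw [h]
  · obtain ⟨s, hs⟩ : ∃ s, m s ≠ 0 := by
      by_contra! hcon
      exact h (Finsupp.ext fun s => (hcon s).symm)
    have hm : m = (m - Finsupp.single s 1) + Finsupp.single s 1 := by
      rw [tsub_add_cancel_of_le]
      rw [Finsupp.single_le_iff]
      omega
    have h1 := coeff_pderiv (i := s) p (m - Finsupp.single s 1)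
    rw [hp s, coeff_zero, ← hm] at h1
    refine (mul_eq_zero.1 h1.symm).resolve_right ?_
    exact Nat.cast_add_one_ne_zero _

/-- Jacobian criterion: an ideal of relations closed under partial derivatives is zero. -/
theorem eq_zero_of_pderiv_closed [CharZero k] (g : σ → MvPolynomial τ k)
    (S : Set (MvPolynomial σ k)) (hS : ∀ p ∈ S, aeval g p = 0 → ∀ s, pderiv s p ∈ S ∧
      aeval g (pderiv s p) = 0) : ∀ p ∈ S, aeval g p = 0 → p = 0 := by
  -- By induction on the degree all partial derivatives vanish, so p is a constant, and that
  -- constant is its value at g.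
  have key : ∀ (N : ℕ), ∀ p ∈ S, p.totalDegree ≤ N → aeval g p = 0 → p = 0 := by
    intro N
    induction N with
    | zero =>
      intro p _ hN hp
      rw [Nat.le_zero, totalDegree_eq_zero_iff_eq_C] at hN
      rw [hN, algHom_C, algebraMap_eq] at hp
      rw [hN, C_eq_zero.1 hp, C_0]
    | succ N ih =>
      intro p hpS hN hp
      have h1 := eq_C_of_pderiv_eq_zero fun s =>
        ih (pderiv s p) (hS p hpS hp s).1 (totalDegree_pderiv_le hN s) (hS p hpS hp s).2
      rw [h1, algHom_C, algebraMap_eq] at hp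
      rw [h1, C_eq_zero.1 hp, C_0]
  exact fun p hpS hp => key _ p hpS le_rfl hp

end Jacobian
end Catalecticant

/-! ### The locus of tuples with a common zero and its parametrization. -/

namespace Catalecticant

theorem eval_aeval {k σ τ : Type*} [CommSemiring k] (g : σ → MvPolynomial τ k) (y : τ → k)
    (p : MvPolynomial σ k) : eval y (aeval g p) = eval (fun s => eval y (g s)) p := by
  rw [← coe_aeval_eq_eval, ← coe_aeval_eq_eval]
  exact comp_aeval_apply g (aeval y) p

theorem aeval_eq_eval_apply {k σ : Type*} [CommSemiring k] (a : σ → k) (p : MvPolynomial σ k) :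
    aeval a p = eval a p :=
  DFunLike.congr_fun (coe_aeval_eq_eval a) p

theorem polynomial_eval_aeval {k σ : Type*} [CommSemiring k] (g : σ → Polynomial k) (t : k)
    (p : MvPolynomial σ k) : (aeval g p : Polynomial k).eval t = eval (fun s => (g s).eval t) p := by
  rw [← Polynomial.coe_aeval_eq_eval, ← coe_aeval_eq_eval]
  exact comp_aeval_apply g (Polynomial.aeval t) p

section Elimination
variable {k : Type*} [Field k] {n d : ℕ}

/-- The tuple of forms with coefficients `a`. -/
noncomputable def tupleForm (a : Fin n × Monom n d → k) (i : Fin n) : MvPolynomial (Fin n) k :=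
  formOf fun m => a (i, m)

theorem tupleForm_isHomogeneous (a : Fin n × Monom n d → k) (i : Fin n) :
    (tupleForm a i).IsHomogeneous d := formOf_isHomogeneous _

theorem mem_commonZeroLocus {a : Fin n × Monom n d → k} :
    a ∈ commonZeroLocus k n d ↔ ¬ NoCommonZero (tupleForm a) := by
  simp only [NoCommonZero, not_forall, not_exists, not_not, exists_prop]
  rfl

theorem eval_formOf {j : ℕ} (v : Monom n j → k) (x : Fin n → k) :
    eval x (formOf v) = ∑ m, v m * eval x (monomial m.1 1) := by
  rw [formOf, map_sum]
  refine Finset.sum_congr rfl fun m _ => ?_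
  simp [eval_monomial]

theorem eval_homogeneousComponent (e : ℕ) (p : MvPolynomial (Fin n) k) (x : Fin n → k) :
    eval x (homogeneousComponent e p) =
      ∑ m : Monom n e, coeff m.1 p * eval x (monomial m.1 1) := by
  rw [← formOf_coeffVec (homogeneousComponent_isHomogeneous e p), eval_formOf]
  refine Finset.sum_congr rfl fun m _ => ?_
  rw [coeffVec, coeff_homogeneousComponent, if_pos m.2]

/-- The exponent vector of the `j`-th power of a variable. -/
noncomputable def pureMonom (n j : ℕ) (i : Fin n) : Monom n j := ⟨Finsupp.single i j, by simp⟩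

theorem eval_pureMonom (j : ℕ) (i : Fin n) (x : Fin n → k) :
    eval x (monomial (pureMonom n j i).1 1) = x i ^ j := by
  simp [pureMonom, eval_monomial]

/-- The complement of the common zero locus is Zariski open. -/
theorem exists_separating [IsAlgClosed k] (hn : 0 < n) (hd : d ≠ 0) {a₀ : Fin n × Monom n d → k}
    (h₀ : NoCommonZero (tupleForm a₀)) :
    ∃ Δ : MvPolynomial (Fin n × Monom n d) k, eval a₀ Δ ≠ 0 ∧
      ∀ a ∈ commonZeroLocus k n d, eval a Δ = 0 := by
  classical
  -- The first degree beyond the socle degree, where the ideal of a tuple without common zero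
  -- contains every monomial.
  let e := n * (d - 1) + 1
  have hc : ∀ m : Monom n e, ∃ c : Fin n → MvPolynomial (Fin n) k,
      ∑ i, c i * tupleForm a₀ i = monomial m.1 1 := fun m =>
    (Submodule.mem_span_range_iff_exists_fun _).1
      (h₀.mem_of_lt hn (tupleForm_isHomogeneous a₀) hd (Nat.lt_succ_self _)
        (isHomogeneous_monomial 1 m.2))
  choose c hc using hc
  let u : Fin n → MvPolynomial (Fin n) (MvPolynomial (Fin n × Monom n d) k) := fun i =>
    ∑ m : Monom n d, monomial m.1 (X (i, m))
  -- The same combinations, taken of the generic tuple. This matrix is the identity at a₀; at a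
  -- tuple with a zero x it kills the nonzero vector of the monomials evaluated at x.
  let E : Matrix (Monom n e) (Monom n e) (MvPolynomial (Fin n × Monom n d) k) :=
    Matrix.of fun m m' => coeff m'.1 (∑ i, map C (c m i) * u i)
  have hE : ∀ a, (eval a).mapMatrix E =
      Matrix.of fun m m' : Monom n e => coeff m'.1 (∑ i, c m i * tupleForm a i) := by
    intro a
    ext m m'
    have hu : ∀ i, map (eval a) (u i) = tupleForm a i := by
      intro i
      simp [u, tupleForm, formOf, map_sum, map_monomial]
    have hC : ∀ p : MvPolynomial (Fin n) k, map (eval a) (map C p) = p := by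
      intro p
      rw [map_map]
      convert map_id p
      ext
      simp
    simp only [RingHom.mapMatrix_apply, Matrix.map_apply, E, Matrix.of_apply]
    rw [← coeff_map, map_sum]
    simp only [map_mul, hu, hC]
  refine ⟨E.det, ?_, fun a ha => ?_⟩
  · rw [RingHom.map_det, hE]
    have : (Matrix.of fun m m' : Monom n e => coeff m'.1 (∑ i, c m i * tupleForm a₀ i)) =
        (1 : Matrix (Monom n e) (Monom n e) k) := by
      ext m m'
      simp only [Matrix.of_apply, hc, coeff_monomial, Matrix.one_apply, Subtype.ext_iff]
    rw [this, Matrix.det_one]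
    exact one_ne_zero
  · obtain ⟨x, hx0, hx⟩ := ha
    rw [RingHom.map_det, hE, ← Matrix.exists_mulVec_eq_zero_iff]
    refine ⟨fun m => eval x (monomial m.1 1), ?_, ?_⟩
    · obtain ⟨j, hj⟩ := Function.ne_iff.1 hx0
      intro h
      have := congrFun h (pureMonom n e j)
      rw [eval_pureMonom] at this
      exact hj (pow_eq_zero_iff (Nat.succ_ne_zero _) |>.1 this)
    · ext m
      simp only [Matrix.mulVec, dotProduct, Matrix.of_apply, Pi.zero_apply]
      rw [← eval_homogeneousComponent, map_sum, map_sum]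
      refine Finset.sum_eq_zero fun i _ => ?_
      rw [mul_comm]
      by_cases hed : e < d
      · rw [homogeneousComponent_mul_of_lt (tupleForm_isHomogeneous a i) _ hed, map_zero]
      · obtain ⟨l, hl⟩ := Nat.exists_eq_add_of_le' (not_lt.1 hed)
        rw [hl, homogeneousComponent_mul (tupleForm_isHomogeneous a i), map_mul]
        rw [show eval x (tupleForm a i) = 0 from hx i, zero_mul]

/-- The coordinates of a point with last coordinate `1`. -/
noncomputable def affinePoint (k : Type*) [Field k] (d : ℕ) (z : Fin n) (j : Fin n) :
    MvPolynomial ((Fin n × Monom n d) ⊕ Fin n) k :=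
  if j = z then 1 else X (Sum.inr j)

open Classical in
/-- The generic tuple of forms vanishing at `affinePoint`. -/
noncomputable def incidence (k : Type*) [Field k] (z : Fin n) (s : Fin n × Monom n d) :
    MvPolynomial ((Fin n × Monom n d) ⊕ Fin n) k :=
  if s.2 = pureMonom n d z then
    -∑ m ∈ Finset.univ.erase (pureMonom n d z),
      X (Sum.inl (s.1, m)) * aeval (affinePoint k d z) (monomial m.1 (1 : k))
  else X (Sum.inl s)

theorem eval_incidence (z : Fin n) (y : (Fin n × Monom n d) ⊕ Fin n → k) (i : Fin n) :
    eval (fun j => eval y (affinePoint k d z j))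
      (tupleForm (fun s => eval y (incidence k z s)) i) = 0 := by
  classical
  have hμ : ∀ m : Monom n d, eval y (aeval (affinePoint k d z) (monomial m.1 (1 : k))) =
      eval (fun j => eval y (affinePoint k d z j)) (monomial m.1 1) := by
    intro m
    exact eval_aeval _ _ _
  rw [tupleForm, eval_formOf, ← Finset.add_sum_erase _ _ (Finset.mem_univ (pureMonom n d z)),
    eval_pureMonom]
  have hz : eval y (affinePoint k d z z) = 1 := by simp [affinePoint]
  rw [hz, one_pow, mul_one]
  simp only [incidence, if_true, map_neg, map_sum, map_mul, eval_X, hμ]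
  rw [neg_add_eq_zero]
  refine Finset.sum_congr rfl fun m hm => ?_
  rw [if_neg (Finset.ne_of_mem_erase hm), eval_X]

theorem eval_smul_of_isHomogeneous {p : MvPolynomial (Fin n) k} {j : ℕ} (hp : p.IsHomogeneous j)
    (c : k) (x : Fin n → k) : eval (c • x) p = c ^ j * eval x p := by
  rw [← formOf_coeffVec hp, eval_formOf, eval_formOf, Finset.mul_sum]
  refine Finset.sum_congr rfl fun m _ => ?_
  have : eval (c • x) (monomial m.1 1) = c ^ j * eval x (monomial m.1 1) := by
    simp only [eval_monomial, one_mul, Pi.smul_apply, smul_eq_mul, mul_pow, Finsupp.prod_mul]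
    congr 1
    rw [Finsupp.prod, Finset.prod_pow_eq_pow_sum]
    congr 1
    exact m.2
  rw [this]
  ring

/-- Every value of the parametrization is a tuple with a zero whose coordinate z is 1, and over an
infinite field a polynomial vanishing at all points is zero. -/
theorem aeval_incidence_eq_zero [Infinite k] {z : Fin n} {p : MvPolynomial (Fin n × Monom n d) k}
    (hp : ∀ a ∈ commonZeroLocus k n d, eval a p = 0) : aeval (incidence k z) p = 0 := by
  refine MvPolynomial.funext fun y => ?_
  rw [map_zero]
  rw [eval_aeval]
  apply hp
  refine ⟨_, ?_, fun i => eval_incidence z y i⟩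
  intro h
  have := congrFun h z
  simp [affinePoint] at this

/-- Once the zero is scaled to x z = 1, the pair (a, x) is itself a parameter, and its image is a.
-/
theorem eval_eq_zero_of_aeval_incidence {z : Fin n} {p : MvPolynomial (Fin n × Monom n d) k}
    (hp : aeval (incidence k z) p = 0) {a : Fin n × Monom n d → k} {x : Fin n → k} (hxz : x z ≠ 0)
    (hx : ∀ i, eval x (tupleForm a i) = 0) : eval a p = 0 := by
  classical
  wlog hz1 : x z = 1 generalizing x
  · refine this (x := (x z)⁻¹ • x) (by simp [hxz]) (fun i => ?_) (by simp [hxz])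
    rw [eval_smul_of_isHomogeneous (tupleForm_isHomogeneous a i), hx, mul_zero]
  let y : (Fin n × Monom n d) ⊕ Fin n → k := Sum.elim a x
  have hy : ∀ j, eval y (affinePoint k d z j) = x j := by
    intro j
    unfold affinePoint
    split_ifs with h
    · rw [h, hz1, map_one]
    · simp [y]
  have hμ : ∀ m : Monom n d, eval y (aeval (affinePoint k d z) (monomial m.1 (1 : k))) =
      eval x (monomial m.1 1) := by
    intro m
    rw [eval_aeval]
    simp only [hy]
  have ha : (fun s => eval y (incidence k z s)) = a := by
    ext ⟨i, m⟩
    unfold incidence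
    split_ifs with h
    · simp only at h
      have h2 := hx i
      rw [tupleForm, eval_formOf, ← Finset.add_sum_erase _ _ (Finset.mem_univ (pureMonom n d z)),
        eval_pureMonom, hz1, one_pow, mul_one] at h2
      rw [h, map_neg, map_sum, eq_comm, ← sub_eq_zero, sub_neg_eq_add, ← h2]
      simp only [map_mul, eval_X, hμ]
      rfl
    · simp [y]
  have h1 := eval_aeval (incidence k z) y p
  rw [hp, map_zero, ha] at h1
  exact h1.symm

theorem polynomial_eval_zero_of_forall_ne [Infinite k] {q : Polynomial k} (hq : ∀ t ≠ 0, q.eval t = 0) :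
    q.eval 0 = 0 := by
  have : q = 0 := by
    refine Polynomial.eq_zero_of_infinite_isRoot q ?_
    refine Set.Infinite.mono (fun t ht => hq t ht) (Set.Finite.infinite_compl (Set.finite_singleton (0 : k)))
  rw [this, Polynomial.eval_zero]

/-- Zeros with x z = 0 are reached as a limit. The zero moves by t in direction z, and the
coefficients of x_j^d, for some j with x j ≠ 0, are corrected so that it remains a zero. The
resulting polynomial in t vanishes for t ≠ 0, hence at t = 0. -/
theorem eval_eq_zero_of_aeval_incidence' [Infinite k] {z : Fin n} {p : MvPolynomial (Fin n × Monom n d) k}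
    (hp : aeval (incidence k z) p = 0) {a : Fin n × Monom n d → k}
    (ha : a ∈ commonZeroLocus k n d) : eval a p = 0 := by
  classical
  obtain ⟨x, hx0, hx⟩ := ha
  change ∀ i, eval x (tupleForm a i) = 0 at hx
  by_cases hxz : x z ≠ 0
  · exact eval_eq_zero_of_aeval_incidence hp hxz hx
  push Not at hxz
  obtain ⟨j, hj⟩ := Function.ne_iff.1 hx0
  simp only [Pi.zero_apply] at hj
  have hjz : j ≠ z := fun h => hj (by rw [h, hxz])
  let xt : Fin n → Polynomial k := fun l => Polynomial.C (x l) + if l = z then Polynomial.X else 0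
  let A : Fin n × Monom n d → Polynomial k := fun s => Polynomial.C (a s) -
    if s.2 = pureMonom n d j then Polynomial.C ((x j ^ d)⁻¹) * aeval xt (tupleForm a s.1) else 0
  have hA : ∀ t, ((aeval A p : Polynomial k)).eval t = eval (fun s => (A s).eval t) p :=
    fun t => polynomial_eval_aeval A t p
  have hxt : ∀ t (q : MvPolynomial (Fin n) k), (aeval xt q : Polynomial k).eval t =
      eval (fun l => (xt l).eval t) q := fun t q => polynomial_eval_aeval xt t q
  have h0 : (fun l => (xt l).eval 0) = x := by
    ext l
    by_cases h : l = z <;> simp [xt, h]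
  have hA0 : (fun s => (A s).eval 0) = a := by
    ext s
    by_cases h : s.2 = pureMonom n d j <;> simp [A, h, hxt, h0, hx]
  have key := polynomial_eval_zero_of_forall_ne (q := (aeval A p : Polynomial k)) (fun t ht => by
    rw [hA]
    refine eval_eq_zero_of_aeval_incidence (x := fun l => (xt l).eval t) hp ?_ fun i => ?_
    · simp [xt, hxz, ht]
    · have h2 : eval (fun l => (xt l).eval t) (tupleForm (fun s => (A s).eval t) i) =
          eval (fun l => (xt l).eval t) (tupleForm a i) -
            (x j ^ d)⁻¹ * eval (fun l => (xt l).eval t) (tupleForm a i) * (xt j).eval t ^ d := by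
        have : ∀ m : Monom n d, (A (i, m)).eval t = a (i, m) - if m = pureMonom n d j then
            (x j ^ d)⁻¹ * eval (fun l => (xt l).eval t) (formOf fun m => a (i, m)) else 0 := by
          intro m
          by_cases h : m = pureMonom n d j
          · simp [A, h, hxt, tupleForm]
          · simp [A, h]
        conv_lhs => rw [tupleForm, funext this, eval_formOf]
        simp only [sub_mul, Finset.sum_sub_distrib, ite_mul, zero_mul, Finset.sum_ite_eq',
          Finset.mem_univ, if_true]
        rw [← eval_formOf, eval_pureMonom]
        rfl
      rw [h2]
      have h3 : (xt j).eval t = x j := by simp [xt, hjz]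
      rw [h3]
      field_simp
      ring)
  rw [hA, hA0] at key
  exact key

end Elimination
end Catalecticant

namespace Catalecticant

/-! ### Existence of the resultant. -/

section Resultant
variable {k : Type*} [Field k] {n d : ℕ}

theorem noCommonZero_X_pow (d : ℕ) :
    NoCommonZero (fun i => (X i : MvPolynomial (Fin n) k) ^ d) := by
  intro x hx
  obtain ⟨i, hi⟩ := Function.ne_iff.1 hx
  refine ⟨i, ?_⟩
  rw [map_pow, eval_X]
  exact pow_ne_zero _ hi

theorem tupleForm_coeff {f : Fin n → MvPolynomial (Fin n) k} (hf : ∀ i, (f i).IsHomogeneous d) :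
    tupleForm (fun p : Fin n × Monom n d => coeff p.2.1 (f p.1)) = f :=
  funext fun i => formOf_coeffVec (hf i)

theorem pderiv_incidence_inl (z i : Fin n) (m : Monom n d) (hm : m ≠ pureMonom n d z)
    (t : (Fin n × Monom n d) ⊕ Fin n) [Decidable (Sum.inl (i, m) = t)] :
    pderiv t (incidence k z (i, m)) = if Sum.inl (i, m) = t then 1 else 0 := by
  classical
  rw [incidence, if_neg hm]
  split_ifs with h
  · rw [← h, pderiv_X_self]
  · rw [pderiv_X_of_ne h]

/-- A single chart z suffices to describe the vanishing ideal as the kernel of a map into a domain,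
so it is prime. -/
theorem mem_vanishingIdeal_commonZeroLocus [IsAlgClosed k] (z : Fin n) (p : MvPolynomial (Fin n × Monom n d) k) :
    p ∈ vanishingIdeal k (commonZeroLocus k n d) ↔ aeval (incidence k z) p = 0 := by
  have hinf : Infinite k := IsAlgClosed.instInfinite
  rw [mem_vanishingIdeal_iff]
  constructor
  · exact fun h => aeval_incidence_eq_zero fun a ha => by rw [← aeval_eq_eval_apply]; exact h a ha
  · intro h a ha
    rw [aeval_eq_eval_apply]
    exact eval_eq_zero_of_aeval_incidence' h ha

variable [CharZero k]

/-- The exponent vector `x_i x_z^{d-1}`. -/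
noncomputable def tangentMonom (n d : ℕ) (hd : d ≠ 0) (z i : Fin n) : Monom n d :=
  ⟨Finsupp.single i 1 + Finsupp.single z (d - 1), by
    rw [map_add, Finsupp.degree_single, Finsupp.degree_single]; omega⟩

/-- The Jacobian of the equations of the incidence variety with respect to the affine coordinates,
completed to a square matrix. -/
theorem det_jacobian_ne_zero (hd : d ≠ 0) (z : Fin n) :
    (Matrix.of fun i j : Fin n => if j = z then (if i = z then 1 else 0) else
      pderiv (Sum.inr j) (incidence k z (i, pureMonom n d z))).det ≠ 0 := by
  classical
  -- The test point is the tuple with f_i = x_i x_z^{d-1} for i ≠ z and f_z = 0, at its zero e_z.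
  -- There the Jacobian is minus the identity away from row and column z.
  let y : (Fin n × Monom n d) ⊕ Fin n → k :=
    Sum.elim (fun s => if s.1 ≠ z ∧ s.2 = tangentMonom n d hd z s.1 then 1 else 0) 0
  have hμ : ∀ (m : Monom n d) (j : Fin n), j ≠ z →
      eval y (pderiv (Sum.inr j) (aeval (affinePoint k d z) (monomial m.1 (1 : k)))) =
        if m = tangentMonom n d hd z j then 1 else 0 := by
    intro m j hj
    rw [pderiv_aeval, map_sum, Finset.sum_eq_single j]
    · have h1 : pderiv (Sum.inr j) (affinePoint k d z j) = 1 := by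
        simp [affinePoint, hj]
      rw [h1, mul_one, eval_aeval, pderiv_monomial, one_mul, eval_monomial]
      have hpt : ∀ l, eval y (affinePoint k d z l) = if l = z then 1 else 0 := by
        intro l
        unfold affinePoint
        split_ifs with h
        · simp
        · simp [y]
      simp only [hpt]
      split_ifs with h
      · subst h
        have h2 : (tangentMonom n d hd z j).1 j = 1 := by
          simp [tangentMonom, Ne.symm hj]
        rw [h2, Nat.cast_one, one_mul]
        refine Finset.prod_eq_one fun l _ => ?_
        by_cases hl : l = z
        · simp [hl]
        · have : ((tangentMonom n d hd z j).1 - Finsupp.single j 1 : Fin n →₀ ℕ) l = 0 := by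
            simp [tangentMonom, Ne.symm hl]
          rw [this]
          exact pow_zero _
      · by_contra hne
        apply h
        have hmj : m.1 j ≠ 0 := by
          intro h0
          rw [h0] at hne
          simp at hne
        have hprod := right_ne_zero_of_mul hne
        rw [Finsupp.prod, Finset.prod_ne_zero_iff] at hprod
        have hzero : ∀ l, l ≠ z → (m.1 - Finsupp.single j 1 : Fin n →₀ ℕ) l = 0 := by
          intro l hl
          by_contra h0
          have := hprod l (Finsupp.mem_support_iff.2 h0)
          rw [if_neg hl, zero_pow h0] at this
          exact this rfl
        have hsub : (m.1 - Finsupp.single j 1 : Fin n →₀ ℕ) =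
            Finsupp.single z ((m.1 - Finsupp.single j 1 : Fin n →₀ ℕ) z) := by
          ext l
          by_cases hl : l = z
          · subst hl; simp
          · rw [hzero l hl, Finsupp.single_apply, if_neg (Ne.symm hl)]
        have hm : m.1 = Finsupp.single j 1 + (m.1 - Finsupp.single j 1) := by
          rw [add_tsub_cancel_of_le]
          rw [Finsupp.single_le_iff]
          omega
        have hdeg := m.2
        rw [hm, hsub, map_add, Finsupp.degree_single, Finsupp.degree_single] at hdeg
        apply Subtype.ext
        rw [hm, hsub, tangentMonom]
        congr 2
        omega
    · intro l _ hl
      have : pderiv (Sum.inr j) (affinePoint k d z l) = 0 := by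
        unfold affinePoint
        split_ifs
        · simp
        · rw [pderiv_X_of_ne (fun h => hl (Sum.inr_injective h))]
      rw [this, mul_zero, map_zero]
    · simp
  intro hdet
  have h1 := congrArg (eval y) hdet
  rw [map_zero, RingHom.map_det] at h1
  have h2 : (eval y).mapMatrix (Matrix.of fun i j : Fin n => if j = z then
      (if i = z then (1 : MvPolynomial ((Fin n × Monom n d) ⊕ Fin n) k) else 0) else
      pderiv (Sum.inr j) (incidence k z (i, pureMonom n d z))) =
      Matrix.diagonal fun i => if i = z then 1 else -1 := by
    ext i j
    rw [RingHom.mapMatrix_apply, Matrix.map_apply, Matrix.of_apply, Matrix.diagonal_apply]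
    by_cases hj : j = z
    · rw [if_pos hj]
      by_cases hi : i = z
      · simp [hi, hj]
      · rw [if_neg hi, map_zero, if_neg (fun h => hi (h.trans hj))]
    · rw [if_neg hj]
      have h3 : eval y (pderiv (Sum.inr j) (incidence k z (i, pureMonom n d z))) =
          -∑ m ∈ Finset.univ.erase (pureMonom n d z),
            (if i ≠ z ∧ m = tangentMonom n d hd z i then 1 else 0) *
              (if m = tangentMonom n d hd z j then 1 else 0) := by
        rw [incidence, if_pos rfl, map_neg, map_neg, map_sum, map_sum]
        congr 1
        refine Finset.sum_congr rfl fun m _ => ?_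
        rw [Derivation.leibniz, pderiv_X_of_ne (by simp), smul_zero, add_zero, smul_eq_mul, map_mul,
          hμ m j hj, eval_X]
        rfl
      have htj : tangentMonom n d hd z j ∈ Finset.univ.erase (pureMonom n d z) := by
        refine Finset.mem_erase.2 ⟨fun h => ?_, Finset.mem_univ _⟩
        have := DFunLike.congr_fun (congrArg Subtype.val h) j
        simp [tangentMonom, pureMonom, Ne.symm hj] at this
      simp only [mul_ite, mul_one, mul_zero] at h3
      rw [Finset.sum_ite_eq' , if_pos htj] at h3
      rw [h3]
      by_cases hij : i = j
      · subst hij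
        simp [hj]
      · rw [if_neg hij, if_neg, neg_zero]
        rintro ⟨-, h⟩
        have := DFunLike.congr_fun (congrArg Subtype.val h) j
        simp [tangentMonom, Ne.symm hj, hij] at this
  rw [h2, Matrix.det_diagonal, Finset.prod_eq_zero_iff] at h1
  obtain ⟨i, -, hi⟩ := h1
  split_ifs at hi <;> simp at hi

/-- The coefficients other than that of `x_z^d` in the last form are algebraically independent on
the incidence variety. -/
theorem eq_zero_of_aeval_incidence_eq_zero (hd : d ≠ 0) (z : Fin n)
    {p : MvPolynomial (Fin n × Monom n d) k} (hpz : pderiv (z, pureMonom n d z) p = 0)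
    (hp : aeval (incidence k z) p = 0) : p = 0 := by
  classical
  refine eq_zero_of_pderiv_closed (incidence k z) {p | pderiv (z, pureMonom n d z) p = 0} ?_ p hpz hp
  intro p hpz hp
  -- The chain rule in the n - 1 affine coordinates gives n - 1 linear equations for these n values;
  -- the last equation is the assumption that p does not involve the coefficient of x_z^d in form z.
  have hpure : ∀ i, aeval (incidence k z) (pderiv (i, pureMonom n d z) p) = 0 := by
    refine fun i => congrFun (Matrix.eq_zero_of_vecMul_eq_zero (det_jacobian_ne_zero (k := k) hd z)
      (v := fun i => aeval (incidence k z) (pderiv (i, pureMonom n d z) p)) ?_) i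
    ext1 j
    simp only [Matrix.vecMul, dotProduct, Matrix.of_apply, Pi.zero_apply]
    by_cases hj : j = z
    · simp only [hj, if_true]
      simp [show pderiv (z, pureMonom n d z) p = 0 from hpz]
    · simp only [if_neg hj]
      have h1 := pderiv_aeval (incidence k z) (Sum.inr j) p
      rw [hp, map_zero, Fintype.sum_prod_type] at h1
      rw [h1]
      refine Finset.sum_congr rfl fun i _ => ?_
      rw [Finset.sum_eq_single (pureMonom n d z)]
      · intro m _ hm
        rw [pderiv_incidence_inl z i m hm, if_neg (by simp), mul_zero]
      · simp
  have hall : ∀ s, aeval (incidence k z) (pderiv s p) = 0 := by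
    rintro ⟨i, m⟩
    by_cases hm : m = pureMonom n d z
    · rw [hm]; exact hpure i
    · have h1 := pderiv_aeval (incidence k z) (Sum.inl (i, m)) p
      rw [hp, map_zero, Finset.sum_eq_single (i, m)] at h1
      · rw [pderiv_incidence_inl z i m hm, if_pos rfl, mul_one] at h1
        exact h1.symm
      · rintro ⟨i', m'⟩ _ hne
        by_cases hm' : m' = pureMonom n d z
        · rw [hm', hpure, zero_mul]
        · rw [pderiv_incidence_inl z i' m' hm', if_neg (fun h => hne (Sum.inl_injective h)), mul_zero]
      · simp
  refine fun s => ⟨?_, hall s⟩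
  have hcomm : pderiv (z, pureMonom n d z) (pderiv s p) = pderiv s (pderiv (z, pureMonom n d z) p) := by
    ext m
    simp only [coeff_pderiv]
    rw [add_right_comm]
    by_cases hs : s = (z, pureMonom n d z)
    · rw [hs]
    · simp only [Finsupp.add_apply, Finsupp.single_apply, if_neg hs, if_neg (Ne.symm hs), add_zero]
      ring
  rw [Set.mem_ofPred_eq, hcomm, show pderiv (z, pureMonom n d z) p = 0 from hpz, map_zero]

variable [IsAlgClosed k]

/-- Existence of the resultant. -/
theorem exists_isResultant (hn : 0 < n) (hd : d ≠ 0) : ∃ R, IsResultant k n d R := by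
  classical
  let z : Fin n := ⟨0, hn⟩
  have hX : ∀ i : Fin n, ((X i : MvPolynomial (Fin n) k) ^ d).IsHomogeneous d :=
    fun i => isHomogeneous_X_pow i d
  have hsep := exists_separating hn hd (a₀ := fun p : Fin n × Monom n d =>
    coeff p.2.1 ((X p.1 : MvPolynomial (Fin n) k) ^ d))
    (by rw [tupleForm_coeff hX]; exact noCommonZero_X_pow d)
  obtain ⟨Δ, hΔ0, hΔ⟩ := hsep
  let P := vanishingIdeal k (commonZeroLocus k n d)
  have hP : P = RingHom.ker (aeval (incidence k z) :
      MvPolynomial (Fin n × Monom n d) k →ₐ[k] _) := by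
    ext p
    rw [RingHom.mem_ker]
    exact mem_vanishingIdeal_commonZeroLocus z p
  have hprime : P.IsPrime := by rw [hP]; exact RingHom.ker_isPrime _
  have hΔP : Δ ∈ P := mem_vanishingIdeal_iff.2 fun a ha => by rw [aeval_eq_eval_apply]; exact hΔ a ha
  have hPne : P ≠ ⊥ := by
    intro h
    rw [h, Ideal.mem_bot] at hΔP
    rw [hΔP, map_zero] at hΔ0
    exact hΔ0 rfl
  obtain ⟨g, hgP, hg⟩ := hprime.exists_mem_prime_of_ne_bot hPne
  have hgprime : (Ideal.span {g}).IsPrime := (Ideal.span_singleton_prime hg.ne_zero).2 hg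
  have hgP' : Ideal.span {g} ≤ P := (Ideal.span_singleton_le_iff_mem _).2 hgP
  -- Otherwise ⊥ < (g) < P. If there are N variables, N - 1 of them are independent modulo P, and
  -- each strict inclusion adds one independent element: N + 1 of them among polynomials in N
  -- variables.
  have heq : P = Ideal.span {g} := by
    by_contra hne
    have hlt : Ideal.span {g} < P := lt_of_le_of_ne hgP' (Ne.symm hne)
    have hlt0 : (⊥ : Ideal (MvPolynomial (Fin n × Monom n d) k)) < Ideal.span {g} :=
      bot_lt_iff_ne_bot.2 (by rw [Ne, Ideal.span_singleton_eq_bot]; exact hg.ne_zero)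
    let ι := {s : Fin n × Monom n d // s ≠ (z, pureMonom n d z)}
    let e := Fintype.equivFin ι
    have hind : IndepMod (k := k) P (fun i => (X (e.symm i).1 : MvPolynomial (Fin n × Monom n d) k)) := by
      intro p hp
      have hinj : Function.Injective fun i => (e.symm i).1 :=
        Subtype.val_injective.comp e.symm.injective
      have h1 : aeval (fun i => (X (e.symm i).1 : MvPolynomial (Fin n × Monom n d) k)) p =
          rename (fun i => (e.symm i).1) p := by
        rw [rename_eq_aeval]; rfl
      rw [h1, hP, RingHom.mem_ker] at hp
      have h2 : pderiv (z, pureMonom n d z) (rename (fun i => (e.symm i).1) p) = 0 := by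
        refine pderiv_eq_zero_of_notMem_vars fun hmem => ?_
        obtain ⟨i, -, hi⟩ := Finset.mem_image.1 (vars_rename _ _ hmem)
        exact (e.symm i).2 hi
      exact rename_injective _ hinj (by rw [eq_zero_of_aeval_incidence_eq_zero hd z h2 hp, map_zero])
    obtain ⟨y, hy⟩ := hind.of_lt hlt
    obtain ⟨y', hy'⟩ := hy.of_lt hlt0
    have h3 := hy'.le_card
    have h4 : Fintype.card ι = Fintype.card (Fin n × Monom n d) - 1 := by
      simp [ι, Fintype.card_subtype_compl]
    have h5 : 0 < Fintype.card (Fin n × Monom n d) :=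
      Fintype.card_pos_iff.2 ⟨(z, pureMonom n d z)⟩
    omega
  -- The separating polynomial Δ is a multiple of g and does not vanish at the tuple of pure powers,
  -- so g can be normalized there.
  have hg1 : eval (fun p : Fin n × Monom n d => coeff p.2.1
      ((X p.1 : MvPolynomial (Fin n) k) ^ d)) g ≠ 0 := by
    intro h0
    rw [heq, Ideal.mem_span_singleton] at hΔP
    obtain ⟨u, hu⟩ := hΔP
    rw [hu, map_mul, h0, zero_mul] at hΔ0
    exact hΔ0 rfl
  refine ⟨C (eval (fun p : Fin n × Monom n d => coeff p.2.1
      ((X p.1 : MvPolynomial (Fin n) k) ^ d)) g)⁻¹ * g, ?_, ?_⟩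
  · change P = _
    rw [heq, eq_comm, mul_comm]
    exact Ideal.span_singleton_mul_right_unit (IsUnit.map C (inv_ne_zero hg1).isUnit) g
  · rw [map_mul, eval_C, inv_mul_cancel₀ hg1]

/-- The resultant detects common zeros. -/
theorem resultant_ne_zero_iff (hn : 0 < n) (hd : d ≠ 0) {f : Fin n → MvPolynomial (Fin n) k}
    (hf : ∀ i, (f i).IsHomogeneous d) : resultant d f ≠ 0 ↔ NoCommonZero f := by
  have hR := exists_isResultant (k := k) hn hd
  have hspec : IsResultant k n d (resultantPoly k n d) := by
    rw [resultantPoly, dif_pos hR]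
    exact hR.choose_spec
  constructor
  · intro hres
    by_contra hcz
    apply hres
    have hmem : (fun p : Fin n × Monom n d => coeff p.2.1 (f p.1)) ∈ commonZeroLocus k n d := by
      rw [mem_commonZeroLocus, tupleForm_coeff hf]; exact hcz
    have h1 : resultantPoly k n d ∈ vanishingIdeal k (commonZeroLocus k n d) := by
      rw [hspec.1]; exact Ideal.mem_span_singleton_self _
    exact mem_vanishingIdeal_iff.1 h1 _ hmem
  · intro hcz h0
    obtain ⟨Δ, hΔ0, hΔ⟩ := exists_separating hn hd (a₀ := fun p : Fin n × Monom n d =>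
      coeff p.2.1 (f p.1)) (by rw [tupleForm_coeff hf]; exact hcz)
    have hΔP : Δ ∈ vanishingIdeal k (commonZeroLocus k n d) :=
      mem_vanishingIdeal_iff.2 fun a ha => by rw [aeval_eq_eval_apply]; exact hΔ a ha
    rw [hspec.1, Ideal.mem_span_singleton] at hΔP
    obtain ⟨u, hu⟩ := hΔP
    rw [hu, map_mul] at hΔ0
    exact hΔ0 (by rw [show eval _ (resultantPoly k n d) = 0 from h0, zero_mul])

end Resultant
end Catalecticant

namespace Catalecticant

/-! ### Differentiation as a pairing of forms. -/

section Apolarity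
variable {k : Type*} [Field k] {n : ℕ}

/-- The product of the factorials of the exponents. -/
def multiFactorial (k : Type*) [Field k] (m : Fin n →₀ ℕ) : k := ∏ i, ((m i).factorial : k)

theorem multiFactorial_ne_zero [CharZero k] (m : Fin n →₀ ℕ) : multiFactorial k m ≠ 0 :=
  Finset.prod_ne_zero_iff.2 fun _ _ => Nat.cast_ne_zero.2 (Nat.factorial_ne_zero _)

theorem multiFactorial_zero : multiFactorial k (0 : Fin n →₀ ℕ) = 1 := by simp [multiFactorial]

theorem multiFactorial_add_single (m : Fin n →₀ ℕ) (i : Fin n) :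
    multiFactorial k (m + Finsupp.single i 1) = multiFactorial k m * (m i + 1) := by
  classical
  rw [multiFactorial, multiFactorial, ← Finset.mul_prod_erase _ _ (Finset.mem_univ i),
    ← Finset.mul_prod_erase (a := i) Finset.univ (fun j => ((m j).factorial : k)) (Finset.mem_univ i)]
  have h1 : ∏ j ∈ Finset.univ.erase i, (((m + Finsupp.single i 1 : Fin n →₀ ℕ) j).factorial : k) =
      ∏ j ∈ Finset.univ.erase i, ((m j).factorial : k) := by
    refine Finset.prod_congr rfl fun j hj => ?_
    simp [(Finset.ne_of_mem_erase hj).symm]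
  rw [h1]
  simp only [Finsupp.add_apply, Finsupp.single_eq_same, Nat.factorial_succ]
  push_cast
  ring

theorem partialPow_zero : partialPow k (0 : Fin n →₀ ℕ) = 1 := (partialMonomial k n).map_one'

theorem partialPow_add (m m' : Fin n →₀ ℕ) :
    partialPow k (m + m') = partialPow k m * partialPow k m' :=
  (partialMonomial k n).map_mul' (Multiplicative.ofAdd m) (Multiplicative.ofAdd m')

/-- Weighted by the factorials of the exponents, differentiation is a shift of exponents. In this
form the identity for m and m' gives the one for m + m', so a single derivative is all that needs
checking. -/
theorem coeff_partialPow (m : Fin n →₀ ℕ) : ∀ (l : Fin n →₀ ℕ) (F : MvPolynomial (Fin n) k),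
    coeff l (partialPow k m F) * multiFactorial k l =
      coeff (l + m) F * multiFactorial k (l + m) := by
  have hadd : ∀ m m' : Fin n →₀ ℕ,
      (∀ (l : Fin n →₀ ℕ) (F : MvPolynomial (Fin n) k), coeff l (partialPow k m F) *
        multiFactorial k l = coeff (l + m) F * multiFactorial k (l + m)) →
      (∀ (l : Fin n →₀ ℕ) (F : MvPolynomial (Fin n) k), coeff l (partialPow k m' F) *
        multiFactorial k l = coeff (l + m') F * multiFactorial k (l + m')) →
      (∀ (l : Fin n →₀ ℕ) (F : MvPolynomial (Fin n) k), coeff l (partialPow k (m + m') F) *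
        multiFactorial k l = coeff (l + (m + m')) F * multiFactorial k (l + (m + m'))) := by
    intro m m' h h' l F
    rw [partialPow_add, Module.End.mul_apply, h, h', add_assoc]
  have hzero : ∀ (l : Fin n →₀ ℕ) (F : MvPolynomial (Fin n) k), coeff l (partialPow k 0 F) *
        multiFactorial k l = coeff (l + 0) F * multiFactorial k (l + 0) := by
    intro l F
    rw [partialPow_zero, add_zero]
    rfl
  induction m using Finsupp.induction_linear with
  | zero => exact hzero
  | add m m' h h' => exact hadd m m' h h'
  | single i a =>
    induction a with
    | zero => rw [Finsupp.single_zero]; exact hzero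
    | succ a ih =>
      rw [Finsupp.single_add]
      refine hadd _ _ ih fun l F => ?_
      rw [partialPow_single, multiFactorial_add_single]
      change coeff l (pderiv i F) * _ = _
      rw [coeff_pderiv]
      ring

/-- The functional `h ↦ (h(∂/∂y) F)(0)`. -/
noncomputable def apolar (F : MvPolynomial (Fin n) k) : MvPolynomial (Fin n) k →ₗ[k] k :=
  lcoeff k 0 ∘ₗ LinearMap.applyₗ F ∘ₗ (diffOp k n).toLinearMap

theorem apolar_apply (F h : MvPolynomial (Fin n) k) : apolar F h = coeff 0 (diffOp k n h F) := rfl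

/-- All coefficients of h ∘ F are values of one functional, which turns questions about F^⊥ into
linear algebra. -/
theorem apolar_monomial_mul (F h : MvPolynomial (Fin n) k) (l : Fin n →₀ ℕ) :
    apolar F (monomial l 1 * h) = coeff l (diffOp k n h F) * multiFactorial k l := by
  rw [apolar_apply, map_mul, Module.End.mul_apply, diffOp_monomial, one_smul]
  have := coeff_partialPow l 0 (diffOp k n h F)
  rwa [multiFactorial_zero, mul_one, zero_add] at this

theorem apolar_monomial (F : MvPolynomial (Fin n) k) (l : Fin n →₀ ℕ) :
    apolar F (monomial l 1) = coeff l F * multiFactorial k l := by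
  have := apolar_monomial_mul F 1 l
  rwa [mul_one, map_one (diffOp k n)] at this

theorem linearMap_apply_eq_sum {M : Type*} [AddCommGroup M] [Module k M]
    (φ : MvPolynomial (Fin n) k →ₗ[k] M) {p : MvPolynomial (Fin n) k} {e : ℕ}
    (hp : p.IsHomogeneous e) : φ p = ∑ m : Monom n e, coeff m.1 p • φ (monomial m.1 1) := by
  conv_lhs => rw [← formOf_coeffVec hp, formOf, map_sum]
  refine Finset.sum_congr rfl fun m _ => ?_
  rw [← map_smul, smul_monomial, smul_eq_mul, mul_one]
  rfl

theorem apolar_eq_zero_of_isHomogeneous {F p : MvPolynomial (Fin n) k} {N e : ℕ}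
    (hF : F.IsHomogeneous N) (hp : p.IsHomogeneous e) (hne : e ≠ N) : apolar F p = 0 := by
  rw [linearMap_apply_eq_sum _ hp]
  refine Finset.sum_eq_zero fun m _ => ?_
  rw [apolar_monomial, hF.coeff_eq_zero (by rw [m.2]; exact hne), zero_mul, smul_zero]

theorem mem_annihilator {F h : MvPolynomial (Fin n) k} :
    h ∈ annihilator F ↔ diffOp k n h F = 0 := Iff.rfl

variable [CharZero k]

theorem eq_zero_of_apolar {F : MvPolynomial (Fin n) k} {N : ℕ} (hF : F.IsHomogeneous N)
    (h : ∀ p, p.IsHomogeneous N → apolar F p = 0) : F = 0 := by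
  refine ext_of_isHomogeneous hF (isHomogeneous_zero _ _ N) fun m => ?_
  have := h (monomial m.1 1) (isHomogeneous_monomial _ m.2)
  rw [apolar_monomial] at this
  rw [coeff_zero]
  exact (mul_eq_zero.1 this).resolve_right (multiFactorial_ne_zero _)

theorem mem_annihilator_iff {F h : MvPolynomial (Fin n) k} :
    h ∈ annihilator F ↔ ∀ l, apolar F (monomial l 1 * h) = 0 := by
  rw [mem_annihilator]
  constructor
  · intro h0 l
    rw [apolar_monomial_mul, h0, coeff_zero, zero_mul]
  · intro h0
    ext l
    have := h0 l
    rw [apolar_monomial_mul] at this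
    exact (mul_eq_zero.1 this).resolve_right (multiFactorial_ne_zero _)

theorem diffOp_isHomogeneous {F h : MvPolynomial (Fin n) k} {N e : ℕ}
    (hF : F.IsHomogeneous N) (hh : h.IsHomogeneous e) : (diffOp k n h F).IsHomogeneous (N - e) := by
  intro l hl
  have h1 : apolar F (monomial l 1 * h) ≠ 0 := by
    rw [apolar_monomial_mul]
    exact mul_ne_zero hl (multiFactorial_ne_zero _)
  have h2 : l.degree + e = N := by
    by_contra hne
    exact h1 (apolar_eq_zero_of_isHomogeneous hF ((isHomogeneous_monomial 1 rfl).mul hh) hne)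
  have h3 : (Finsupp.weight 1) l = l.degree := by rw [Finsupp.degree_eq_weight_one]; rfl
  rw [h3]
  omega

/-- Every functional on forms of degree `N` is given by differentiation of a form. -/
theorem exists_form_apolar {N : ℕ} (φ : MvPolynomial (Fin n) k →ₗ[k] k) :
    ∃ F : Form k n N, ∀ p, p.IsHomogeneous N → apolar F.1 p = φ p := by
  refine ⟨⟨formOf fun m => φ (monomial m.1 1) / multiFactorial k m.1, formOf_isHomogeneous _⟩,
    fun p hp => ?_⟩
  rw [linearMap_apply_eq_sum _ hp, linearMap_apply_eq_sum φ hp]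
  refine Finset.sum_congr rfl fun m _ => ?_
  rw [apolar_monomial, coeff_formOf, div_mul_cancel₀ _ (multiFactorial_ne_zero _)]

end Apolarity

/-! ### Macaulay duality for complete intersections. -/

section Macaulay
variable {k : Type*} [Field k] {n d : ℕ}

theorem span_le_annihilator {f : Fin n → MvPolynomial (Fin n) k} {F : MvPolynomial (Fin n) k}
    (h : ∀ i, f i ∈ annihilator F) : Ideal.span (Set.range f) ≤ annihilator F := by
  refine Ideal.span_le.2 ?_
  rintro _ ⟨i, rfl⟩
  exact h i

theorem apolar_eq_zero_of_mem_annihilator {F h : MvPolynomial (Fin n) k} (hh : h ∈ annihilator F) :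
    apolar F h = 0 := by
  rw [apolar_apply, mem_annihilator.1 hh, coeff_zero]

variable [IsAlgClosed k]

/-- In the socle degree the ideal generated by `f` has codimension one. -/
theorem NoCommonZero.exists_smul_sub_mem (hn : 0 < n) {f : Fin n → MvPolynomial (Fin n) k}
    (hf : NoCommonZero f) (hfd : ∀ i, (f i).IsHomogeneous d) (hd : d ≠ 0)
    {h p : MvPolynomial (Fin n) k} (hh : h.IsHomogeneous (n * (d - 1)))
    (hhI : h ∉ Ideal.span (Set.range f)) (hp : p.IsHomogeneous (n * (d - 1))) :
    ∃ c : k, p - c • h ∈ Ideal.span (Set.range f) := by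
  have h1 := hf.hilbertFunction_eq hn hfd hd (n * (d - 1))
  rw [seqT_top (by omega), hilbertFunction] at h1
  let I := Ideal.span (Set.range f)
  let π := (Ideal.Quotient.mkₐ k I).toLinearMap
  have hne : (⟨π h, Submodule.mem_map_of_mem hh⟩ :
      (homogeneousSubmodule (Fin n) k (n * (d - 1))).map π) ≠ 0 := by
    intro h0
    exact hhI (Ideal.Quotient.eq_zero_iff_mem.1 (congrArg Subtype.val h0))
  obtain ⟨c, hc⟩ := (finrank_eq_one_iff_of_nonzero' _ hne).1 h1
    ⟨π p, Submodule.mem_map_of_mem hp⟩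
  refine ⟨c, Ideal.Quotient.eq_zero_iff_mem.1 ?_⟩
  have h2 : c • π h = π p := congrArg Subtype.val hc
  change π (p - c • h) = 0
  rw [map_sub, map_smul, h2, sub_self]

theorem NoCommonZero.exists_notMem (hn : 0 < n) {f : Fin n → MvPolynomial (Fin n) k}
    (hf : NoCommonZero f) (hfd : ∀ i, (f i).IsHomogeneous d) (hd : d ≠ 0) :
    ∃ h : MvPolynomial (Fin n) k, h.IsHomogeneous (n * (d - 1)) ∧
      h ∉ Ideal.span (Set.range f) := by
  by_contra! hcon
  have h1 := hf.hilbertFunction_eq hn hfd hd (n * (d - 1))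
  rw [seqT_top (by omega)] at h1
  have h2 := hilbertFunction_add (Ideal.span (Set.range f)) (n * (d - 1))
  have h3 : idealDeg (Ideal.span (Set.range f)) (n * (d - 1)) =
      homogeneousSubmodule (Fin n) k (n * (d - 1)) :=
    le_antisymm inf_le_right fun p hp => ⟨hcon p hp, hp⟩
  rw [h3, h1] at h2
  omega

variable [CharZero k]

/-- The functional of F kills the ideal, which has codimension one in degree n(d-1). If it also
killed h it would vanish in that whole degree, and F would be zero. -/
theorem NoCommonZero.apolar_ne_zero (hn : 0 < n) {f : Fin n → MvPolynomial (Fin n) k}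
    (hf : NoCommonZero f) (hfd : ∀ i, (f i).IsHomogeneous d) (hd : d ≠ 0)
    {F : Form k n (n * (d - 1))} (hF : F ≠ 0) (hann : ∀ i, f i ∈ annihilator F.1)
    {h : MvPolynomial (Fin n) k} (hh : h.IsHomogeneous (n * (d - 1)))
    (hhI : h ∉ Ideal.span (Set.range f)) : apolar F.1 h ≠ 0 := by
  intro h0
  refine hF (Subtype.ext (eq_zero_of_apolar F.2 fun p hp => ?_))
  obtain ⟨c, hc⟩ := hf.exists_smul_sub_mem hn hfd hd hh hhI hp
  have h1 := apolar_eq_zero_of_mem_annihilator (span_le_annihilator hann hc)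
  rwa [map_sub, map_smul, h0, smul_zero, sub_zero] at h1

/-- Macaulay duality for complete intersections: the annihilator of a nonzero form of the socle
degree killed by `f` agrees with the ideal generated by `f`. -/
theorem NoCommonZero.idealDeg_annihilator (hn : 0 < n) {f : Fin n → MvPolynomial (Fin n) k}
    (hf : NoCommonZero f) (hfd : ∀ i, (f i).IsHomogeneous d) (hd : d ≠ 0)
    {F : Form k n (n * (d - 1))} (hF : F ≠ 0) (hann : ∀ i, f i ∈ annihilator F.1) (e : ℕ) :
    idealDeg (annihilator F.1) e = idealDeg (Ideal.span (Set.range f)) e := by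
  apply le_antisymm
  · rintro h ⟨hh, he⟩
    refine ⟨?_, he⟩
    by_contra hhI
    obtain ⟨g, hg, hgI⟩ := hf.exists_mul_notMem hn hfd hd (n * (d - 1) + 1) e h (by omega) he hhI
    exact hf.apolar_ne_zero hn hfd hd hF hann hg hgI
      (apolar_eq_zero_of_mem_annihilator (Ideal.mul_mem_left _ _ hh))
  · exact fun h hh => ⟨span_le_annihilator hann hh.1, hh.2⟩

/-- Take a functional that kills the ideal but not some h of degree n(d-1), and represent it in that
degree by a form; the multiples of f in other degrees pair to zero with it for degree reasons. -/
theorem NoCommonZero.exists_form (hn : 0 < n) {f : Fin n → MvPolynomial (Fin n) k}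
    (hf : NoCommonZero f) (hfd : ∀ i, (f i).IsHomogeneous d) (hd : d ≠ 0) :
    ∃ F : Form k n (n * (d - 1)), F ≠ 0 ∧ ∀ i, f i ∈ annihilator F.1 := by
  obtain ⟨h, hh, hhI⟩ := hf.exists_notMem hn hfd hd
  obtain ⟨φ, hφ, hφI⟩ := Submodule.exists_dual_map_eq_bot_of_notMem
    (p := (Ideal.span (Set.range f)).restrictScalars k) (x := h) hhI inferInstance
  obtain ⟨F, hF⟩ := exists_form_apolar (N := n * (d - 1)) φ
  refine ⟨F, ?_, fun i => mem_annihilator_iff.2 fun l => ?_⟩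
  · rintro rfl
    apply hφ
    rw [← hF h hh, apolar_apply]
    simp
  · have hhom : (monomial l 1 * f i).IsHomogeneous (l.degree + d) :=
      (isHomogeneous_monomial 1 rfl).mul (hfd i)
    by_cases hl : l.degree + d = n * (d - 1)
    · rw [hF _ (hl ▸ hhom)]
      have : φ (monomial l 1 * f i) ∈ ((Ideal.span (Set.range f)).restrictScalars k).map φ :=
        Submodule.mem_map_of_mem (Ideal.mul_mem_left _ _ (Ideal.subset_span ⟨i, rfl⟩))
      rw [hφI] at this
      exact (Submodule.mem_bot k).1 this
    · exact apolar_eq_zero_of_isHomogeneous F.2 hhom hl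

theorem NoCommonZero.form_unique (hn : 0 < n) {f : Fin n → MvPolynomial (Fin n) k}
    (hf : NoCommonZero f) (hfd : ∀ i, (f i).IsHomogeneous d) (hd : d ≠ 0)
    {F G : Form k n (n * (d - 1))} (hF : F ≠ 0) (hannF : ∀ i, f i ∈ annihilator F.1)
    (hannG : ∀ i, f i ∈ annihilator G.1) : ∃ c : k, G = c • F := by
  obtain ⟨h, hh, hhI⟩ := hf.exists_notMem hn hfd hd
  have h0 := hf.apolar_ne_zero hn hfd hd hF hannF hh hhI
  -- With this ratio c the functional of G - c F vanishes at h, which `apolar_ne_zero` permits only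
  -- for the zero form.
  refine ⟨apolar G.1 h / apolar F.1 h, ?_⟩
  rw [← sub_eq_zero]
  by_contra hne
  refine hf.apolar_ne_zero hn hfd hd hne (fun i => ?_) hh hhI ?_
  · rw [mem_annihilator]
    have h1 := mem_annihilator.1 (hannF i)
    have h2 := mem_annihilator.1 (hannG i)
    simp [h1, h2]
  · rw [apolar_apply]
    have h1 : diffOp k n h (G - (apolar G.1 h / apolar F.1 h) • F : Form k n (n * (d - 1))).1 =
        diffOp k n h G.1 - (apolar G.1 h / apolar F.1 h) • diffOp k n h F.1 := by
      simp
    rw [h1, coeff_sub, coeff_smul, ← apolar_apply, ← apolar_apply, smul_eq_mul,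
      div_mul_cancel₀ _ h0, sub_self]

end Macaulay
end Catalecticant

namespace Catalecticant

/-! ### Nonvanishing minors of a matrix of given rank. -/

section Minors
variable {k : Type*} [Field k]

theorem exists_linearIndependent_cols {ι κ : Type*} [Finite ι] [Fintype κ] (M : Matrix ι κ k) {r : ℕ}
    (hr : M.rank = r) : ∃ c : Fin r ↪ κ, LinearIndependent k fun j => M.col (c j) := by
  obtain ⟨κ', a, ha, hspan, hli⟩ := exists_linearIndependent' k M.col
  have : Finite κ' := Finite.of_injective a ha
  have := Fintype.ofFinite κ'
  have hcard : Fintype.card κ' = r := by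
    rw [← finrank_span_eq_card hli, hspan, ← Matrix.rank_eq_finrank_span_cols, hr]
  let e := (Fintype.equivFinOfCardEq hcard).symm
  exact ⟨⟨fun j => a (e j), ha.comp e.injective⟩, hli.comp e e.injective⟩

theorem exists_rows_det_ne_zero {ι : Type*} [Fintype ι] {r : ℕ} (M : Matrix ι (Fin r) k)
    (h : LinearIndependent k M.col) : ∃ s : Fin r ↪ ι, (M.submatrix s id).det ≠ 0 := by
  have hr : M.transpose.rank = r := by
    rw [Matrix.rank_transpose, Matrix.rank_eq_finrank_span_cols, finrank_span_eq_card h,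
      Fintype.card_fin]
  obtain ⟨s, hs⟩ := exists_linearIndependent_cols M.transpose hr
  refine ⟨s, ?_⟩
  have h1 : LinearIndependent k (M.submatrix s id).row := hs
  exact ((Matrix.isUnit_iff_isUnit_det _).1
    (Matrix.linearIndependent_rows_iff_isUnit.1 h1)).ne_zero

end Minors

/-! ### Charts of U, canonical bases, and the complement of Z. -/

section Charts
variable {k : Type*} [Field k] {n d : ℕ}

/-- Keeps the natural subtraction n(d-1) - d from being truncated. -/
theorem le_socleDegree (hn : 2 ≤ n) (hd : 2 ≤ d) : d ≤ n * (d - 1) := by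
  obtain ⟨e, rfl⟩ := Nat.exists_eq_add_of_le hd
  have : 2 * (2 + e - 1) ≤ n * (2 + e - 1) := Nat.mul_le_mul_right _ hn
  omega

/-- Makes K - n a genuine positive number, so that the zero form does not lie in U. -/
theorem lt_dimK (hn : 2 ≤ n) (hd : 2 ≤ d) : n < dimK n d := by
  have h1 : (n + 1).choose (n - 1) ≤ dimK n d := Nat.choose_le_choose _ (by omega)
  have h2 : (n + 1).choose (n - 1) = (n + 1).choose 2 := by
    rw [← Nat.choose_symm (by omega : 2 ≤ n + 1)]
    congr 1
  rw [h2, Nat.choose_two_right] at h1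
  have h3 : n + 1 ≤ (n + 1) * (n + 1 - 1) / 2 := by
    rw [Nat.le_div_iff_mul_le (by norm_num)]
    exact Nat.mul_le_mul_left _ (by omega)
  omega

theorem catMatrix_mulVec (F : MvPolynomial (Fin n) k) (v : Monom n d → k) :
    (catMatrix d F).mulVec v = coeffVec (n * (d - 1) - d) (diffOp k n (formOf v) F) := by
  ext l
  have h := linearMap_apply_eq_sum (lcoeff k l.1 ∘ₗ LinearMap.applyₗ F ∘ₗ (diffOp k n).toLinearMap)
    (formOf_isHomogeneous v)
  simp only [coeff_formOf] at h
  refine Eq.trans ?_ h.symm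
  simp only [Matrix.mulVec, dotProduct, smul_eq_mul]
  exact Finset.sum_congr rfl fun m _ => mul_comm _ _

/-- The forms with coefficient vector in the kernel of the catalecticant matrix are the elements of
the annihilator. -/
theorem catMatrix_mulVec_eq_zero [CharZero k] (F : Form k n (n * (d - 1))) (v : Monom n d → k) :
    (catMatrix d F.1).mulVec v = 0 ↔ formOf v ∈ annihilatorDeg F.1 d := by
  rw [catMatrix_mulVec]
  constructor
  · intro h
    refine ⟨?_, formOf_isHomogeneous v⟩
    refine mem_annihilator.2 (ext_of_isHomogeneous
      (diffOp_isHomogeneous F.2 (formOf_isHomogeneous v)) (isHomogeneous_zero _ _ _) fun m => ?_)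
    rw [coeff_zero]
    exact congrFun h m
  · intro h
    rw [mem_annihilator.1 h.1]
    ext m
    simp [coeffVec]

theorem rank_add_finrank [CharZero k] (hn : 0 < n) (F : Form k n (n * (d - 1))) :
    (catMatrix d F.1).rank + Module.finrank k (annihilatorDeg F.1 d) = dimK n d := by
  have h1 := (catMatrix d F.1).mulVecLin.finrank_range_add_finrank_ker
  rw [Module.finrank_fintype_fun_eq_card, card_monom_dimK hn] at h1
  have h2 : ((LinearMap.ker (catMatrix d F.1).mulVecLin).map
      (coeffEquiv k n d).symm.toLinearMap).map (homogeneousSubmodule (Fin n) k d).subtype =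
      annihilatorDeg F.1 d := by
    ext p
    constructor
    · rintro ⟨_, ⟨v, hv, rfl⟩, rfl⟩
      exact (catMatrix_mulVec_eq_zero F v).1 hv
    · intro hp
      refine ⟨⟨p, hp.2⟩, ⟨coeffVec d p, ?_, Subtype.ext (formOf_coeffVec hp.2)⟩, rfl⟩
      refine (catMatrix_mulVec_eq_zero F _).2 ?_
      rwa [formOf_coeffVec hp.2]
  rw [← h2, (Submodule.equivMapOfInjective _ (Submodule.injective_subtype _) _).symm.finrank_eq,
    (Submodule.equivMapOfInjective _ (coeffEquiv k n d).symm.injective _).symm.finrank_eq]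
  exact h1

theorem mem_varU_iff [CharZero k] (hn : 2 ≤ n) (hd : 2 ≤ d) {F : Form k n (n * (d - 1))} :
    F ∈ varU k n d ↔ Module.finrank k (annihilatorDeg F.1 d) = n := by
  have h1 := rank_add_finrank (by omega) F
  have h2 := lt_dimK hn hd
  change (catMatrix d F.1).rank = _ ↔ _
  omega

theorem ne_zero_of_mem_varU (hn : 2 ≤ n) (hd : 2 ≤ d) {F : Form k n (n * (d - 1))}
    (hF : F ∈ varU k n d) : F ≠ 0 := by
  rintro rfl
  have h2 := lt_dimK hn hd
  have h3 : catMatrix d ((0 : Form k n (n * (d - 1))) : MvPolynomial (Fin n) k) = 0 := by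
    ext l m
    simp [catMatrix]
  have h4 : (catMatrix d ((0 : Form k n (n * (d - 1))) : MvPolynomial (Fin n) k)).rank = _ := hF
  rw [h3, Matrix.rank_zero] at h4
  omega

variable (α : MinorChoice n d)

theorem MinorChoice.catMatrix_mulVec_rows (F : MvPolynomial (Fin n) k) (v : Monom n d → k) :
    (fun i => (catMatrix d F).mulVec v (α.rows i)) =
      (α.blockA F).mulVec (fun i => v (α.cols (Sum.inl i))) +
        (α.blockB F).mulVec (fun j => v (α.cols (Sum.inr j))) := by
  ext i
  simp only [Matrix.mulVec, dotProduct, Pi.add_apply, blockA, blockB, Matrix.submatrix_apply]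
  rw [← Equiv.sum_comp α.cols, Fintype.sum_sum_type]

variable {α}

/-- A solution of the chosen rows of `D(F) v = 0` is a combination of the canonical solutions. -/
theorem MinorChoice.eq_sum_kernelVec {F : MvPolynomial (Fin n) k} (hA : (α.blockA F).det ≠ 0)
    {v : Monom n d → k} (hv : (fun i => (catMatrix d F).mulVec v (α.rows i)) = 0) :
    v = ∑ j, v (α.cols (Sum.inr j)) • α.kernelVec F j := by
  rw [catMatrix_mulVec_rows] at hv
  have hu : IsUnit (α.blockA F).det := isUnit_iff_ne_zero.2 hA
  have h1 : (fun i => v (α.cols (Sum.inl i))) =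
      -(α.blockA F)⁻¹.mulVec ((α.blockB F).mulVec fun j => v (α.cols (Sum.inr j))) := by
    have h2 := congrArg ((α.blockA F)⁻¹.mulVec) (eq_neg_of_add_eq_zero_left hv)
    rwa [Matrix.mulVec_mulVec, Matrix.nonsing_inv_mul _ hu, Matrix.one_mulVec,
      Matrix.mulVec_neg] at h2
  have h3 : (fun j => v (α.cols (Sum.inr j))) =
      ∑ j, v (α.cols (Sum.inr j)) • (Pi.single j 1 : Fin n → k) := by
    ext j
    simp [Finset.sum_apply, Pi.single_apply]
  ext m
  obtain ⟨s, rfl⟩ := α.cols.surjective m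
  rw [Finset.sum_apply]
  rcases s with i | j
  · have h4 : v (α.cols (Sum.inl i)) = _ := congrFun h1 i
    rw [h4, h3, Matrix.mulVec_sum, Matrix.mulVec_sum, Pi.neg_apply, Finset.sum_apply,
      ← Finset.sum_neg_distrib]
    refine Finset.sum_congr rfl fun j _ => ?_
    simp [kernelVec, Matrix.mulVec_smul]
  · simp [kernelVec, Pi.single_apply]

theorem MinorChoice.kernelVec_inr (F : MvPolynomial (Fin n) k) (i j : Fin n) :
    α.kernelVec F j (α.cols (Sum.inr i)) = (Pi.single j 1 : Fin n → k) i := by simp [kernelVec]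

/-- The coefficients at the last n columns form the identity matrix, whether or not the minor
vanishes. -/
theorem MinorChoice.linearIndependent_canonicalForm (F : MvPolynomial (Fin n) k) :
    LinearIndependent k (α.canonicalForm F) := by
  rw [Fintype.linearIndependent_iff]
  intro c hc i
  have h1 := congrArg (coeff (α.cols (Sum.inr i)).1) hc
  rw [coeff_sum, coeff_zero] at h1
  have h2 : ∀ j, coeff (α.cols (Sum.inr i)).1 (c j • α.canonicalForm F j) =
      c j * (Pi.single j 1 : Fin n → k) i := by
    intro j
    rw [coeff_smul, smul_eq_mul, ← α.kernelVec_inr F i j]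
    congr 1
    exact coeff_formOf _ _
  simp only [h2] at h1
  simpa [Pi.single_apply] using h1

theorem MinorChoice.canonicalForm_isHomogeneous (F : MvPolynomial (Fin n) k) (j : Fin n) :
    (α.canonicalForm F j).IsHomogeneous d := formOf_isHomogeneous _

/-- A minor choice with prescribed columns. -/
theorem exists_minorChoice {F : MvPolynomial (Fin n) k}
    (cols : Fin (dimK n d - n) ⊕ Fin n ≃ Monom n d)
    (hli : LinearIndependent k fun i => (catMatrix d F).col (cols (Sum.inl i))) :
    ∃ α : MinorChoice n d, α.cols = cols ∧ (α.blockA F).det ≠ 0 := by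
  obtain ⟨s, hs⟩ := exists_rows_det_ne_zero
    ((catMatrix d F).submatrix id fun i => cols (Sum.inl i)) hli
  exact ⟨⟨s, cols⟩, rfl, hs⟩

theorem locusZ_subset_varU : locusZ k n d ⊆ varU k n d := by
  intro F hF
  obtain ⟨α, hα⟩ := Set.mem_iUnion.1 hF
  exact hα.1.1

theorem exists_mem_chart (hn : 2 ≤ n) (hd : 2 ≤ d) {F : Form k n (n * (d - 1))}
    (hF : F ∈ varU k n d) : ∃ α : MinorChoice n d, F ∈ α.chart k := by
  classical
  obtain ⟨c, hc⟩ := exists_linearIndependent_cols _ hF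
  have hcard : Fintype.card ↥(Set.range c)ᶜ = n := by
    rw [Fintype.card_compl_set, card_monom_dimK (by omega), Set.card_range_of_injective c.injective,
      Fintype.card_fin]
    have := lt_dimK hn hd
    omega
  let cols : Fin (dimK n d - n) ⊕ Fin n ≃ Monom n d :=
    ((Equiv.ofInjective c c.injective).sumCongr (Fintype.equivFinOfCardEq hcard).symm).trans
      (Equiv.Set.sumCompl (Set.range c))
  obtain ⟨α, -, hα⟩ := exists_minorChoice (F := F.1) cols hc
  exact ⟨α, hF, hα⟩

variable [CharZero k]

/-- On a chart, the canonical forms span the degree `d` part of the annihilator. -/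
theorem MinorChoice.span_canonicalForm (hn : 2 ≤ n) (hd : 2 ≤ d) {F : Form k n (n * (d - 1))}
    (hF : F ∈ α.chart k) :
    Submodule.span k (Set.range (α.canonicalForm F.1)) = annihilatorDeg F.1 d := by
  have hfin : Module.Finite k (Submodule.span k (Set.range (α.canonicalForm F.1))) :=
    Module.Finite.span_of_finite k (Set.finite_range _)
  symm
  -- The rows of the minor alone put the annihilator inside the span; comparing dimensions avoids
  -- looking at the other rows.
  refine Submodule.eq_of_le_of_finrank_le ?_ ?_
  · intro p hp
    have hv : (catMatrix d F.1).mulVec (coeffVec d p) = 0 := by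
      rw [catMatrix_mulVec_eq_zero, formOf_coeffVec hp.2]
      exact hp
    have h1 := eq_sum_kernelVec hF.2 (v := coeffVec d p) (by rw [hv]; rfl)
    have h2 : p = ∑ j, coeffVec d p (α.cols (Sum.inr j)) • α.canonicalForm F.1 j := by
      refine ext_of_isHomogeneous hp.2 (IsHomogeneous.sum _ _ _ fun j _ => ?_) fun m => ?_
      · rw [smul_eq_C_mul]; exact (formOf_isHomogeneous _).C_mul _
      · rw [coeff_sum]
        have := congrFun h1 m
        rw [Finset.sum_apply] at this
        refine this.trans (Finset.sum_congr rfl fun j _ => ?_)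
        rw [coeff_smul, Pi.smul_apply]
        congr 1
        exact (coeff_formOf _ _).symm
    rw [h2]
    exact Submodule.sum_mem _ fun j _ => Submodule.smul_mem _ _ (Submodule.subset_span ⟨j, rfl⟩)
  · rw [finrank_span_eq_card (linearIndependent_canonicalForm _), Fintype.card_fin,
      (mem_varU_iff hn hd).1 hF.1]

theorem MinorChoice.canonicalForm_mem (hn : 2 ≤ n) (hd : 2 ≤ d) {F : Form k n (n * (d - 1))}
    (hF : F ∈ α.chart k) (j : Fin n) : α.canonicalForm F.1 j ∈ annihilator F.1 := by
  have : α.canonicalForm F.1 j ∈ annihilatorDeg F.1 d := by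
    rw [← span_canonicalForm hn hd hF]
    exact Submodule.subset_span ⟨j, rfl⟩
  exact this.1

variable [IsAlgClosed k]

/-- By Macaulay duality f itself is a basis of the degree d part of F^⊥. -/
theorem mem_locusURes_of_noCommonZero (hn : 2 ≤ n) (hd : 2 ≤ d) {F : Form k n (n * (d - 1))}
    (hF : F ≠ 0) {f : Fin n → MvPolynomial (Fin n) k} (hf : NoCommonZero f)
    (hfd : ∀ i, (f i).IsHomogeneous d) (hann : ∀ i, f i ∈ annihilator F.1) :
    F ∈ locusURes k n d := by
  have h1 : annihilatorDeg F.1 d = Submodule.span k (Set.range f) := by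
    rw [← idealDeg_span_self hfd]
    exact hf.idealDeg_annihilator (by omega) hfd (by omega) hF hann d
  have hli := (hf.exists_regSeq_eq (by omega) hfd (by omega)).1
  refine ⟨by rw [h1, finrank_span_eq_card hli, Fintype.card_fin], ?_⟩
  rw [h1]
  refine ⟨Module.Basis.span hli, ?_⟩
  have h2 : (fun i => ((Module.Basis.span hli i : Submodule.span k (Set.range f)) :
      MvPolynomial (Fin n) k)) = f := _root_.funext fun i => by rw [Module.Basis.span_apply]
  rw [h2]
  exact (resultant_ne_zero_iff (by omega) (by omega) hfd).2 hf

theorem exists_noCommonZero_of_mem_locusURes (hn : 2 ≤ n) (hd : 2 ≤ d)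
    {F : Form k n (n * (d - 1))} (hF : F ∈ locusURes k n d) :
    F ∈ varU k n d ∧ F ≠ 0 ∧ ∃ f : Fin n → MvPolynomial (Fin n) k, NoCommonZero f ∧
      (∀ i, (f i).IsHomogeneous d) ∧ (∀ i, f i ∈ annihilator F.1) := by
  obtain ⟨hfin, b, hb⟩ := hF
  have hU := (mem_varU_iff hn hd).2 hfin
  have hbd : ∀ i, (b i : MvPolynomial (Fin n) k).IsHomogeneous d := fun i => (b i).2.2
  exact ⟨hU, ne_zero_of_mem_varU hn hd hU, fun i => b i,
    (resultant_ne_zero_iff (by omega) (by omega) hbd).1 hb, hbd, fun i => (b i).2.1⟩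

theorem locusURes_subset_varGor (hn : 2 ≤ n) (hd : 2 ≤ d) :
    locusURes k n d ⊆ varGor k n d := by
  intro F hF i
  obtain ⟨-, hF0, f, hf, hfd, hann⟩ := exists_noCommonZero_of_mem_locusURes hn hd hF
  rw [hilbertFunction_congr (hf.idealDeg_annihilator (by omega) hfd (by omega) hF0 hann i)]
  exact hf.hilbertFunction_eq (by omega) hfd (by omega) i

/-- The value of T in degree d is K - n, read off from the complete intersection of the pure powers.
-/
theorem varGor_subset_varU (hn : 2 ≤ n) (hd : 2 ≤ d) : varGor k n d ⊆ varU k n d := by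
  intro F hF
  have hX : ∀ i : Fin n, ((X i : MvPolynomial (Fin n) k) ^ d).IsHomogeneous d :=
    fun i => isHomogeneous_X_pow i d
  have hf := noCommonZero_X_pow (k := k) (n := n) d
  have h1 := hf.hilbertFunction_eq (by omega) hX (by omega) d
  have h2 := hilbertFunction_add
    (Ideal.span (Set.range fun i => (X i : MvPolynomial (Fin n) k) ^ d)) d
  rw [idealDeg_span_self hX, finrank_span_eq_card (hf.exists_regSeq_eq (by omega) hX (by omega)).1,
    Fintype.card_fin] at h2
  have h3 := hilbertFunction_add (annihilator F.1) d
  rw [hF d] at h3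
  rw [mem_varU_iff hn hd]
  change Module.finrank k (idealDeg (annihilator F.1) d) = n
  omega

/-- Absence of common zeros depends only on the span of the forms, so it passes from any basis to
the canonical one. -/
theorem mem_locusURes_iff_resultant (hn : 2 ≤ n) (hd : 2 ≤ d) {F : Form k n (n * (d - 1))}
    (hF : F ∈ α.chart k) : F ∈ locusURes k n d ↔ resultant d (α.canonicalForm F.1) ≠ 0 := by
  rw [resultant_ne_zero_iff (by omega) (by omega) (α.canonicalForm_isHomogeneous F.1)]
  constructor
  · intro h
    obtain ⟨-, -, f, hf, hfd, hann⟩ := exists_noCommonZero_of_mem_locusURes hn hd h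
    intro x hx
    by_contra! hcon
    obtain ⟨i, hi⟩ := hf x hx
    have h1 : f i ∈ Submodule.span k (Set.range (α.canonicalForm F.1)) := by
      rw [α.span_canonicalForm hn hd hF]; exact ⟨hann i, hfd i⟩
    obtain ⟨c, hc⟩ := (Submodule.mem_span_range_iff_exists_fun k).1 h1
    rw [← hc, map_sum] at hi
    exact hi (Finset.sum_eq_zero fun j _ => by rw [smul_eval, hcon, mul_zero])
  · intro h
    exact mem_locusURes_of_noCommonZero hn hd (ne_zero_of_mem_varU hn hd hF.1) h
      (α.canonicalForm_isHomogeneous F.1) (α.canonicalForm_mem hn hd hF)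

theorem locusURes_eq_diff (hn : 2 ≤ n) (hd : 2 ≤ d) :
    locusURes k n d = varU k n d \ locusZ k n d := by
  ext F
  constructor
  · intro hF
    refine ⟨varGor_subset_varU hn hd (locusURes_subset_varGor hn hd hF), fun hZ => ?_⟩
    obtain ⟨α, hα⟩ := Set.mem_iUnion.1 hZ
    exact (mem_locusURes_iff_resultant hn hd hα.1).1 hF hα.2
  · rintro ⟨hU, hZ⟩
    obtain ⟨α, hα⟩ := exists_mem_chart hn hd hU
    rw [mem_locusURes_iff_resultant hn hd hα]
    exact fun h0 => hZ (Set.mem_iUnion.2 ⟨α, hα, h0⟩)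

end Charts
end Catalecticant

namespace Catalecticant

/-! ### The Zariski topology tested by polynomials. -/

section Zariski
variable {k : Type*} [Field k] {n j : ℕ}

/-- The value of a polynomial in the coefficients at a form. -/
noncomputable def evalForm (F : Form k n j) : MvPolynomial (Monom n j) k →ₐ[k] k :=
  aeval (coeffVec j F.1)

theorem evalForm_apply (F : Form k n j) (p : MvPolynomial (Monom n j) k) :
    evalForm F p = eval (coeffVec j F.1) p := aeval_eq_eval_apply _ _

theorem evalForm_X (F : Form k n j) (m : Monom n j) : evalForm F (X m) = coeff m.1 F.1 :=
  aeval_X _ _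

theorem mem_formZeros {S : Set (MvPolynomial (Monom n j) k)} {F : Form k n j} :
    F ∈ formZeros S ↔ ∀ p ∈ S, evalForm F p = 0 := by
  simp only [evalForm_apply]
  rfl

theorem isClosed_iff_formZeros {C : Set (Form k n j)} :
    IsClosed C ↔ ∃ S : Set (MvPolynomial (Monom n j) k), C = formZeros S := by
  rw [← isOpen_compl_iff]
  change Cᶜᶜ ∈ {C | ∃ S : Set (MvPolynomial (Monom n j) k), C = formZeros S} ↔ _
  rw [compl_compl]
  rfl

theorem isClosed_evalForm_eq_zero (p : MvPolynomial (Monom n j) k) :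
    IsClosed {F : Form k n j | evalForm F p = 0} :=
  isClosed_iff_formZeros.2 ⟨{p}, by ext F; simp [mem_formZeros]⟩

theorem isOpen_evalForm_ne_zero (p : MvPolynomial (Monom n j) k) :
    IsOpen {F : Form k n j | evalForm F p ≠ 0} :=
  (isClosed_evalForm_eq_zero p).isOpen_compl

theorem mem_closure_iff_evalForm {S : Set (Form k n j)} {F : Form k n j} :
    F ∈ closure S ↔ ∀ p : MvPolynomial (Monom n j) k,
      (∀ G ∈ S, evalForm G p = 0) → evalForm F p = 0 := by
  constructor
  · intro hF p hp
    exact closure_minimal (t := {F : Form k n j | evalForm F p = 0}) hp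
      (isClosed_evalForm_eq_zero p) hF
  · intro h
    obtain ⟨S', hS'⟩ := isClosed_iff_formZeros.1 (isClosed_closure (s := S))
    rw [hS', mem_formZeros]
    intro p hp
    refine h p fun G hG => ?_
    have hG' := subset_closure hG
    rw [hS', mem_formZeros] at hG'
    exact hG' p hp

theorem exists_evalForm_of_isOpen {O : Set (Form k n j)} (hO : IsOpen O) {F : Form k n j}
    (hF : F ∈ O) : ∃ p : MvPolynomial (Monom n j) k, evalForm F p ≠ 0 ∧
      ∀ G : Form k n j, evalForm G p ≠ 0 → G ∈ O := by
  obtain ⟨S, hS⟩ := isClosed_iff_formZeros.1 hO.isClosed_compl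
  have h1 : F ∉ formZeros S := by rw [← hS]; exact fun h => h hF
  rw [mem_formZeros] at h1
  push Not at h1
  obtain ⟨p, hp, hpF⟩ := h1
  refine ⟨p, hpF, fun G hG => ?_⟩
  by_contra hcon
  have h2 : G ∈ formZeros S := by rw [← hS]; exact hcon
  exact hG (mem_formZeros.1 h2 p hp)

/-- The loci where one polynomial is nonzero form a basis of the topology, so irreducibility need
only be tested on them. -/
theorem isIrreducible_iff_evalForm {S : Set (Form k n j)} :
    IsIrreducible S ↔ S.Nonempty ∧ ∀ p q : MvPolynomial (Monom n j) k,
      (∃ F ∈ S, evalForm F p ≠ 0) → (∃ F ∈ S, evalForm F q ≠ 0) →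
        ∃ F ∈ S, evalForm F p ≠ 0 ∧ evalForm F q ≠ 0 := by
  refine and_congr_right fun _ => ⟨fun h p q ⟨F, hF, hp⟩ ⟨G, hG, hq⟩ => ?_, fun h => ?_⟩
  · obtain ⟨E, hE, hE'⟩ := h _ _ (isOpen_evalForm_ne_zero p) (isOpen_evalForm_ne_zero q)
      ⟨F, hF, hp⟩ ⟨G, hG, hq⟩
    exact ⟨E, hE, hE'⟩
  · rintro u v hu hv ⟨F, hF, hFu⟩ ⟨G, hG, hGv⟩
    obtain ⟨p, hp, hpu⟩ := exists_evalForm_of_isOpen hu hFu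
    obtain ⟨q, hq, hqv⟩ := exists_evalForm_of_isOpen hv hGv
    obtain ⟨E, hE, hEp, hEq⟩ := h p q ⟨F, hF, hp⟩ ⟨G, hG, hq⟩
    exact ⟨E, hE, hpu E hEp, hqv E hEq⟩

end Zariski

section Denominators
variable {k : Type*} [Field k]

/-- Clearing denominators in a polynomial expression in fractions with a common denominator. -/
theorem exists_clear_denominators {σ τ : Type*} (P : MvPolynomial τ k) (num : τ → MvPolynomial σ k)
    (den : MvPolynomial σ k) : ∃ (P' : MvPolynomial σ k) (N : ℕ), ∀ x : σ → k, eval x den ≠ 0 →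
      eval x P' = eval x den ^ N * eval (fun t => eval x (num t) / eval x den) P := by
  induction P using MvPolynomial.induction_on with
  | C a => exact ⟨C a, 0, fun x _ => by simp⟩
  | add p q hp hq =>
    obtain ⟨p', N, hp⟩ := hp
    obtain ⟨q', M, hq⟩ := hq
    refine ⟨den ^ M * p' + den ^ N * q', N + M, fun x hx => ?_⟩
    rw [map_add, map_mul, map_mul, map_pow, map_pow, hp x hx, hq x hx, map_add]
    ring
  | mul_X p t hp =>
    obtain ⟨p', N, hp⟩ := hp
    refine ⟨p' * num t, N + 1, fun x hx => ?_⟩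
    rw [map_mul, hp x hx, map_mul, eval_X]
    field_simp
    ring

end Denominators

/-! ### Minors and canonical forms as functions of F; openness of U_Res. -/

section CatalecticantPolynomials
variable (k : Type*) [Field k] (n d : ℕ)

/-- The catalecticant matrix with entries polynomials in the coefficients of a form. -/
noncomputable def catPoly : Matrix (Monom n (n * (d - 1) - d)) (Monom n d)
    (MvPolynomial (Monom n (n * (d - 1))) k) :=
  Matrix.of fun l m' => ∑ m : Monom n (n * (d - 1)),
    C (catMatrix d (monomial m.1 (1 : k)) l m') * X m

variable {k n d}

theorem catMatrix_eq_sum (F : Form k n (n * (d - 1))) (l : Monom n (n * (d - 1) - d))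
    (m' : Monom n d) : catMatrix d F.1 l m' =
      ∑ m : Monom n (n * (d - 1)), coeff m.1 F.1 * catMatrix d (monomial m.1 (1 : k)) l m' :=
  linearMap_apply_eq_sum (lcoeff k l.1 ∘ₗ diffOp k n (monomial m'.1 1)) F.2

theorem catPoly_map (F : Form k n (n * (d - 1))) :
    (catPoly k n d).map (evalForm F) = catMatrix d F.1 := by
  ext l m'
  rw [catMatrix_eq_sum]
  simp [catPoly, evalForm_X, mul_comm, ← algebraMap_eq]

variable (α : MinorChoice n d)

/-- The chosen minor, as a polynomial in the coefficients of a form. -/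
noncomputable def MinorChoice.detPoly (k : Type*) [Field k] {n d : ℕ} (α : MinorChoice n d) :
    MvPolynomial (Monom n (n * (d - 1))) k :=
  ((catPoly k n d).submatrix α.rows fun i => α.cols (Sum.inl i)).det

theorem MinorChoice.blockA_eq_map (F : Form k n (n * (d - 1))) :
    α.blockA F.1 = (evalForm F).mapMatrix
      ((catPoly k n d).submatrix α.rows fun i => α.cols (Sum.inl i)) := by
  rw [blockA, ← catPoly_map]
  rfl

theorem MinorChoice.evalForm_detPoly (F : Form k n (n * (d - 1))) :
    evalForm F (α.detPoly k) = (α.blockA F.1).det := by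
  rw [blockA_eq_map, detPoly, AlgHom.map_det]

/-- The coefficients of the canonical forms are regular functions on a chart. -/
theorem MinorChoice.exists_kernelVec_eq_div : ∃ num : Fin n × Monom n d →
    MvPolynomial (Monom n (n * (d - 1))) k, ∀ F : Form k n (n * (d - 1)),
      (α.blockA F.1).det ≠ 0 → ∀ t, α.kernelVec F.1 t.1 t.2 =
        evalForm F (num t) / evalForm F (α.detPoly k) := by
  let A := (catPoly k n d).submatrix α.rows fun i => α.cols (Sum.inl i)
  let B := (catPoly k n d).submatrix α.rows fun i => α.cols (Sum.inr i)
  -- Cramer's rule; the constant entries are multiplied by the minor so that all share one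
  -- denominator.
  refine ⟨fun t => Sum.elim (fun i => -(A.adjugate * B) i t.1)
    (fun i => A.det * (Pi.single t.1 1 : Fin n → _) i) (α.cols.symm t.2), fun F hF => ?_⟩
  rintro ⟨j, m⟩
  obtain ⟨s, rfl⟩ := α.cols.surjective m
  rw [eq_div_iff (by rwa [evalForm_detPoly]), evalForm_detPoly, kernelVec]
  simp only [Equiv.symm_apply_apply]
  have hA : (evalForm F).mapMatrix A = α.blockA F.1 := (α.blockA_eq_map F).symm
  have hB : B.map (evalForm F) = α.blockB F.1 := by
    rw [blockB, ← catPoly_map]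
    rfl
  rcases s with i | i
  · have h1 : (A.adjugate * B).map (evalForm F) = (α.blockA F.1).adjugate * α.blockB F.1 := by
      rw [Matrix.map_mul, hB]
      congr 1
      rw [← hA, ← AlgHom.map_adjugate]
      rfl
    have h2 : evalForm F ((A.adjugate * B) i j) =
        ((α.blockA F.1).adjugate * α.blockB F.1) i j := by rw [← h1]; rfl
    have h3 : ((α.blockA F.1).adjugate * α.blockB F.1) i j =
      (α.blockA F.1).adjugate.mulVec ((α.blockB F.1).col j) i := rfl
    simp only [Sum.elim_inl, map_neg, h2, h3, Pi.neg_apply, Matrix.mulVec_single_one]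
    rw [Matrix.inv_def, Ring.inverse_eq_inv', Matrix.smul_mulVec, Pi.smul_apply, smul_eq_mul]
    field_simp
  · simp only [Sum.elim_inr, map_mul]
    have h3 : evalForm F A.det = (α.blockA F.1).det := by rw [← hA, AlgHom.map_det]
    rw [h3, mul_comm]
    congr 1
    by_cases h : i = j
    · subst h; simp
    · simp [Pi.single_eq_of_ne h]

/-- A polynomial expression in the coefficients of the canonical forms is, up to a power of the
minor, a polynomial in the coefficients of the form. -/
theorem MinorChoice.exists_evalForm_eq (P : MvPolynomial (Fin n × Monom n d) k) :
    ∃ (P' : MvPolynomial (Monom n (n * (d - 1))) k) (N : ℕ), ∀ F : Form k n (n * (d - 1)),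
      (α.blockA F.1).det ≠ 0 → evalForm F P' =
        (α.blockA F.1).det ^ N * eval (fun t => α.kernelVec F.1 t.1 t.2) P := by
  obtain ⟨num, hnum⟩ := α.exists_kernelVec_eq_div (k := k)
  obtain ⟨P', N, h⟩ := exists_clear_denominators P num (α.detPoly k)
  refine ⟨P', N, fun F hF => ?_⟩
  have h1 := h (coeffVec _ F.1)
  simp only [← evalForm_apply, α.evalForm_detPoly] at h1
  rw [h1 hF]
  congr 3
  ext t
  rw [hnum F hF t, α.evalForm_detPoly]

theorem le_rank_of_blockA {F : MvPolynomial (Fin n) k} (h : (α.blockA F).det ≠ 0) :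
    dimK n d - n ≤ (catMatrix d F).rank := by
  have h1 : (α.blockA F).rank = dimK n d - n := by
    rw [Matrix.rank_of_isUnit _ ((Matrix.isUnit_iff_isUnit_det _).2 (isUnit_iff_ne_zero.2 h)),
      Fintype.card_fin]
  rw [← h1]
  exact Matrix.rank_submatrix_le _ _ _

variable [CharZero k] [IsAlgClosed k]

/-- The open set is where, for some choice of minor, the minor and the resultant of its canonical
forms, cleared of denominators, are both nonzero. Inside V a nonzero minor already forces rank K -
n. -/
theorem exists_isOpen_locusURes (hn : 2 ≤ n) (hd : 2 ≤ d) :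
    ∃ O : Set (Form k n (n * (d - 1))), IsOpen O ∧ locusURes k n d = varV k n d ∩ O := by
  choose P N hP using fun α : MinorChoice n d => α.exists_evalForm_eq (resultantPoly k n d)
  have hres : ∀ (α : MinorChoice n d) (F : Form k n (n * (d - 1))),
      resultant d (α.canonicalForm F.1) =
        eval (fun t => α.kernelVec F.1 t.1 t.2) (resultantPoly k n d) := by
    intro α F
    rw [resultant]
    congr 2
    ext t
    exact coeff_formOf _ _
  refine ⟨⋃ α : MinorChoice n d, {F | evalForm F (α.detPoly k * P α) ≠ 0},
    isOpen_iUnion fun α => isOpen_evalForm_ne_zero _, ?_⟩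
  ext F
  simp only [Set.mem_inter_iff, Set.mem_iUnion, Set.mem_ofPred_eq, map_mul, mul_ne_zero_iff,
    MinorChoice.evalForm_detPoly]
  constructor
  · intro hF
    have hU := (exists_noCommonZero_of_mem_locusURes hn hd hF).1
    obtain ⟨α, hα⟩ := exists_mem_chart hn hd hU
    refine ⟨le_of_eq hU, α, hα.2, ?_⟩
    rw [hP α F hα.2, ← hres]
    exact mul_ne_zero (pow_ne_zero _ hα.2) ((mem_locusURes_iff_resultant hn hd hα).1 hF)
  · rintro ⟨hV, α, hdet, hPα⟩
    have hU : F ∈ varU k n d := le_antisymm hV (le_rank_of_blockA α hdet)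
    rw [mem_locusURes_iff_resultant hn hd ⟨hU, hdet⟩, hres]
    rw [hP α F hdet] at hPα
    exact right_ne_zero_of_mul hPα

theorem isClosed_locusZ (hn : 2 ≤ n) (hd : 2 ≤ d) :
    IsClosed ((↑) ⁻¹' locusZ k n d : Set ↥(varU k n d)) := by
  obtain ⟨O, hO, h⟩ := exists_isOpen_locusURes (k := k) hn hd
  rw [← isOpen_compl_iff, isOpen_induced_iff]
  refine ⟨O, hO, ?_⟩
  ext ⟨F, hF⟩
  have h1 : F ∈ locusURes k n d ↔ F ∈ O := by
    rw [h]; exact and_iff_right (le_of_eq hF)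
  rw [locusURes_eq_diff hn hd] at h1
  exact ⟨fun hFO => (h1.2 hFO).2, fun hZ => h1.1 ⟨hF, hZ⟩⟩

end CatalecticantPolynomials
end Catalecticant

namespace Catalecticant

/-! ### Raising the rank by powers of linear forms; the closure of Z. -/

section Perturbation
variable {k : Type*} [Field k] {n d : ℕ}

theorem apolar_add (F G h : MvPolynomial (Fin n) k) :
    apolar (F + G) h = apolar F h + apolar G h := by simp [apolar_apply]

theorem apolar_smul (c : k) (F h : MvPolynomial (Fin n) k) :
    apolar (c • F) h = c * apolar F h := by simp [apolar_apply]

theorem exists_eval_ne_zero {σ : Type*} [Infinite k] {p : MvPolynomial σ k} (hp : p ≠ 0) :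
    ∃ x, eval x p ≠ 0 := by
  by_contra! h
  exact hp (MvPolynomial.funext fun x => by rw [h x, map_zero])

/-- A polynomial in the coefficients, restricted to a line of forms. -/
theorem exists_polynomial_eval_line {j : ℕ} (F L : Form k n j) (p : MvPolynomial (Monom n j) k) :
    ∃ q : Polynomial k, ∀ t, q.eval t = evalForm (F + t • L) p := by
  refine ⟨aeval (fun m : Monom n j =>
    Polynomial.C (coeff m.1 F.1) + Polynomial.X * Polynomial.C (coeff m.1 L.1)) p, fun t => ?_⟩
  rw [polynomial_eval_aeval, evalForm_apply]
  congr 2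
  ext m
  simp [coeffVec]
  exact mul_comm _ _

/-- A polynomial vanishing at `F + t L` for all `t ≠ 0` vanishes at `F`. -/
theorem evalForm_eq_zero_of_line [Infinite k] {j : ℕ} {F L : Form k n j}
    {p : MvPolynomial (Monom n j) k} (h : ∀ t : k, t ≠ 0 → evalForm (F + t • L) p = 0) :
    evalForm F p = 0 := by
  obtain ⟨q, hq⟩ := exists_polynomial_eval_line F L p
  have h0 := polynomial_eval_zero_of_forall_ne (q := q) fun t ht => by rw [hq, h t ht]
  rwa [hq, zero_smul, add_zero] at h0

variable [CharZero k]

theorem mem_annihilator_iff_of_isHomogeneous {F h : MvPolynomial (Fin n) k} {N e : ℕ}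
    (hF : F.IsHomogeneous N) (hh : h.IsHomogeneous e) (he : e ≤ N) :
    h ∈ annihilator F ↔ ∀ g : MvPolynomial (Fin n) k, g.IsHomogeneous (N - e) →
      apolar F (g * h) = 0 := by
  constructor
  · intro ha g _
    exact apolar_eq_zero_of_mem_annihilator (Ideal.mul_mem_left _ _ ha)
  · intro ha
    refine mem_annihilator_iff.2 fun l => ?_
    by_cases hl : l.degree = N - e
    · exact ha _ (isHomogeneous_monomial _ hl)
    · exact apolar_eq_zero_of_isHomogeneous hF ((isHomogeneous_monomial _ rfl).mul hh) (by omega)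

/-- If the catalecticant matrix has dependent rows, some form of complementary degree is apolar to
all multiples of degree `n(d-1)`. -/
theorem exists_apolar_mul_eq_zero (hn : 0 < n) (F : Form k n (n * (d - 1)))
    (hr : (catMatrix d F.1).rank < Fintype.card (Monom n (n * (d - 1) - d))) :
    ∃ g : MvPolynomial (Fin n) k, g.IsHomogeneous (n * (d - 1) - d) ∧ g ≠ 0 ∧
      ∀ h : MvPolynomial (Fin n) k, h.IsHomogeneous d → apolar F.1 (g * h) = 0 := by
  let W : Submodule k (Form k n d) :=
    (annihilatorDeg F.1 d).comap (homogeneousSubmodule (Fin n) k d).subtype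
  -- Its values kill the degree d part of F^⊥, so they lie in a space whose dimension is the rank of
  -- D(F), less than the dimension of the source.
  let φ : Form k n (n * (d - 1) - d) →ₗ[k] Module.Dual k (Form k n d) :=
    LinearMap.mk₂ k (fun g h => apolar F.1 (g.1 * h.1))
      (fun _ _ _ => by simp [add_mul]) (fun _ _ _ => by simp)
      (fun _ _ _ => by simp [mul_add]) (fun _ _ _ => by simp)
  have hφ : ∀ g, φ g ∈ W.dualAnnihilator := by
    intro g
    rw [Submodule.mem_dualAnnihilator]
    intro h hh
    exact apolar_eq_zero_of_mem_annihilator (Ideal.mul_mem_left _ _ hh.1)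
  have h1 : Module.finrank k W = Module.finrank k (annihilatorDeg F.1 d) :=
    (Submodule.comapSubtypeEquivOfLe inf_le_right).finrank_eq
  have h2 := rank_add_finrank hn F
  have h3 := Subspace.finrank_add_finrank_dualAnnihilator_eq W
  rw [finrank_homogeneousSubmodule, card_monom_dimK hn] at h3
  have h4 : LinearMap.ker (φ.codRestrict W.dualAnnihilator hφ) ≠ ⊥ := by
    have hfin : Module.Finite k (Module.Dual k (Form k n d)) := inferInstance
    have hfin' : Module.Finite k W.dualAnnihilator := inferInstance
    refine LinearMap.ker_ne_bot_of_finrank_lt (V := Form k n (n * (d - 1) - d))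
      (V₂ := W.dualAnnihilator) (f := φ.codRestrict W.dualAnnihilator hφ) ?_
    rw [finrank_homogeneousSubmodule]
    omega
  obtain ⟨g, hg, hg0⟩ := Submodule.exists_mem_ne_zero_of_ne_bot h4
  refine ⟨g.1, g.2, fun h => hg0 (Subtype.ext h), fun h hh => ?_⟩
  have h5 := congrArg Subtype.val (LinearMap.mem_ker.1 hg)
  exact LinearMap.congr_fun h5 ⟨h, hh⟩

/-- Adding a general power of a linear form to a form whose catalecticant matrix has dependent rows
and columns increases the rank by one, and makes the annihilator in degree `d` have a zero. -/
theorem exists_rank_add_smul (hn : 2 ≤ n) (hd : 2 ≤ d) (F : Form k n (n * (d - 1)))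
    (hr : (catMatrix d F.1).rank < Fintype.card (Monom n (n * (d - 1) - d)))
    (hr' : (catMatrix d F.1).rank < dimK n d) :
    ∃ (L : Form k n (n * (d - 1))) (x : Fin n → k), x ≠ 0 ∧ ∀ t : k, t ≠ 0 →
      (catMatrix d (F + t • L).1).rank = (catMatrix d F.1).rank + 1 ∧
      ∀ h ∈ annihilatorDeg (F + t • L).1 d, eval x h = 0 := by
  obtain ⟨g, hg, hg0, hgF⟩ := exists_apolar_mul_eq_zero (by omega) F hr
  have h1 := rank_add_finrank (by omega) F
  have h2 : annihilatorDeg F.1 d ≠ ⊥ := by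
    intro h
    rw [h, finrank_bot] at h1
    omega
  obtain ⟨h, hh, hh0⟩ := Submodule.exists_mem_ne_zero_of_ne_bot h2
  -- g lies in the left kernel and h in the right kernel of the catalecticant pairing; x is a point
  -- where neither vanishes.
  obtain ⟨x, hx⟩ := exists_eval_ne_zero (mul_ne_zero hg0 hh0)
  rw [map_mul, mul_ne_zero_iff] at hx
  have hx0 : x ≠ 0 := by
    rintro rfl
    have h3 := eval_smul_of_isHomogeneous hh.2 (0 : k) (0 : Fin n → k)
    rw [smul_zero, zero_pow (by omega), zero_mul] at h3
    exact hx.2 h3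
  -- Up to a scalar L is a power of a linear form: it represents evaluation at x, and so changes the
  -- pairing by t times the product of the two values at x, a term of rank one.
  obtain ⟨L, hL⟩ := exists_form_apolar (N := n * (d - 1)) (aeval x : _ →ₐ[k] k).toLinearMap
  have hle := le_socleDegree hn hd
  have hsum : n * (d - 1) - d + d = n * (d - 1) := Nat.sub_add_cancel hle
  have hap : ∀ (t : k) {g h : MvPolynomial (Fin n) k}, g.IsHomogeneous (n * (d - 1) - d) →
      h.IsHomogeneous d → apolar (F + t • L).1 (g * h) =
        apolar F.1 (g * h) + t * (eval x g * eval x h) := by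
    intro t g h hg hh
    have hgh := hg.mul hh
    rw [hsum] at hgh
    change apolar (F.1 + t • L.1) _ = _
    rw [apolar_add, apolar_smul, hL _ hgh, ← map_mul]
    congr 2
  refine ⟨L, x, hx0, fun t ht => ?_⟩
  have hann : ∀ p, p ∈ annihilatorDeg (F + t • L).1 d ↔ p ∈ annihilatorDeg F.1 d ∧ eval x p = 0 := by
    intro p
    constructor
    · intro hp
      have h3 := (mem_annihilator_iff_of_isHomogeneous (F + t • L).2 hp.2 hle).1 hp.1
      have h4 : eval x p = 0 := by
        -- Pairing with g isolates the new term and forces p to vanish at x, so the annihilator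
        -- shrinks to a hyperplane.
        have h5 := h3 g hg
        rw [hap t hg hp.2, hgF p hp.2, zero_add] at h5
        simpa [ht, hx.1] using h5
      refine ⟨⟨(mem_annihilator_iff_of_isHomogeneous F.2 hp.2 hle).2 fun g' hg' => ?_, hp.2⟩, h4⟩
      have h5 := h3 g' hg'
      rwa [hap t hg' hp.2, h4, mul_zero, mul_zero, add_zero] at h5
    · rintro ⟨hp, hp0⟩
      refine ⟨(mem_annihilator_iff_of_isHomogeneous (F + t • L).2 hp.2 hle).2 fun g' hg' => ?_, hp.2⟩
      rw [hap t hg' hp.2, hp0, mul_zero, mul_zero, add_zero]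
      exact (mem_annihilator_iff_of_isHomogeneous F.2 hp.2 hle).1 hp.1 g' hg'
  refine ⟨?_, fun p hp => ((hann p).1 hp).2⟩
  have hfin : Module.Finite k (annihilatorDeg F.1 d) := finite_idealDeg (annihilator F.1) d
  let ψ : annihilatorDeg F.1 d →ₗ[k] k :=
    (aeval x : MvPolynomial (Fin n) k →ₐ[k] k).toLinearMap.domRestrict (annihilatorDeg F.1 d)
  have hψ : ∀ p, ψ p = eval x p.1 := fun p => aeval_eq_eval_apply _ _
  have hψs : LinearMap.range ψ = ⊤ := LinearMap.range_eq_top.2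
    (LinearMap.surjective_of_ne_zero fun h0 => hx.2 (by
      rw [← hψ ⟨h, hh⟩, h0, LinearMap.zero_apply]))
  have h3 := ψ.finrank_range_add_finrank_ker
  rw [hψs, finrank_top, Module.finrank_self] at h3
  have h4 : (LinearMap.ker ψ).map (annihilatorDeg F.1 d).subtype =
      annihilatorDeg (F + t • L).1 d := by
    ext p
    rw [hann]
    constructor
    · rintro ⟨p, hp, rfl⟩
      exact ⟨p.2, (hψ p).symm.trans hp⟩
    · rintro ⟨hp, hp0⟩
      exact ⟨⟨p, hp⟩, (hψ _).trans hp0, rfl⟩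
  have h5 := (Submodule.equivMapOfInjective _ (annihilatorDeg F.1 d).injective_subtype
    (LinearMap.ker ψ)).finrank_eq
  rw [h4] at h5
  have h6 := rank_add_finrank (by omega) (F + t • L)
  omega

variable [IsAlgClosed k]

theorem locusURes_nonempty (hn : 2 ≤ n) (hd : 2 ≤ d) : (locusURes k n d).Nonempty := by
  have hX : ∀ i : Fin n, ((X i : MvPolynomial (Fin n) k) ^ d).IsHomogeneous d :=
    fun i => isHomogeneous_X_pow i d
  obtain ⟨F, hF, hann⟩ := (noCommonZero_X_pow (k := k) (n := n) d).exists_form (by omega) hX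
    (by omega)
  exact ⟨F, mem_locusURes_of_noCommonZero hn hd hF (noCommonZero_X_pow d) hX hann⟩

/-- Each perturbation raises the rank by one. When it reaches K - n, the degree d part of the
annihilator has a common zero, so the perturbed form lies in Z; a polynomial vanishing for all t ≠ 0
on a line also vanishes at t = 0. -/
theorem mem_closure_locusZ_of_rank_lt (hn : 2 ≤ n) (hd : 2 ≤ d) {F : Form k n (n * (d - 1))}
    (hF : (catMatrix d F.1).rank < dimK n d - n) : F ∈ closure (locusZ k n d) := by
  have hinf : Infinite k := IsAlgClosed.instInfinite
  obtain ⟨F₀, hF₀⟩ := locusURes_nonempty (k := k) hn hd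
  -- D(F) has at least K - n rows because some form attains this rank; hence the rows are dependent
  -- below that rank.
  have hcard : dimK n d - n ≤ Fintype.card (Monom n (n * (d - 1) - d)) := by
    rw [← show (catMatrix d F₀.1).rank = dimK n d - n from
      (exists_noCommonZero_of_mem_locusURes hn hd hF₀).1]
    exact Matrix.rank_le_card_height _
  obtain ⟨e, he⟩ := Nat.exists_eq_add_of_lt hF
  induction e generalizing F with
  | zero =>
    obtain ⟨L, x, hx, h⟩ := exists_rank_add_smul hn hd F (by omega) (by omega)
    rw [mem_closure_iff_evalForm]
    intro p hp
    refine evalForm_eq_zero_of_line (L := L) fun t ht => hp _ ?_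
    by_contra hZ
    have hU : F + t • L ∈ varU k n d := (h t ht).1.trans he.symm
    have hR : F + t • L ∈ locusURes k n d := by
      rw [locusURes_eq_diff hn hd]; exact ⟨hU, hZ⟩
    obtain ⟨-, -, f, hf, hfd, hann⟩ := exists_noCommonZero_of_mem_locusURes hn hd hR
    obtain ⟨i, hi⟩ := hf x hx
    exact hi ((h t ht).2 (f i) ⟨hann i, hfd i⟩)
  | succ e ih =>
    obtain ⟨L, x, hx, h⟩ := exists_rank_add_smul hn hd F (by omega) (by omega)
    rw [mem_closure_iff_evalForm]
    intro p hp
    refine evalForm_eq_zero_of_line (L := L) fun t ht => ?_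
    have h1 := (h t ht).1
    exact mem_closure_iff_evalForm.1 (ih (F := F + t • L) (by omega) (by omega)) p hp

/-- Forms in V but not in U lie in the closure of Z. Conversely U_Res is open in V and disjoint from
Z, so it misses the closure. -/
theorem varV_diff_closure_locusZ (hn : 2 ≤ n) (hd : 2 ≤ d) :
    varV k n d \ closure (locusZ k n d) = locusURes k n d := by
  obtain ⟨O, hO, h⟩ := exists_isOpen_locusURes (k := k) hn hd
  have hdisj : Disjoint (locusURes k n d) (locusZ k n d) := by
    rw [locusURes_eq_diff hn hd]; exact Set.disjoint_sdiff_left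
  apply Set.Subset.antisymm
  · rintro F ⟨hV, hZ⟩
    rw [locusURes_eq_diff hn hd]
    refine ⟨?_, fun h => hZ (subset_closure h)⟩
    by_contra hU
    exact hZ (mem_closure_locusZ_of_rank_lt hn hd (lt_of_le_of_ne hV hU))
  · intro F hF
    have hF' := hF
    rw [h] at hF'
    refine ⟨hF'.1, fun hZ => ?_⟩
    obtain ⟨G, hGO, hGZ⟩ := mem_closure_iff.1 hZ O hO hF'.2
    have hGV : G ∈ varV k n d := le_of_eq (locusZ_subset_varU hGZ)
    exact hdisj.le_bot ⟨by rw [h]; exact ⟨hGV, hGO⟩, hGZ⟩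

end Perturbation
end Catalecticant

namespace Catalecticant

/-! ### Polynomial families of forms. -/

section Families
variable {k : Type*} [Field k] {n j : ℕ} {τ : Type*}

/-- The member at `x` of a polynomial family of forms. -/
noncomputable def formAt (G : Monom n j → MvPolynomial τ k) (x : τ → k) : Form k n j :=
  ⟨formOf fun m => eval x (G m), formOf_isHomogeneous _⟩

theorem coeffVec_formAt (G : Monom n j → MvPolynomial τ k) (x : τ → k) :
    coeffVec j (formAt G x).1 = fun m => eval x (G m) := coeffVec_formOf _

theorem coeff_formAt (G : Monom n j → MvPolynomial τ k) (x : τ → k) (m : Monom n j) :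
    coeff m.1 (formAt G x).1 = eval x (G m) := coeff_formOf _ _

theorem evalForm_formAt (G : Monom n j → MvPolynomial τ k) (x : τ → k)
    (p : MvPolynomial (Monom n j) k) : evalForm (formAt G x) p = eval x (aeval G p) := by
  rw [evalForm_apply, coeffVec_formAt, eval_aeval]

theorem formAt_eq {G : Monom n j → MvPolynomial τ k} {x : τ → k} {F : Form k n j}
    (h : ∀ m, eval x (G m) = coeff m.1 F.1) : formAt G x = F :=
  Subtype.ext (ext_of_isHomogeneous (formAt G x).2 F.2 fun m => by rw [coeff_formAt, h])

theorem isIrreducible_range_formAt [Infinite k] (G : Monom n j → MvPolynomial τ k)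
    {D : MvPolynomial τ k} (hD : D ≠ 0) :
    IsIrreducible {F | ∃ x, eval x D ≠ 0 ∧ formAt G x = F} := by
  rw [isIrreducible_iff_evalForm]
  constructor
  · obtain ⟨x, hx⟩ := exists_eval_ne_zero hD
    exact ⟨_, x, hx, rfl⟩
  · rintro p q ⟨_, ⟨x, -, rfl⟩, hp⟩ ⟨_, ⟨y, -, rfl⟩, hq⟩
    rw [evalForm_formAt] at hp hq
    have hp' : aeval G p ≠ 0 := fun h => hp (by rw [h, map_zero])
    have hq' : aeval G q ≠ 0 := fun h => hq (by rw [h, map_zero])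
    obtain ⟨z, hz⟩ := exists_eval_ne_zero (mul_ne_zero hD (mul_ne_zero hp' hq'))
    rw [map_mul, map_mul, mul_ne_zero_iff, mul_ne_zero_iff] at hz
    exact ⟨_, ⟨z, hz.1, rfl⟩, by rw [evalForm_formAt]; exact hz.2.1,
      by rw [evalForm_formAt]; exact hz.2.2⟩

end Families

/-! ### Local sections of the family of dual forms, and irreducibility of U_Res. -/

section Sections
variable {k : Type*} [Field k]

/-- A solution of a linear system with polynomial coefficients that is injective at `a₀` extends to
a polynomial family of solutions, up to a factor that is `1` at `a₀`. -/
theorem exists_polynomial_solution {ρ R S : Type*} [Fintype R] [Fintype S]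
    (T : Matrix R S (MvPolynomial ρ k)) (b : R → k) (a₀ : ρ → k) (v₀ : S → k)
    (hinj : ∀ v, (T.map (eval a₀)).mulVec v = 0 → v = 0)
    (hv₀ : (T.map (eval a₀)).mulVec v₀ = b) :
    ∃ (G : S → MvPolynomial ρ k) (δ : MvPolynomial ρ k), eval a₀ δ = 1 ∧
      (∀ s, eval a₀ (G s) = v₀ s) ∧ ∀ (a : ρ → k) (v : S → k) (c : k),
        (T.map (eval a)).mulVec v = c • b → ∀ s, eval a δ * v s = c * eval a (G s) := by
  classical
  obtain ⟨g, hg⟩ := (T.map (eval a₀)).mulVecLin.exists_leftInverse_of_injective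
    (LinearMap.ker_eq_bot'.2 hinj)
  -- Composing with a left inverse at a₀ gives a square system whose determinant is 1 at a₀, to
  -- which Cramer's rule applies; solvability elsewhere is not asserted but assumed of v.
  let L : Matrix S R k := LinearMap.toMatrix' g
  have hL : L * T.map (eval a₀) = 1 := by
    have := congrArg LinearMap.toMatrix' hg
    rwa [LinearMap.toMatrix'_comp, ← Matrix.toLin'_apply', LinearMap.toMatrix'_toLin',
      LinearMap.toMatrix'_id] at this
  let L' : Matrix S R (MvPolynomial ρ k) := L.map C
  let N : Matrix S S (MvPolynomial ρ k) := L' * T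
  have hN : ∀ a, (eval a).mapMatrix N = L * T.map (eval a) := by
    intro a
    rw [RingHom.mapMatrix_apply, show N = L' * T from rfl, Matrix.map_mul]
    congr 1
    ext s r
    simp [L']
  have hG : ∀ a s, eval a (N.adjugate.mulVec (fun s => C (L.mulVec b s)) s) =
      (L * T.map (eval a)).adjugate.mulVec (L.mulVec b) s := by
    intro a s
    rw [← hN, ← RingHom.map_adjugate, RingHom.map_mulVec]
    congr 2
    ext s
    simp
  have key : ∀ (a : ρ → k) (v : S → k) (c : k), (T.map (eval a)).mulVec v = c • b →
      ∀ s, eval a N.det * v s = c * eval a (N.adjugate.mulVec (fun s => C (L.mulVec b s)) s) := by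
    intro a v c hv s
    have h1 : (L * T.map (eval a)).mulVec v = c • L.mulVec b := by
      rw [← Matrix.mulVec_mulVec, hv, Matrix.mulVec_smul]
    have h2 := congrArg ((L * T.map (eval a)).adjugate.mulVec) h1
    rw [Matrix.mulVec_mulVec, Matrix.adjugate_mul, Matrix.mulVec_smul, Matrix.smul_mulVec,
      Matrix.one_mulVec, ← hN, ← RingHom.map_det, hN] at h2
    rw [hG]
    exact congrFun h2 s
  have h1 : eval a₀ N.det = 1 := by rw [RingHom.map_det, hN, hL, Matrix.det_one]
  refine ⟨_, N.det, h1, fun s => ?_, key⟩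
  have := key a₀ v₀ 1 (by rw [hv₀, one_smul]) s
  rw [h1, one_mul, one_mul] at this
  exact this.symm

end Sections

section LocalSections
variable {k : Type*} [Field k] {n d : ℕ}

/-- The linear system, with coefficients depending on `n` forms of degree `d`, whose solutions are
the forms killed by these, together with the coefficient at `m₀`. -/
noncomputable def apolarSystem (k : Type*) [Field k] {n d : ℕ} (m₀ : Monom n (n * (d - 1))) :
    Matrix ((Fin n × Monom n (n * (d - 1) - d)) ⊕ Unit) (Monom n (n * (d - 1)))
      (MvPolynomial (Fin n × Monom n d) k) :=
  open Classical in
  Matrix.of (Sum.elim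
    (fun r m => ∑ m' : Monom n d, X (r.1, m') * C (catMatrix d (monomial m.1 (1 : k)) r.2 m'))
    (fun _ m => if m = m₀ then 1 else 0))

theorem apolarSystem_mulVec (m₀ : Monom n (n * (d - 1))) (a : Fin n × Monom n d → k)
    (F : Form k n (n * (d - 1))) : ((apolarSystem k m₀).map (eval a)).mulVec (coeffVec _ F.1) =
      Sum.elim (fun r => (catMatrix d F.1).mulVec (fun m' => a (r.1, m')) r.2)
        (fun _ => coeff m₀.1 F.1) := by
  ext (r | r)
  · simp only [Matrix.mulVec, dotProduct, apolarSystem, Matrix.map_apply, Matrix.of_apply,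
      Sum.elim_inl, map_sum, map_mul, eval_X, eval_C, coeffVec, catMatrix_eq_sum F,
      Finset.sum_mul]
    rw [Finset.sum_comm]
    refine Finset.sum_congr rfl fun m' _ => Finset.sum_congr rfl fun m _ => ?_
    ring
  · simp [Matrix.mulVec, dotProduct, apolarSystem, coeffVec]

variable [CharZero k]

theorem apolarSystem_mulVec_eq {m₀ : Monom n (n * (d - 1))} {a : Fin n × Monom n d → k}
    {F : Form k n (n * (d - 1))} (hF : ∀ i, tupleForm a i ∈ annihilator F.1) :
    ((apolarSystem k m₀).map (eval a)).mulVec (coeffVec _ F.1) =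
      Sum.elim (0 : Fin n × Monom n (n * (d - 1) - d) → k) (fun _ => coeff m₀.1 F.1) := by
  rw [apolarSystem_mulVec]
  congr 1
  ext r
  have := (catMatrix_mulVec_eq_zero F fun m' => a (r.1, m')).2 ⟨hF r.1, formOf_isHomogeneous _⟩
  exact congrFun this r.2

variable [IsAlgClosed k]

/-- The line of forms killed by `n` forms of degree `d` without common zero has, locally, a
polynomial generator. -/
theorem exists_local_section (hn : 2 ≤ n) (hd : 2 ≤ d) {a₀ : Fin n × Monom n d → k}
    (h₀ : NoCommonZero (tupleForm a₀)) {F₀ : Form k n (n * (d - 1))} (hF₀ : F₀ ≠ 0)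
    (hann : ∀ i, tupleForm a₀ i ∈ annihilator F₀.1) :
    ∃ (G : Monom n (n * (d - 1)) → MvPolynomial (Fin n × Monom n d) k)
      (δ : MvPolynomial (Fin n × Monom n d) k) (m₀ : Monom n (n * (d - 1))),
      eval a₀ δ ≠ 0 ∧ formAt G a₀ = F₀ ∧ ∀ a, NoCommonZero (tupleForm a) → eval a δ ≠ 0 →
        (∀ i, tupleForm a i ∈ annihilator (formAt G a).1) ∧ eval a (G m₀) = eval a δ := by
  have hm₀ : ∃ m₀ : Monom n (n * (d - 1)), coeff m₀.1 F₀.1 ≠ 0 := by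
    by_contra! h
    exact hF₀ (Subtype.ext (ext_of_isHomogeneous F₀.2 (isHomogeneous_zero _ _ _) fun m => by
      rw [h]; rfl))
  obtain ⟨m₀, hm₀⟩ := hm₀
  -- The forms killed by the tuple at a₀ form a line, so prescribing a coefficient that is nonzero
  -- in F₀ makes the system injective.
  obtain ⟨G, δ, hδ, hG, hsol⟩ := exists_polynomial_solution (apolarSystem k m₀)
    (Sum.elim (0 : Fin n × Monom n (n * (d - 1) - d) → k) fun _ => coeff m₀.1 F₀.1) a₀ (coeffVec _ F₀.1) (fun v hv => by
      let F : Form k n (n * (d - 1)) := (coeffEquiv k n _).symm v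
      have hFv : coeffVec _ F.1 = v := coeffVec_formOf v
      rw [← hFv, apolarSystem_mulVec] at hv
      have hF : ∀ i, tupleForm a₀ i ∈ annihilator F.1 := by
        intro i
        refine ((catMatrix_mulVec_eq_zero F fun m' => a₀ (i, m')).1 ?_).1
        ext l
        exact congrFun hv (Sum.inl (i, l))
      obtain ⟨c, hc⟩ := h₀.form_unique (by omega) (tupleForm_isHomogeneous a₀) (by omega) hF₀ hann hF
      have h1 : coeff m₀.1 F.1 = 0 := congrFun hv (Sum.inr ())
      rw [hc] at h1
      have h2 : c * coeff m₀.1 F₀.1 = 0 := h1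
      have h3 : c = 0 := (mul_eq_zero.1 h2).resolve_right hm₀
      rw [← hFv, hc, h3, zero_smul]
      ext m
      simp [coeffVec]) (apolarSystem_mulVec_eq hann)
  -- With this factor the coefficient of the section at m₀ equals the returned δ, so the section is
  -- nonzero wherever δ is.
  refine ⟨G, C (coeff m₀.1 F₀.1) * δ, m₀, by rw [map_mul, hδ, eval_C, mul_one]; exact hm₀,
    formAt_eq hG, fun a ha hδa => ?_⟩
  rw [map_mul, eval_C, mul_ne_zero_iff] at hδa
  obtain ⟨F, hF, hFa⟩ := ha.exists_form (by omega) (tupleForm_isHomogeneous a) (by omega)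
  have h1 : ∀ m : Monom n (n * (d - 1)), eval a δ * coeff m.1 F.1 =
      (coeff m₀.1 F.1 / coeff m₀.1 F₀.1) * eval a (G m) := by
    refine hsol a (coeffVec _ F.1) _ ?_
    rw [apolarSystem_mulVec_eq hFa]
    ext (r | r)
    · simp
    · simp [hm₀]
  have h2 : coeff m₀.1 F.1 ≠ 0 := by
    intro h0
    refine hF (Subtype.ext (ext_of_isHomogeneous F.2 (isHomogeneous_zero _ _ _) fun m => ?_))
    have := h1 m
    rw [h0, zero_div, zero_mul] at this
    exact (mul_eq_zero.1 this).resolve_left hδa.2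
  have h3 : formAt G a = (coeff m₀.1 F₀.1 * eval a δ / coeff m₀.1 F.1) • F := by
    refine formAt_eq fun m => ?_
    have := h1 m
    change _ = _ * coeff m.1 F.1
    field_simp at this ⊢
    linear_combination -this
  constructor
  · intro i
    rw [h3]
    change diffOp k n _ (_ • F.1) = 0
    rw [map_smul, mem_annihilator.1 (hFa i), smul_zero]
  · rw [← coeff_formAt, h3, map_mul, eval_C]
    change _ * coeff m₀.1 F.1 = _
    field_simp

theorem smul_mem_locusURes (hn : 2 ≤ n) (hd : 2 ≤ d) {F : Form k n (n * (d - 1))}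
    (hF : F ∈ locusURes k n d) {c : k} (hc : c ≠ 0) : c • F ∈ locusURes k n d := by
  obtain ⟨-, hF0, f, hf, hfd, hann⟩ := exists_noCommonZero_of_mem_locusURes hn hd hF
  refine mem_locusURes_of_noCommonZero hn hd (smul_ne_zero hc hF0) hf hfd fun i => ?_
  change diffOp k n _ (c • F.1) = 0
  rw [map_smul, mem_annihilator.1 (hann i), smul_zero]

/-- For p, and likewise for q, a nonempty open set of tuples in an affine space has a dual form
where it is nonzero. At a tuple common to both sets the two dual forms are proportional, and one
nonzero multiple serves p and q together. -/
theorem isIrreducible_locusURes (hn : 2 ≤ n) (hd : 2 ≤ d) : IsIrreducible (locusURes k n d) := by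
  have hinf : Infinite k := IsAlgClosed.instInfinite
  refine isIrreducible_iff_evalForm.2 ⟨locusURes_nonempty hn hd, ?_⟩
  have hsec : ∀ (F₀ : Form k n (n * (d - 1))) (p : MvPolynomial (Monom n (n * (d - 1))) k),
      F₀ ∈ locusURes k n d → evalForm F₀ p ≠ 0 →
      ∃ P : MvPolynomial (Fin n × Monom n d) k, P ≠ 0 ∧ ∀ a, eval a P ≠ 0 →
        NoCommonZero (tupleForm a) ∧ ∃ F : Form k n (n * (d - 1)), F ≠ 0 ∧ evalForm F p ≠ 0 ∧
          ∀ i, tupleForm a i ∈ annihilator F.1 := by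
    intro F₀ p hF₀ hp
    obtain ⟨-, hF0, f, hf, hfd, hann⟩ := exists_noCommonZero_of_mem_locusURes hn hd hF₀
    let a₀ : Fin n × Monom n d → k := fun t => coeff t.2.1 (f t.1)
    have ha₀ : tupleForm a₀ = f := tupleForm_coeff hfd
    rw [← ha₀] at hf hann
    obtain ⟨Δ, hΔ0, hΔ⟩ := exists_separating (by omega) (by omega) hf
    obtain ⟨G, δ, m₀, hδ, hG, hsol⟩ := exists_local_section hn hd hf hF0 hann
    refine ⟨Δ * (δ * aeval G p), ?_, fun a ha => ?_⟩
    · intro h0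
      have := congrArg (eval a₀) h0
      rw [map_mul, map_mul, map_zero, ← evalForm_formAt, hG] at this
      exact mul_ne_zero hΔ0 (mul_ne_zero hδ hp) this
    · rw [map_mul, map_mul, mul_ne_zero_iff, mul_ne_zero_iff, ← evalForm_formAt] at ha
      have hcz : NoCommonZero (tupleForm a) := by
        by_contra hcon
        exact ha.1 (hΔ a (mem_commonZeroLocus.2 hcon))
      obtain ⟨h1, h2⟩ := hsol a hcz ha.2.1
      refine ⟨hcz, formAt G a, fun h0 => ?_, ha.2.2, h1⟩
      rw [← coeff_formAt, h0] at h2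
      exact ha.2.1 h2.symm
  rintro p q ⟨F₁, hF₁, hp⟩ ⟨F₂, hF₂, hq⟩
  obtain ⟨P, hP0, hP⟩ := hsec F₁ p hF₁ hp
  obtain ⟨Q, hQ0, hQ⟩ := hsec F₂ q hF₂ hq
  obtain ⟨a, ha⟩ := exists_eval_ne_zero (mul_ne_zero hP0 hQ0)
  rw [map_mul, mul_ne_zero_iff] at ha
  obtain ⟨hcz, E₁, hE₁, hpE, hann₁⟩ := hP a ha.1
  obtain ⟨-, E₂, hE₂, hqE, hann₂⟩ := hQ a ha.2
  obtain ⟨c, rfl⟩ := hcz.form_unique (by omega) (tupleForm_isHomogeneous a) (by omega) hE₁ hann₁ hann₂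
  obtain ⟨u, hu⟩ := exists_polynomial_eval_line 0 E₁ p
  obtain ⟨v, hv⟩ := exists_polynomial_eval_line 0 E₁ q
  simp only [zero_add] at hu hv
  have hu0 : u ≠ 0 := by
    rintro rfl
    have := hu 1
    rw [one_smul, Polynomial.eval_zero] at this
    exact hpE this.symm
  have hv0 : v ≠ 0 := by
    rintro rfl
    have := hv c
    rw [Polynomial.eval_zero] at this
    exact hqE this.symm
  -- The factor X keeps the scalar nonzero, so that the multiple stays in U_Res.
  have huv : ∃ s, (u * v * Polynomial.X).eval s ≠ 0 := by
    by_contra! h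
    exact mul_ne_zero (mul_ne_zero hu0 hv0) Polynomial.X_ne_zero
      (Polynomial.funext fun s => by rw [h s, Polynomial.eval_zero])
  obtain ⟨s, hs⟩ := huv
  rw [Polynomial.eval_mul, Polynomial.eval_mul, Polynomial.eval_X, mul_ne_zero_iff,
    mul_ne_zero_iff, hu, hv] at hs
  exact ⟨s • E₁, smul_mem_locusURes hn hd (mem_locusURes_of_noCommonZero hn hd hE₁ hcz
    (tupleForm_isHomogeneous a) hann₁) hs.2, hs.1⟩

end LocalSections
end Catalecticant

namespace Catalecticant

/-! ### Irreducible closed subsets of a subspace. -/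

section Subspaces
variable {α : Type*} [TopologicalSpace α]

theorem isIrreducible_preimage_val {S X : Set α} (hS : IsIrreducible S) (hSX : S ⊆ X) :
    IsIrreducible (Subtype.val ⁻¹' S : Set X) := by
  obtain ⟨⟨x, hx⟩, h⟩ := hS
  refine ⟨⟨⟨x, hSX hx⟩, hx⟩, ?_⟩
  rintro _ _ ⟨u, hu, rfl⟩ ⟨v, hv, rfl⟩ ⟨y, hy, hyu⟩ ⟨z, hz, hzv⟩
  obtain ⟨w, hw, hw'⟩ := h u v hu hv ⟨y, hy, hyu⟩ ⟨z, hz, hzv⟩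
  exact ⟨⟨w, hSX hw⟩, hw, hw'⟩

/-- The closure in `X` of an irreducible subset. -/
noncomputable def closureIn (X : Set α) {S : Set α} (hS : IsIrreducible S) (hSX : S ⊆ X) :
    TopologicalSpace.IrreducibleCloseds X where
  carrier := closure (Subtype.val ⁻¹' S)
  isIrreducible' := isIrreducible_iff_closure.2 (isIrreducible_preimage_val hS hSX)
  isClosed' := isClosed_closure

theorem val_mem_closure_of_mem {X S : Set α} {x : X}
    (hx : x ∈ closure (Subtype.val ⁻¹' S : Set X)) : x.1 ∈ closure S :=
  closure_mono (Set.image_preimage_subset _ _)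
    (image_closure_subset_closure_image continuous_subtype_val ⟨x, hx, rfl⟩)

end Subspaces

/-! ### Bounds for the Krull dimension of a parametrized set. -/

section Dimension
variable {k : Type*} [Field k] {n j : ℕ} {τ : Type*} [Fintype τ]

/-- The polynomials vanishing on a set of forms. -/
noncomputable def vanishingIdealForm (S : Set (Form k n j)) : Ideal (MvPolynomial (Monom n j) k) where
  carrier := {p | ∀ F ∈ S, evalForm F p = 0}
  add_mem' hp hq F hF := by rw [map_add, hp F hF, hq F hF, add_zero]
  zero_mem' F _ := map_zero _
  smul_mem' c p hp F hF := by rw [smul_eq_mul, map_mul, hp F hF, mul_zero]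

theorem mem_vanishingIdealForm {S : Set (Form k n j)} {p : MvPolynomial (Monom n j) k} :
    p ∈ vanishingIdealForm S ↔ ∀ F ∈ S, evalForm F p = 0 := Iff.rfl

theorem isPrime_vanishingIdealForm {S : Set (Form k n j)} (hS : IsIrreducible S) :
    (vanishingIdealForm S).IsPrime := by
  obtain ⟨⟨F, hF⟩, h⟩ := isIrreducible_iff_evalForm.1 hS
  constructor
  · intro htop
    have h1 : (1 : MvPolynomial (Monom n j) k) ∈ vanishingIdealForm S := by
      rw [htop]; trivial
    exact one_ne_zero ((map_one (evalForm F)).symm.trans (h1 F hF))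
  · intro p q hpq
    by_contra! hcon
    simp only [mem_vanishingIdealForm, not_forall] at hcon
    obtain ⟨⟨F, hF, hp⟩, G, hG, hq⟩ := hcon
    obtain ⟨E, hE, hpE, hqE⟩ := h p q ⟨F, hF, hp⟩ ⟨G, hG, hq⟩
    have := hpq E hE
    rw [map_mul] at this
    exact mul_ne_zero hpE hqE this

theorem vanishingIdealForm_lt {X : Set (Form k n j)} {Z Z' : TopologicalSpace.IrreducibleCloseds X}
    (h : Z < Z') : vanishingIdealForm (Subtype.val '' (Z' : Set X)) <
      vanishingIdealForm (Subtype.val '' (Z : Set X)) := by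
  obtain ⟨F, hF', hF⟩ := Set.exists_of_ssubset (SetLike.coe_ssubset_coe.2 h)
  obtain ⟨C, hC, hCZ⟩ := isClosed_induced_iff.1 Z.isClosed
  have hFC : F.1 ∈ Cᶜ := fun hmem => hF (by rw [← hCZ]; exact hmem)
  obtain ⟨p, hpF, hp⟩ := exists_evalForm_of_isOpen hC.isOpen_compl hFC
  refine lt_of_le_of_ne (fun q hq G hG => hq G (Set.image_mono (SetLike.coe_subset_coe.2 h.le) hG))
    fun heq => ?_
  have h1 : p ∈ vanishingIdealForm (Subtype.val '' (Z : Set X)) := by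
    rintro _ ⟨G, hG, rfl⟩
    by_contra hG0
    exact hp G.1 hG0 (by rw [← hCZ] at hG; exact hG)
  rw [← heq] at h1
  exact hpF (h1 F.1 ⟨F, hF', rfl⟩)

/-- A set of forms contained in the closure of the image of a polynomial family has dimension at
most the number of parameters. -/
theorem topologicalKrullDim_le_card (G : Monom n j → MvPolynomial τ k) {X : Set (Form k n j)}
    (hX : ∀ p, aeval G p = 0 → ∀ F ∈ X, evalForm F p = 0) :
    topologicalKrullDim X ≤ ((Fintype.card τ : ℕ) : WithBot ℕ∞) := by
  refine iSup_le fun p => ?_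
  -- Growing closed sets have shrinking prime ideals, and each step adds one independent element.
  -- Those of the last member are carried by G to independent polynomials in the parameters.
  have key : ∀ (i : ℕ) (hi : i < p.length + 1), ∃ x : Fin i → MvPolynomial (Monom n j) k,
      IndepMod (k := k) (vanishingIdealForm (Subtype.val '' (p.toFun ⟨i, hi⟩ : Set X))) x := by
    intro i
    induction i with
    | zero =>
      intro hi
      refine ⟨Fin.elim0, fun q hq => ?_⟩
      obtain ⟨F, hF⟩ := (p.toFun ⟨0, hi⟩).isIrreducible.1
      have h1 := hq F.1 ⟨F, hF, rfl⟩
      rw [eq_C_of_isEmpty q] at h1 ⊢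
      rw [algHom_C, algebraMap_eq, algHom_C] at h1
      rw [show coeff 0 q = 0 from h1, C_0]
    | succ i ih =>
      intro hi
      obtain ⟨x, hx⟩ := ih (by omega)
      have hprime : (vanishingIdealForm (Subtype.val ''
          (p.toFun (Fin.succ ⟨i, by omega⟩) : Set X))).IsPrime := isPrime_vanishingIdealForm
        ((p.toFun _).isIrreducible.image Subtype.val continuous_subtype_val.continuousOn)
      exact IndepMod.of_lt (vanishingIdealForm_lt (p.step ⟨i, Nat.lt_of_succ_lt_succ hi⟩)) hx
  obtain ⟨x, hx⟩ := key p.length (Nat.lt_succ_self _)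
  have h1 : IndepMod (k := k) (⊥ : Ideal (MvPolynomial τ k)) fun i => aeval G (x i) := by
    intro q hq
    refine hx q ?_
    have h2 : aeval G (aeval x q) = 0 := by
      rw [comp_aeval_apply]
      exact Ideal.mem_bot.1 hq
    rintro _ ⟨F, -, rfl⟩
    exact hX _ h2 F.1 F.2
  exact_mod_cast h1.le_card

/-- A set of forms containing a polynomial family whose parameters are rational functions of the
forms has dimension at least the number of parameters. -/
theorem card_le_topologicalKrullDim [Infinite k] (G : Monom n j → MvPolynomial τ k)
    {D : MvPolynomial τ k} {x₀ : τ → k} (hD : eval x₀ D ≠ 0) (h : τ → MvPolynomial (Monom n j) k)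
    (hh : ∀ x, eval x D ≠ 0 → ∀ t, evalForm (formAt G x) (h t) = 0 ↔ x t = x₀ t)
    {X : Set (Form k n j)} (hX : ∀ x, eval x D ≠ 0 → formAt G x ∈ X) :
    ((Fintype.card τ : ℕ) : WithBot ℕ∞) ≤ topologicalKrullDim X := by
  classical
  let m := Fintype.card τ
  let e : Fin m ≃ τ := (Fintype.equivFin τ).symm
  -- Members of the family whose parameters numbered i and above are frozen at x₀; their closures
  -- form the chain.
  let S : Fin (m + 1) → Set (Form k n j) := fun i =>
    {F | ∃ x, (eval x D ≠ 0 ∧ ∀ t : Fin m, i ≤ t.castSucc → x (e t) = x₀ (e t)) ∧ formAt G x = F}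
  have hSX : ∀ i, S i ⊆ X := by
    rintro i _ ⟨x, hx, rfl⟩
    exact hX x hx.1
  have hSirr : ∀ i, IsIrreducible (S i) := by
    intro i
    let s : τ → MvPolynomial τ k := fun t =>
      if i ≤ (e.symm t).castSucc then C (x₀ t) else MvPolynomial.X t
    have hs : ∀ x, (∀ t : Fin m, i ≤ t.castSucc → x (e t) = x₀ (e t)) →
        (fun t => eval x (s t)) = x := by
      intro x hx
      ext t
      by_cases ht : i ≤ (e.symm t).castSucc
      · simpa [s, ht] using (hx _ ht).symm
      · simp [s, ht]
    have h1 : S i = {F | ∃ x, eval x (aeval s D) ≠ 0 ∧ formAt (fun m => aeval s (G m)) x = F} := by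
      ext F
      constructor
      · rintro ⟨x, ⟨hx, hxi⟩, rfl⟩
        refine ⟨x, ?_, formAt_eq fun m => ?_⟩
        · rwa [eval_aeval, hs x hxi]
        · rw [eval_aeval, hs x hxi, coeff_formAt]
      · rintro ⟨x, hx, rfl⟩
        refine ⟨fun t => eval x (s t), ⟨?_, fun t ht => ?_⟩, formAt_eq fun m => ?_⟩
        · rwa [eval_aeval] at hx
        · simp [s, ht]
        · rw [coeff_formAt, eval_aeval]
    rw [h1]
    refine isIrreducible_range_formAt _ fun h0 => hD ?_
    have h2 := eval_aeval s x₀ D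
    rw [h0, map_zero, hs x₀ fun _ _ => rfl] at h2
    exact h2.symm
  let Z : Fin (m + 1) → TopologicalSpace.IrreducibleCloseds X := fun i =>
    closureIn X (hSirr i) (hSX i)
  have hZ : StrictMono Z := by
    refine Fin.strictMono_iff_lt_succ.2 fun i => ?_
    refine lt_of_le_not_ge ?_ fun hle => ?_
    · refine closure_mono (Set.preimage_mono ?_)
      rintro _ ⟨x, ⟨hx, hxi⟩, rfl⟩
      exact ⟨x, ⟨hx, fun t ht => hxi t (i.castSucc_lt_succ.le.trans ht)⟩, rfl⟩
    -- For strictness, move the i-th parameter away from x₀ by some c ≠ 0 that keeps D nonzero. The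
    -- function h (e i) vanishes on the smaller closure but not at this member.
    · let u : τ → Polynomial k := fun t =>
        Polynomial.C (x₀ t) + if t = e i then Polynomial.X else 0
      have hu : ∀ c, (aeval u D : Polynomial k).eval c =
          eval (fun t => x₀ t + if t = e i then c else 0) D := by
        intro c
        rw [polynomial_eval_aeval]
        congr 2
        ext t
        by_cases ht : t = e i <;> simp [u, ht]
      have hc : ∃ c ≠ 0, eval (fun t => x₀ t + if t = e i then c else 0) D ≠ 0 := by
        by_contra! hcon
        have h1 := polynomial_eval_zero_of_forall_ne (q := (aeval u D : Polynomial k))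
          fun c hc => by rw [hu, hcon c hc]
        rw [hu] at h1
        exact hD (by simpa using h1)
      obtain ⟨c, hc0, hcD⟩ := hc
      let x : τ → k := fun t => x₀ t + if t = e i then c else 0
      have hxS : formAt G x ∈ S i.succ := by
        refine ⟨x, ⟨hcD, fun t ht => ?_⟩, rfl⟩
        have hti : t ≠ i := by
          rintro rfl
          exact absurd ht (not_le.2 t.castSucc_lt_succ)
        simp [x, hti]
      have h1 : (⟨formAt G x, hSX _ hxS⟩ : X) ∈ Z i.succ :=
        subset_closure (s := (Subtype.val ⁻¹' S i.succ : Set X)) hxS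
      have h2 := mem_closure_iff_evalForm.1 (val_mem_closure_of_mem (S := S i.castSucc) (hle h1))
        (h (e i)) (by
          rintro _ ⟨y, ⟨hy, hyi⟩, rfl⟩
          exact (hh y hy (e i)).2 (hyi i le_rfl))
      have h3 := (hh x hcD (e i)).1 h2
      simp [x, hc0] at h3
  exact Order.LTSeries.length_le_krullDim (LTSeries.mk m Z hZ)

end Dimension
end Catalecticant

namespace Catalecticant

/-! ### The chart of U normalized at the pure powers. -/

section PureMonomials
variable {k : Type*} [Field k] {n d : ℕ}

theorem pureMonom_injective (hd : d ≠ 0) : Function.Injective (pureMonom n d) := fun _ _ h =>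
  Finsupp.single_left_injective hd (congrArg Subtype.val h)

theorem card_compl_range_pureMonom (hn : 0 < n) (hd : d ≠ 0)
    [Fintype ↥(Set.range (pureMonom n d))ᶜ] :
    Fintype.card ↥(Set.range (pureMonom n d))ᶜ = dimK n d - n := by
  classical
  rw [Fintype.card_compl_set, card_monom_dimK hn,
    Set.card_range_of_injective (pureMonom_injective hd), Fintype.card_fin]

/-- A numbering of the monomials in which the pure powers come last. -/
theorem exists_cols_pureMonom (hn : 0 < n) (hd : d ≠ 0) :
    ∃ cols : Fin (dimK n d - n) ⊕ Fin n ≃ Monom n d,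
      ∀ j, cols (Sum.inr j) = pureMonom n d j := by
  classical
  refine ⟨(((Fintype.equivFinOfCardEq (card_compl_range_pureMonom hn hd)).symm.sumCongr
    (Equiv.ofInjective _ (pureMonom_injective hd))).trans (Equiv.sumComm _ _)).trans
      (Equiv.Set.sumCompl _), fun j => ?_⟩
  simp

theorem coeff_X_pow_pureMonom (i j : Fin n) (hd : d ≠ 0) :
    coeff (pureMonom n d j).1 ((X i : MvPolynomial (Fin n) k) ^ d) = if j = i then 1 else 0 := by
  rw [coeff_X_pow]
  refine if_congr ⟨fun h => ?_, fun h => by rw [h]; rfl⟩ rfl rfl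
  exact (Finsupp.single_left_injective hd h).symm

variable [CharZero k]

/-- A tuple normalized at the pure powers is already reduced with respect to the last n columns, so
it must be the canonical basis. -/
theorem MinorChoice.kernelVec_eq {α : MinorChoice n d}
    (hα : ∀ j, α.cols (Sum.inr j) = pureMonom n d j) {F : Form k n (n * (d - 1))}
    (hF : (α.blockA F.1).det ≠ 0) {a : Fin n × Monom n d → k}
    (ha : ∀ i, tupleForm a i ∈ annihilator F.1)
    (hpure : ∀ i j, a (i, pureMonom n d j) = if j = i then 1 else 0) (t : Fin n × Monom n d) :
    α.kernelVec F.1 t.1 t.2 = a t := by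
  have h1 := (catMatrix_mulVec_eq_zero F fun m => a (t.1, m)).2 ⟨ha t.1, formOf_isHomogeneous _⟩
  have h2 := congrFun (α.eq_sum_kernelVec hF (v := fun m => a (t.1, m)) (by rw [h1]; rfl)) t.2
  simp only [hα, hpure, Finset.sum_apply, Pi.smul_apply, smul_eq_mul, ite_mul, one_mul, zero_mul,
    Finset.sum_ite_eq', Finset.mem_univ, if_true] at h2
  exact h2.symm

variable [IsAlgClosed k]

/-- A relation among the other columns is a form of degree d in F^⊥ without pure powers; but the
pure powers span that space, so the relation is trivial. -/
theorem exists_minorChoice_pureMonom (hn : 2 ≤ n) (hd : 2 ≤ d) {F : Form k n (n * (d - 1))}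
    (hF : F ≠ 0) (hann : ∀ i, X i ^ d ∈ annihilator F.1) :
    ∃ α : MinorChoice n d, (∀ j, α.cols (Sum.inr j) = pureMonom n d j) ∧
      (α.blockA F.1).det ≠ 0 := by
  obtain ⟨cols, hcols⟩ := exists_cols_pureMonom (n := n) (d := d) (by omega) (by omega)
  obtain ⟨α, rfl, hα⟩ := exists_minorChoice (F := F.1) cols (by
    rw [Fintype.linearIndependent_iff]
    intro c hc i
    let v : Monom n d → k := fun m => Sum.elim c 0 (cols.symm m)
    have hv : (catMatrix d F.1).mulVec v = 0 := by
      rw [← hc]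
      ext l
      rw [Matrix.mulVec, dotProduct, ← Equiv.sum_comp cols, Fintype.sum_sum_type]
      simp [v, Finset.sum_apply, mul_comm]
    have h1 := (catMatrix_mulVec_eq_zero F v).1 hv
    have hX : ∀ i : Fin n, ((X i : MvPolynomial (Fin n) k) ^ d).IsHomogeneous d :=
      fun i => isHomogeneous_X_pow i d
    have h2 : annihilatorDeg F.1 d = _ :=
      (noCommonZero_X_pow d).idealDeg_annihilator (by omega) hX (by omega) hF hann d
    rw [h2, idealDeg_span_self hX] at h1
    obtain ⟨b, hb⟩ := (Submodule.mem_span_range_iff_exists_fun k).1 h1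
    have h3 := congrArg (coeff (cols (Sum.inl i)).1) hb
    rw [coeff_formOf, coeff_sum, Finset.sum_eq_zero] at h3
    · simpa [v] using h3.symm
    · intro j _
      rw [coeff_smul, coeff_X_pow, if_neg, smul_zero]
      intro h4
      have h5 : cols (Sum.inr j) = cols (Sum.inl i) := by
        rw [hcols]; exact Subtype.ext h4
      exact Sum.inr_ne_inl (cols.injective h5))
  exact ⟨α, hcols, hα⟩

end PureMonomials

/-! ### Rational coordinates on U_Res and its dimension. -/

section Chart

/-- The parameters of the family of forms apolar to `n` forms of degree `d` that are normalized at
the pure powers: the other coefficients of these forms, and a scalar. -/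
abbrev ChartIndex (n d : ℕ) : Type :=
  Option (Fin n × ↥(Set.range (pureMonom n d))ᶜ)

variable (k : Type*) [Field k] (n d : ℕ)

open Classical in
/-- The coefficients of `n` forms of degree `d` that are normalized at the pure powers. -/
noncomputable def chartTuple (t : Fin n × Monom n d) : MvPolynomial (ChartIndex n d) k :=
  if h : t.2 ∈ (Set.range (pureMonom n d))ᶜ then X (some (t.1, ⟨t.2, h⟩))
  else if t.2 = pureMonom n d t.1 then 1 else 0

variable {k n d}

theorem eval_chartTuple_pureMonom (hd : d ≠ 0) (x : ChartIndex n d → k) (i j : Fin n) :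
    eval x (chartTuple k n d (i, pureMonom n d j)) = if j = i then 1 else 0 := by
  have h : pureMonom n d j ∉ (Set.range (pureMonom n d))ᶜ := fun h => h ⟨j, rfl⟩
  rw [chartTuple, dif_neg h]
  by_cases hij : j = i
  · simp [hij]
  · rw [if_neg hij, if_neg fun h => hij (pureMonom_injective hd h), map_zero]

theorem eval_chartTuple_of_notMem (x : ChartIndex n d → k) (i : Fin n)
    (m : ↥(Set.range (pureMonom n d))ᶜ) :
    eval x (chartTuple k n d (i, m.1)) = x (some (i, m)) := by
  rw [chartTuple, dif_pos m.2, eval_X]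

theorem eval_chartTuple_eq (hd : d ≠ 0) {a : Fin n × Monom n d → k}
    (ha : ∀ i j, a (i, pureMonom n d j) = if j = i then 1 else 0) {x : ChartIndex n d → k}
    (hx : ∀ t, x (some t) = a (t.1, t.2.1)) : (fun t => eval x (chartTuple k n d t)) = a := by
  ext ⟨i, m⟩
  by_cases hm : m ∈ Set.range (pureMonom n d)
  · obtain ⟨j, rfl⟩ := hm
    rw [eval_chartTuple_pureMonom hd, ha]
  · rw [eval_chartTuple_of_notMem x i ⟨m, hm⟩, hx]

/-- n(K - n) is the dimension of the Grassmannian of n-dimensional spaces of degree d forms; the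
extra parameter is the scale of F. -/
theorem card_chartIndex (hn : 2 ≤ n) (hd : 2 ≤ d) [Fintype (ChartIndex n d)] :
    Fintype.card (ChartIndex n d) = dimK n d * n - n ^ 2 + 1 := by
  classical
  rw [← Nat.card_eq_fintype_card, Finite.card_option, Nat.card_prod, Nat.card_fin,
    Nat.card_eq_fintype_card, card_compl_range_pureMonom (by omega) (by omega), Nat.mul_sub, mul_comm, sq]

variable [CharZero k] [IsAlgClosed k]

/-- A dense part of `U_Res` is parametrized, with a rational inverse. -/
theorem exists_chart_family (hn : 2 ≤ n) (hd : 2 ≤ d) :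
    ∃ (G : Monom n (n * (d - 1)) → MvPolynomial (ChartIndex n d) k)
      (D : MvPolynomial (ChartIndex n d) k) (x₀ : ChartIndex n d → k)
      (h : ChartIndex n d → MvPolynomial (Monom n (n * (d - 1))) k), eval x₀ D ≠ 0 ∧
      (∀ x, eval x D ≠ 0 → formAt G x ∈ locusURes k n d) ∧
      (∀ x, eval x D ≠ 0 → ∀ t, evalForm (formAt G x) (h t) = 0 ↔ x t = x₀ t) ∧
      ∀ p, aeval G p = 0 → ∀ F ∈ locusURes k n d, evalForm F p = 0 := by
  have hX : ∀ i : Fin n, ((X i : MvPolynomial (Fin n) k) ^ d).IsHomogeneous d :=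
    fun i => isHomogeneous_X_pow i d
  have hcz := noCommonZero_X_pow (k := k) (n := n) d
  obtain ⟨F₀, hF₀, hann₀⟩ := hcz.exists_form (by omega) hX (by omega)
  have hF₀R := mem_locusURes_of_noCommonZero hn hd hF₀ hcz hX hann₀
  obtain ⟨α, hα, hdet₀⟩ := exists_minorChoice_pureMonom hn hd hF₀ hann₀
  -- The base point: scale 1 and the tuple of pure powers.
  let x₀ : ChartIndex n d → k := fun t => t.elim 1 fun _ => 0
  let a₀ : Fin n × Monom n d → k := fun t => coeff t.2.1 ((X t.1 : MvPolynomial (Fin n) k) ^ d)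
  have hx₀ : (fun t => eval x₀ (chartTuple k n d t)) = a₀ := by
    refine eval_chartTuple_eq (by omega) (fun i j => coeff_X_pow_pureMonom i j (by omega)) ?_
    rintro ⟨i, m, hm⟩
    change 0 = coeff m.1 (X i ^ d)
    rw [coeff_X_pow, if_neg]
    exact fun h => hm ⟨i, Subtype.ext h⟩
  have ha₀ : tupleForm a₀ = fun i => (X i : MvPolynomial (Fin n) k) ^ d := tupleForm_coeff hX
  obtain ⟨Δ, hΔ₀, hΔ⟩ := exists_separating (a₀ := a₀) (by omega) (by omega) (by rwa [ha₀])
  obtain ⟨G, δ, m₀, hδ₀, hG₀, hG⟩ := exists_local_section (a₀ := a₀) hn hd (by rwa [ha₀]) hF₀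
    (by rw [ha₀]; exact hann₀)
  obtain ⟨num, hnum⟩ := α.exists_kernelVec_eq_div (k := k)
  obtain ⟨δ', N, hδ'⟩ := α.exists_evalForm_eq δ
  let Φ : Monom n (n * (d - 1)) → MvPolynomial (ChartIndex n d) k :=
    fun m => X none * aeval (chartTuple k n d) (G m)
  have hΦ : ∀ x, formAt Φ x = x none • formAt G fun t => eval x (chartTuple k n d t) := by
    intro x
    refine formAt_eq fun m => ?_
    rw [map_mul, eval_X, eval_aeval]
    exact congrArg (x none * ·) (coeff_formAt _ _ _).symm
  have hΦ₀ : formAt Φ x₀ = F₀ := by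
    rw [hΦ, hx₀, hG₀]
    exact one_smul k F₀
  -- Where D is nonzero the scale is nonzero, the tuple has no common zero, the local section is
  -- valid and the minor of α does not vanish.
  let D : MvPolynomial (ChartIndex n d) k :=
    X none * (aeval (chartTuple k n d) (Δ * δ) * aeval Φ (α.detPoly k))
  have hDiff : ∀ x, eval x D ≠ 0 ↔ x none ≠ 0 ∧
      (eval (fun t => eval x (chartTuple k n d t)) Δ ≠ 0 ∧
        eval (fun t => eval x (chartTuple k n d t)) δ ≠ 0) ∧
      (α.blockA (formAt Φ x).1).det ≠ 0 := by
    intro x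
    simp only [D, map_mul, mul_ne_zero_iff, eval_X, eval_aeval]
    rw [← eval_aeval Φ, ← evalForm_formAt, α.evalForm_detPoly]
  have hfam : ∀ x, eval x D ≠ 0 → formAt Φ x ∈ locusURes k n d ∧
      (∀ t, α.kernelVec (formAt Φ x).1 t.1 t.2 = eval x (chartTuple k n d t)) ∧
      coeff m₀.1 (formAt Φ x).1 = x none * eval (fun t => eval x (chartTuple k n d t)) δ := by
    intro x hx
    obtain ⟨hx0, ⟨hxΔ, hxδ⟩, hdet⟩ := (hDiff x).1 hx
    have hcz : NoCommonZero (tupleForm fun t => eval x (chartTuple k n d t)) := by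
      by_contra hcon
      exact hxΔ (hΔ _ (mem_commonZeroLocus.2 hcon))
    obtain ⟨h1, h2⟩ := hG _ hcz hxδ
    have h3 : coeff m₀.1 (formAt Φ x).1 =
        x none * eval (fun t => eval x (chartTuple k n d t)) δ := by
      rw [coeff_formAt, map_mul, eval_X, eval_aeval, h2]
    have h4 : ∀ i, tupleForm (fun t => eval x (chartTuple k n d t)) i ∈
        annihilator (formAt Φ x).1 := by
      intro i
      rw [hΦ]
      change diffOp k n _ (_ • _) = 0
      rw [map_smul, mem_annihilator.1 (h1 i), smul_zero]
    refine ⟨mem_locusURes_of_noCommonZero hn hd (fun h0 => ?_) hcz (tupleForm_isHomogeneous _) h4,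
      α.kernelVec_eq hα hdet h4 (eval_chartTuple_pureMonom (by omega) x), h3⟩
    rw [h0] at h3
    exact mul_ne_zero hx0 hxδ h3.symm
  have hδa₀ : eval (fun t => α.kernelVec F₀.1 t.1 t.2) δ ≠ 0 := by
    have : (fun t : Fin n × Monom n d => α.kernelVec F₀.1 t.1 t.2) = a₀ := by
      ext t
      exact α.kernelVec_eq hα hdet₀ (by rw [ha₀]; exact hann₀)
        (fun i j => coeff_X_pow_pureMonom i j (by omega)) t
    rwa [this]
  -- The inverse functions, compared with x₀ after clearing denominators. The tuple is the canonical
  -- basis, given by quotients by the minor; the scale is the coefficient at m₀ divided by δ, and δ'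
  -- is δ at the canonical tuple times a power of the minor.
  refine ⟨Φ, D, x₀, fun t => t.elim (X m₀ * α.detPoly k ^ N - δ') fun t =>
    num (t.1, t.2.1) - C (x₀ (some t)) * α.detPoly k, ?_, fun x hx => (hfam x hx).1, ?_, ?_⟩
  · rw [hDiff, hx₀, hΦ₀]
    exact ⟨one_ne_zero, ⟨hΔ₀, hδ₀⟩, hdet₀⟩
  · intro x hx t
    obtain ⟨-, ⟨-, hxδ⟩, hdet⟩ := (hDiff x).1 hx
    obtain ⟨-, hker, hcoeff⟩ := hfam x hx
    rcases t with _ | ⟨i, m⟩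
    · simp only [Option.elim_none, map_sub, map_mul, map_pow, evalForm_X, α.evalForm_detPoly,
        hδ' _ hdet, hker, hcoeff]
      change _ ↔ x none = 1
      rw [show x none * eval (fun t => eval x (chartTuple k n d t)) δ *
          (α.blockA (formAt Φ x).1).det ^ N - (α.blockA (formAt Φ x).1).det ^ N *
          eval (fun t => eval x (chartTuple k n d t)) δ =
          ((α.blockA (formAt Φ x).1).det ^ N * eval (fun t => eval x (chartTuple k n d t)) δ) *
          (x none - 1) by ring, mul_eq_zero, or_iff_right (mul_ne_zero (pow_ne_zero _ hdet) hxδ),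
        sub_eq_zero]
    · have h1 := hnum (formAt Φ x) hdet (i, m.1)
      rw [hker, α.evalForm_detPoly, eval_chartTuple_of_notMem, eq_div_iff hdet] at h1
      simp only [Option.elim_some, map_sub, map_mul, α.evalForm_detPoly, ← h1]
      rw [← algebraMap_eq, AlgHom.commutes, ← sub_mul, mul_eq_zero, or_iff_left hdet, sub_eq_zero]
      rfl
  · intro p hp F hF
    by_contra hpF
    -- By irreducibility p is also nonzero at a form of U_Res where the minor and δ are nonzero, and
    -- such a form is a member of the family.
    obtain ⟨E, hE, hpE, hqE⟩ := (isIrreducible_iff_evalForm.1 (isIrreducible_locusURes hn hd)).2 p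
      (α.detPoly k * δ') ⟨F, hF, hpF⟩ ⟨F₀, hF₀R, by
        rw [map_mul, hδ' F₀ hdet₀, α.evalForm_detPoly]
        exact mul_ne_zero hdet₀ (mul_ne_zero (pow_ne_zero _ hdet₀) hδa₀)⟩
    rw [map_mul, mul_ne_zero_iff, α.evalForm_detPoly] at hqE
    obtain ⟨hdet, hδE⟩ := hqE
    rw [hδ' E hdet, mul_ne_zero_iff] at hδE
    have hch : E ∈ α.chart k := ⟨(exists_noCommonZero_of_mem_locusURes hn hd hE).1, hdet⟩
    have hczE := (resultant_ne_zero_iff (by omega) (by omega)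
      (α.canonicalForm_isHomogeneous E.1)).1 ((mem_locusURes_iff_resultant hn hd hch).1 hE)
    obtain ⟨hannG, hGm⟩ := hG (fun t => α.kernelVec E.1 t.1 t.2) hczE hδE.2
    have hG0 : formAt G (fun t => α.kernelVec E.1 t.1 t.2) ≠ 0 := by
      intro h0
      rw [← coeff_formAt, h0] at hGm
      exact hδE.2 hGm.symm
    obtain ⟨c, hc⟩ := hczE.form_unique (by omega) (α.canonicalForm_isHomogeneous E.1) (by omega)
      hG0 hannG (α.canonicalForm_mem hn hd hch)
    let x : ChartIndex n d → k := fun t => t.elim c fun t => α.kernelVec E.1 t.1 t.2.1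
    have hx : (fun t => eval x (chartTuple k n d t)) = fun t => α.kernelVec E.1 t.1 t.2 := by
      refine eval_chartTuple_eq (by omega) (fun i j => ?_) fun t => rfl
      rw [← hα, α.kernelVec_inr, Pi.single_apply]
    have hEx : formAt Φ x = E := by
      rw [hΦ, hx]
      exact hc.symm
    rw [← hEx, evalForm_formAt, hp, map_zero] at hpE
    exact hpE rfl

/-- The upper bound uses only that polynomials vanishing on the family vanish on U_Res and hence on
its closure, the lower one only that the family lies in U_Res. Any set in between therefore has the
same dimension. -/
theorem topologicalKrullDim_eq (hn : 2 ≤ n) (hd : 2 ≤ d) {Y : Set (Form k n (n * (d - 1)))}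
    (hY : locusURes k n d ⊆ Y) (hY' : Y ⊆ closure (locusURes k n d)) :
    topologicalKrullDim Y = ((dimK n d * n - n ^ 2 + 1 : ℕ) : WithBot ℕ∞) := by
  classical
  have hinf : Infinite k := IsAlgClosed.instInfinite
  obtain ⟨G, D, x₀, h, hD, hG, hh, hp⟩ := exists_chart_family (k := k) hn hd
  rw [← card_chartIndex hn hd]
  exact le_antisymm
    (topologicalKrullDim_le_card G fun p hp0 F hF => mem_closure_iff_evalForm.1 (hY' hF) p
      (hp p hp0))
    (card_le_topologicalKrullDim G hD h hh fun x hx => hY (hG x hx))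

end Chart
end Catalecticant

/-! ### The irreducible components and the main theorem. -/

namespace Catalecticant

/-- The closure of a relatively open irreducible subset is an irreducible component. -/
theorem exists_isIrredComponentOf {α : Type*} [TopologicalSpace α] {S X O : Set α}
    (hS : IsIrreducible S) (hO : IsOpen O) (h : S = X ∩ O) :
    ∃ C, IsIrredComponentOf C X ∧ S ⊆ C ∧ C ⊆ X ∧ C ⊆ closure S := by
  have hSX : S ⊆ X := h ▸ Set.inter_subset_left
  have hpre : (Subtype.val ⁻¹' S : Set X) = Subtype.val ⁻¹' O := by
    ext x
    simp [h]
  have hopen : IsOpen (Subtype.val ⁻¹' S : Set X) := hpre ▸ hO.preimage continuous_subtype_val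
  refine ⟨_, ⟨closure (Subtype.val ⁻¹' S : Set X), ⟨(closureIn X hS hSX).isIrreducible,
    fun T hT hle => ?_⟩, rfl⟩, ?_, Subtype.coe_image_subset _ _, ?_⟩
  · obtain ⟨x, hx⟩ := hS.1
    have hne : (T ∩ Subtype.val ⁻¹' S).Nonempty :=
      ⟨⟨x, hSX hx⟩, hle (subset_closure hx), hx⟩
    exact (subset_closure_inter_of_isPreirreducible_of_isOpen hT.2 hopen hne).trans
      (closure_mono Set.inter_subset_right)
  · exact fun x hx => ⟨⟨x, hSX hx⟩, subset_closure hx, rfl⟩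
  · rintro _ ⟨x, hx, rfl⟩
    exact val_mem_closure_of_mem hx

theorem eq_diff_of_subset {α : Type*} {S C Y W : Set α} (h : S = Y \ W) (hSC : S ⊆ C)
    (hCY : C ⊆ Y) : S = C \ W :=
  Set.Subset.antisymm (fun x hx => ⟨hSC hx, (h ▸ hx : x ∈ Y \ W).2⟩)
    fun _ hx => h ▸ ⟨hCY hx.1, hx.2⟩

end Catalecticant

theorem mainTheorem2 {k : Type*} [Field k] [IsAlgClosed k] [CharZero k] (n d : ℕ)
    (hn : 2 ≤ n) (hd : 2 ≤ d) :
    IsClosed ((↑) ⁻¹' Catalecticant.locusZ k n d : Set ↥(Catalecticant.varU k n d)) ∧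
    ∃ GorT₀ U₀ V₀ : Set (Catalecticant.Form k n (n * (d - 1))),
      Catalecticant.IsIrredComponentOf GorT₀ (Catalecticant.varGor k n d) ∧
      Catalecticant.IsIrredComponentOf U₀ (Catalecticant.varU k n d) ∧
      Catalecticant.IsIrredComponentOf V₀ (Catalecticant.varV k n d) ∧
      Catalecticant.locusURes k n d = GorT₀ \ Catalecticant.locusZ k n d ∧
      Catalecticant.locusURes k n d = U₀ \ Catalecticant.locusZ k n d ∧
      Catalecticant.locusURes k n d = V₀ \ closure (Catalecticant.locusZ k n d) ∧
      topologicalKrullDim ↥GorT₀ =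
        ((Catalecticant.dimK n d * n - n ^ 2 + 1 : ℕ) : WithBot ℕ∞) ∧
      topologicalKrullDim ↥U₀ =
        ((Catalecticant.dimK n d * n - n ^ 2 + 1 : ℕ) : WithBot ℕ∞) ∧
      topologicalKrullDim ↥V₀ =
        ((Catalecticant.dimK n d * n - n ^ 2 + 1 : ℕ) : WithBot ℕ∞) := by
  obtain ⟨O, hO, hVO⟩ := Catalecticant.exists_isOpen_locusURes (k := k) hn hd
  have hirr := Catalecticant.isIrreducible_locusURes (k := k) hn hd
  have hGor := Catalecticant.locusURes_subset_varGor (k := k) hn hd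
  have hGorU := Catalecticant.varGor_subset_varU (k := k) hn hd
  have hUV : Catalecticant.varU k n d ⊆ Catalecticant.varV k n d := fun F hF => le_of_eq hF
  -- The open set that cuts U_Res out of V also cuts it out of every set between U_Res and V, in
  -- particular out of Gor(T) and U.
  have hO' : ∀ Y : Set (Catalecticant.Form k n (n * (d - 1))), Catalecticant.locusURes k n d ⊆ Y → Y ⊆ Catalecticant.varV k n d →
      Catalecticant.locusURes k n d = Y ∩ O := by
    intro Y hY hYV
    refine Set.Subset.antisymm (fun F hF => ⟨hY hF, ?_⟩) fun F hF => ?_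
    · exact (hVO ▸ hF : F ∈ Catalecticant.varV k n d ∩ O).2
    · exact hVO ▸ ⟨hYV hF.1, hF.2⟩
  obtain ⟨A, hA, hAS, hAX, hAc⟩ :=
    Catalecticant.exists_isIrredComponentOf hirr hO (hO' _ hGor (hGorU.trans hUV))
  obtain ⟨B, hB, hBS, hBX, hBc⟩ := Catalecticant.exists_isIrredComponentOf hirr hO (hO' _ (hGor.trans hGorU) hUV)
  obtain ⟨E, hE, hES, hEX, hEc⟩ := Catalecticant.exists_isIrredComponentOf hirr hO hVO
  have hU := Catalecticant.locusURes_eq_diff (k := k) hn hd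
  exact ⟨Catalecticant.isClosed_locusZ hn hd, A, B, E, hA, hB, hE, Catalecticant.eq_diff_of_subset hU hAS (hAX.trans hGorU),
    Catalecticant.eq_diff_of_subset hU hBS hBX, Catalecticant.eq_diff_of_subset (Catalecticant.varV_diff_closure_locusZ hn hd).symm hES hEX,
    Catalecticant.topologicalKrullDim_eq hn hd hAS hAc, Catalecticant.topologicalKrullDim_eq hn hd hBS hBc,
    Catalecticant.topologicalKrullDim_eq hn hd hES hEc⟩
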